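/- An $n\times n$ chess position ($n$ arbitrary) assigns to every square of an $n\times n$ board either nothing or a white or black pawn, rook, knight, bishop, queen or king, and designates the player who moves next. Moves follow the FIDE rules on the $n\times n$ board: rooks, bishops and queens slide any distance; a pawn on its second rank that has not moved may advance two squares, with en passant capture possible on the next move; a pawn reaching the last rank is promoted to a queen, rook, bishop or knight; kings are never captured, and no player may leave his own king in check. Castling takes place on the player's own first rank between a king and a rook that have not moved during the play, with at least two squares between them, all of them empty: the king moves two squares towards the rook, the rook goes to the square the king crossed, and neither the square the king leaves nor the one it crosses nor the one it reaches may be attacked. Draw rules (repetition, move counting, dead positions) do not restrict the sequences of moves. At the beginning of a sequence of moves nothing counts as having moved, and no en passant capture is available. **Helpmate.** Given an $n\times n$ position with exactly one king of each color in which the player who is not to move is not in check, is there a finite (possibly empty) sequence of legal moves, with the players alternating, to a position in which the black king is checkmated? **Reachability.** Given an $n\times n$ position, is there a finite (possibly empty) sequence of legal moves leading to it (same pieces on the same squares, same player to move) from some natural starting position? Here, for a fixed rational number $q$ and a fixed integer $m\ge 0$, a natural starting position is one with White to move in which the first two ranks are filled with white pieces, the last two ranks with black pieces, and the rest of the board is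 empty; the second and the second-to-last rank consist of pawns; the first and the last rank contain no pawns, exactly one king each, and at least $qn+m$ queens, rooks, bishops and knights each. An instance is written as a word over a fixed finite alphabet: the player to move, followed by the contents of the squares, rank by rank, with a marker after each rank (length $n^2+n+1$). **Lemma.** For all $q$ and $m$, Helpmate and Reachability are in PSPACE: each of these two languages is decided by a deterministic multi-stack Turing machine (finitely many states and stacks, finite alphabets) that halts on every input word and uses a number of memory cells bounded by a polynomial in the length of the input. Both statements also hold when castling is left out of the rules. -/

import Mathlib

/-! ### Polynomial space -/

namespace PolySpace

open Turing

/-- The number of memory cells (stack entries) in use in a configuration of a multi-stack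
Turing machine. -/
def space (tm : FinTM2) (c : tm.Cfg) : ℕ :=
  ∑ k ∈ @Finset.univ tm.K tm.kFin, (c.stk k).length

/-- The deterministic machine `M`, all of whose stack alphabets are finite, decides `L` in space
`s`: on every input word `w` it halts with the correct answer on its output stack, and no
configuration of the run uses more than `s |w|` cells. -/
structure DecidesInSpace {α : Type} (M : TM2ComputableAux α Bool) (L : Language α) (s : ℕ → ℕ) :
    Prop where
  finite_alphabets : ∀ k, Finite (M.tm.Γ k)
  halts : ∀ w : List α, ∃ (c : M.tm.Cfg) (b : Bool),
    StateTransition.Reaches M.tm.step (initList M.tm (w.map M.inputAlphabet.symm)) c ∧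
      c.l = none ∧ c.stk M.tm.k₁ = [M.outputAlphabet.symm b] ∧ (b = true ↔ w ∈ L)
  space_le : ∀ (w : List α) (c : M.tm.Cfg),
    StateTransition.Reaches M.tm.step (initList M.tm (w.map M.inputAlphabet.symm)) c →
      space M.tm c ≤ s w.length

/-- The class PSPACE of languages over the alphabet `α`. -/
def PSPACE (α : Type) : Set (Language α) :=
  {L | ∃ (M : TM2ComputableAux α Bool) (p : Polynomial ℕ), DecidesInSpace M L fun n => p.eval n}

end PolySpace

/-! ### Chess on an `n × n` board -/

namespace Chess

inductive Color where
  | white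
  | black
  deriving DecidableEq

/-- The opponent. -/
def Color.other : Color → Color
  | .white => .black
  | .black => .white

inductive Kind where
  | pawn
  | rook
  | knight
  | bishop
  | queen
  | king
  deriving DecidableEq

/-- A chess piece or pawn. -/
structure Piece where
  color : Color
  kind : Kind
  deriving DecidableEq

/-- A square is a pair (rank, file), both counted from `0`; rank `0` is the first rank, on White's
side of the board. -/
abbrev Square (n : ℕ) : Type := Fin n × Fin n

abbrev Board (n : ℕ) : Type := Square n → Option Piece

/-- A chess position: the contents of the squares, and the player who moves next. -/
structure Position (n : ℕ) where
  board : Board n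
  turn : Color

variable {n : ℕ}

/-- The rank of a square as counted from the side of the player `c`, starting from `0`. -/
def relRank (c : Color) (s : Square n) : ℕ :=
  match c with
  | .white => (s.1 : ℕ)
  | .black => (s.1.rev : ℕ)

/-- `t` is reached from `s` by `k` steps in direction `d`. -/
def Along (d : ℤ × ℤ) (k : ℕ) (s t : Square n) : Prop :=
  ((t.1 : ℕ) : ℤ) = ((s.1 : ℕ) : ℤ) + k * d.1 ∧ ((t.2 : ℕ) : ℤ) = ((s.2 : ℕ) : ℤ) + k * d.2

/-- All squares strictly between `s` and the square `k` steps further in direction `d` are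
empty. -/
def ClearPath (b : Board n) (d : ℤ × ℤ) (k : ℕ) (s : Square n) : Prop :=
  ∀ (j : ℕ) (u : Square n), 0 < j → j < k → Along d j s u → b u = none

def straight : Finset (ℤ × ℤ) := {(1, 0), (-1, 0), (0, 1), (0, -1)}

def diagonal : Finset (ℤ × ℤ) := {(1, 1), (1, -1), (-1, 1), (-1, -1)}

def knightJumps : Finset (ℤ × ℤ) :=
  {(1, 2), (1, -2), (-1, 2), (-1, -2), (2, 1), (2, -1), (-2, 1), (-2, -1)}

/-- `t` can be reached from `s` by an unobstructed slide of any positive length in one of the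
directions `D`; the square `t` itself may be occupied. -/
def Slides (b : Board n) (D : Finset (ℤ × ℤ)) (s t : Square n) : Prop :=
  ∃ d ∈ D, ∃ k : ℕ, 0 < k ∧ Along d k s t ∧ ClearPath b d k s

/-- `t` can be reached from `s` by exactly one step in one of the directions `D`. -/
def Steps (D : Finset (ℤ × ℤ)) (s t : Square n) : Prop := ∃ d ∈ D, Along d 1 s t

/-- The files of `s` and `t` are adjacent. -/
def AdjacentFile (s t : Square n) : Prop :=
  (t.2 : ℕ) = s.2 + 1 ∨ (s.2 : ℕ) = t.2 + 1

/-- The piece `p`, standing on `s`, attacks the square `t`. -/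
def Attacks (b : Board n) (p : Piece) (s t : Square n) : Prop :=
  match p.kind with
  | .pawn => relRank p.color t = relRank p.color s + 1 ∧ AdjacentFile s t
  | .rook => Slides b straight s t
  | .knight => Steps knightJumps s t
  | .bishop => Slides b diagonal s t
  | .queen => Slides b (straight ∪ diagonal) s t
  | .king => Steps (straight ∪ diagonal) s t

/-- Some piece of the player `c` attacks the square `t`. -/
def AttackedBy (b : Board n) (c : Color) (t : Square n) : Prop :=
  ∃ (s : Square n) (k : Kind), b s = some ⟨c, k⟩ ∧ Attacks b ⟨c, k⟩ s t

/-- The king of the player `c` is in check. -/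
def InCheck (b : Board n) (c : Color) : Prop :=
  ∃ t : Square n, b t = some ⟨c, .king⟩ ∧ AttackedBy b c.other t

/-- A position together with the part of the history on which moves depend: the squares from or to
which something has moved, and the square that a pawn has just passed over by a double step. -/
structure State (n : ℕ) extends Position n where
  touched : Finset (Square n)
  passed : Option (Square n)

/-- A given position, before any move. -/
def Position.toState (p : Position n) : State n where
  toPosition := p
  touched := ∅
  passed := none

/-- The state after a move of the player to move that leads to the board `b`, moves something from
or to the squares `T`, and is a double step over the square `e` if `e` is not `none`. -/
def State.next (s : State n) (b : Board n) (T : Finset (Square n)) (e : Option (Square n)) :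
    State n where
  board := b
  turn := s.turn.other
  touched := s.touched ∪ T
  passed := e

/-- The board after the contents of `x` are taken away and the piece `p` is put on `y`. -/
def Board.move (b : Board n) (x y : Square n) (p : Piece) : Board n :=
  Function.update (Function.update b x none) y (some p)

/-- `y` holds a piece of the opponent of `c` that may be captured; a king is never captured. -/
def Capturable (b : Board n) (c : Color) (y : Square n) : Prop :=
  ∃ k : Kind, k ≠ .king ∧ b y = some ⟨c.other, k⟩

/-- A pawn of the player `c` that arrives on `y` becomes a piece of kind `k`: on the last rank it
is promoted to a queen, rook, bishop or knight, elsewhere it stays a pawn. -/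
def Arrives (c : Color) (y : Square n) (k : Kind) : Prop :=
  if relRank c y + 1 = n then k = .queen ∨ k = .rook ∨ k = .bishop ∨ k = .knight else k = .pawn

/-- The moves of the player to move, without regard to whether they leave the own king in check.
Castling is included if `castling` is true. -/
inductive Move (castling : Bool) (s : State n) : State n → Prop
  | piece (x y : Square n) (k : Kind) :
      k ≠ .pawn →
      s.board x = some ⟨s.turn, k⟩ →
      Attacks s.board ⟨s.turn, k⟩ x y →
      s.board y = none ∨ Capturable s.board s.turn y →
      Move castling s (s.next (Board.move s.board x y ⟨s.turn, k⟩) {x, y} none)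
  | pawnStep (x y : Square n) (k : Kind) :
      s.board x = some ⟨s.turn, .pawn⟩ →
      relRank s.turn y = relRank s.turn x + 1 → y.2 = x.2 →
      s.board y = none →
      Arrives s.turn y k →
      Move castling s (s.next (Board.move s.board x y ⟨s.turn, k⟩) {x, y} none)
  | pawnDoubleStep (x e y : Square n) (k : Kind) :
      s.board x = some ⟨s.turn, .pawn⟩ →
      relRank s.turn x = 1 → x ∉ s.touched →
      relRank s.turn e = 2 → e.2 = x.2 → s.board e = none →
      relRank s.turn y = 3 → y.2 = x.2 → s.board y = none →
      Arrives s.turn y k →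
      Move castling s (s.next (Board.move s.board x y ⟨s.turn, k⟩) {x, y} (some e))
  | pawnCapture (x y : Square n) (k : Kind) :
      s.board x = some ⟨s.turn, .pawn⟩ →
      Attacks s.board ⟨s.turn, .pawn⟩ x y →
      Capturable s.board s.turn y →
      Arrives s.turn y k →
      Move castling s (s.next (Board.move s.board x y ⟨s.turn, k⟩) {x, y} none)
  -- En passant: `y` was passed over by the enemy pawn on `z`, which stands beside `x`.
  | enPassant (x y z : Square n) (k : Kind) :
      s.board x = some ⟨s.turn, .pawn⟩ →
      s.passed = some y →
      Attacks s.board ⟨s.turn, .pawn⟩ x y →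
      s.board y = none →
      z.1 = x.1 → z.2 = y.2 → s.board z = some ⟨s.turn.other, .pawn⟩ →
      Arrives s.turn y k →
      Move castling s
        (s.next (Function.update (Board.move s.board x y ⟨s.turn, k⟩) z none) {x, y, z} none)
  -- Castling: on the own first rank the unmoved king on `x` goes two squares towards the unmoved
  -- rook on `r`, crossing `u` and arriving on `y`, and the rook goes to `u`. All squares between
  -- the two, among them `u` and `y`, are empty, and none of `x`, `u`, `y` is attacked.
  | castle (x u y r : Square n) (d : ℤ × ℤ) (m : ℕ) :
      castling = true →
      s.board x = some ⟨s.turn, .king⟩ → relRank s.turn x = 0 → x ∉ s.touched →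
      s.board r = some ⟨s.turn, .rook⟩ → r ∉ s.touched →
      d = (0, 1) ∨ d = (0, -1) →
      3 ≤ m → Along d 1 x u → Along d 2 x y → Along d m x r → ClearPath s.board d m x →
      ¬ AttackedBy s.board s.turn.other x →
      ¬ AttackedBy s.board s.turn.other u →
      ¬ AttackedBy s.board s.turn.other y →
      Move castling s
        (s.next
          (Board.move (Board.move s.board x y ⟨s.turn, .king⟩) r u ⟨s.turn, .rook⟩)
          {x, u, y, r} none)

/-- A legal move: the player who moved is not in check afterwards. -/
def LegalMove (castling : Bool) (s t : State n) : Prop :=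
  Move castling s t ∧ ¬ InCheck t.board s.turn

/-- The player `c` is checkmated: it is the turn of `c`, whose king is in check, and `c` has no
legal move. -/
def Checkmated (castling : Bool) (s : State n) (c : Color) : Prop :=
  s.turn = c ∧ InCheck s.board c ∧ ∀ t, ¬ LegalMove castling s t

/-- `t` arises from `s` by a finite, possibly empty, sequence of legal moves. -/
def Reaches (castling : Bool) (s t : State n) : Prop :=
  Relation.ReflTransGen (LegalMove castling) s t

/-- There is exactly one king of each color, and the player who has just moved is not in check. -/
def Position.Valid (p : Position n) : Prop :=
  (∀ c : Color, ∃! s : Square n, p.board s = some ⟨c, .king⟩) ∧ ¬ InCheck p.board p.turn.other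

/-- The natural starting positions in which each player has at least `q * n + m` queens, rooks,
bishops and knights each. -/
structure Position.IsStarting (q : ℚ) (m : ℕ) (p : Position n) : Prop where
  white_begins : p.turn = .white
  pawns : ∀ (c : Color) (s : Square n), relRank c s = 1 → p.board s = some ⟨c, .pawn⟩
  pieces : ∀ (c : Color) (s : Square n), relRank c s = 0 →
    ∃ k : Kind, k ≠ .pawn ∧ p.board s = some ⟨c, k⟩
  empty : ∀ s : Square n, (∀ c : Color, 2 ≤ relRank c s) → p.board s = none
  one_king : ∀ c : Color, ∃! s : Square n, p.board s = some ⟨c, .king⟩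
  enough : ∀ (c : Color) (k : Kind), k ≠ .pawn → k ≠ .king →
    q * n + m ≤ ((Finset.univ.filter fun s : Square n => p.board s = some ⟨c, k⟩).card : ℚ)

/-! ### The two decision problems -/

/-- The letters in which positions are written. -/
inductive Letter where
  | toMove (c : Color)
  | square (o : Option Piece)
  | endOfRank
  deriving DecidableEq

/-- A position as a word: the player to move, then rank by rank the contents of the squares. -/
def Position.encode (p : Position n) : List Letter :=
  .toMove p.turn ::
    (List.finRange n).flatMap fun i =>
      ((List.finRange n).map fun j => Letter.square (p.board (i, j))) ++ [.endOfRank]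

/-- Helpmate: the words for the positions, on boards of any size, from which some sequence of legal
moves leads to a position in which the black king is checkmated. -/
def helpmate (castling : Bool) : Language Letter :=
  {w | ∃ (n : ℕ) (p : Position n), w = p.encode ∧ p.Valid ∧
    ∃ t : State n, Reaches castling p.toState t ∧ Checkmated castling t .black}

/-- Reachability: the words for the positions, on boards of any size, to which some sequence of
legal moves leads from a natural starting position. -/
def reachability (castling : Bool) (q : ℚ) (m : ℕ) : Language Letter :=
  {w | ∃ (n : ℕ) (p : Position n), w = p.encode ∧
    ∃ (p₀ : Position n) (t : State n), p₀.IsStarting q m ∧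
      Reaches castling p₀.toState t ∧ t.toPosition = p}

end Chess

/-!
Both languages ask whether a chain of moves leads from one state of the game to another. The state
(position, squares touched so far, square passed by a pawn) is described by boundedly many letters
per square, so it is as long as the input, and reachability between objects of linear length can be
decided in polynomial space by Savitch's theorem. What takes work is to show that the rules
themselves are decidable in polynomial space. They are expressed by formulas, and the predicates
decidable in polynomial space are shown to be closed under everything that occurs in the formulas.

*The machine model.* Programs of a while language on stacks (`StackProg.Prog`) are executed step by
step by a multi-stack Turing machine. Since the machine is deterministic, one halting run that keeps
the stacks short bounds all configurations it reaches (`StackProg.mem_PSPACE_of_runs`), and programs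
only have to be analysed by their big-step semantics `StackProg.Runs`.

*Predicates on words.* `StackProg.PS L` says that the predicate `L` on the words over a finite
alphabet is decided by a program whose stacks stay polynomially short. Such predicates are closed
under Boolean operations and substitution of letters, and contain the words that a weighted finite
automaton accepts (`StackProg.PS.automaton`). They are closed under the transitive closure of
relations between words of equal length (`StackProg.PS.reflTransGen`): a chain of at most `2 ^ k`
steps is found by `k` nested guesses of a midpoint (`StackProg.halving_iff_reflTransGen`), which a
depth-first search evaluates on a stack of `k` frames, counting through all midpoints
(`StackProg.search_halving`). A quantifier over words is a transitive closure with chains of length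
two (`StackProg.PS.ex`).

*Boards.* The objects of chess are represented by words of the same length as the input, which have
one letter for each square (`StackProg.Coding`). A predicate is `StackProg.Definable` if it is
decided in polynomial space in this representation. Functions that act square by square may be
substituted (`StackProg.Definable.comp`), and quantifiers, counting and transitive closure are
inherited from words. The geometry of the board enters through two relations: a step along a rank
moves the mark of a square by one place (`StackProg.definable_east`), and a step along a file moves
it by the distance between the ends of successive ranks (`StackProg.definable_north`). Sliding
pieces are the transitive closure of steps to empty squares (`StackProg.slide_iff`). With the rules
for moves rewritten in these terms (`StackProg.move_iff`), class inference shows that the two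
decision problems are definable.

*Inputs.* A word is the code of a position exactly if the squares and the other letters are arranged
in the right way. Boards are square if the number of the other letters equals the distance between
them, so that this can be checked by shifting and counting (`StackProg.PS.shape`,
`StackProg.mem_PSPACE_of_definable`).
-/


namespace StackProg

open Turing Function

/-! ### A while language on stacks -/

/-- The contents of the stacks `0, 1, 2, …`, the top of a stack being the head of the list. -/
abbrev Store : Type := ℕ → List ℕ

/-- Structured programs on stacks of natural numbers. Tests inspect the top of one stack, which is
`none` if the stack is empty. -/
inductive Prog where
  | skip
  | push (k a : ℕ)
  | pop (k : ℕ)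
  | seq (P Q : Prog)
  | ite (k : ℕ) (φ : Option ℕ → Bool) (P Q : Prog)
  | loop (k : ℕ) (φ : Option ℕ → Bool) (P : Prog)

/-- `Runs M P s t`: started in `s`, the program `P` terminates in `t`, and it never pushes onto a
stack that holds `M` entries already. -/
inductive Runs (M : ℕ) : Prog → Store → Store → Prop
  | skip (s) : Runs M .skip s s
  | push {k s} (a) : (s k).length < M → Runs M (.push k a) s (update s k (a :: s k))
  | pop (k s) : Runs M (.pop k) s (update s k (s k).tail)
  | seq {P Q s t u} : Runs M P s t → Runs M Q t u → Runs M (.seq P Q) s u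
  | iteT {k φ P Q s t} : φ (s k).head? = true → Runs M P s t → Runs M (.ite k φ P Q) s t
  | iteF {k φ P Q s t} : φ (s k).head? = false → Runs M Q s t → Runs M (.ite k φ P Q) s t
  | loopT {k φ P s t u} : φ (s k).head? = true → Runs M P s t → Runs M (.loop k φ P) t u →
      Runs M (.loop k φ P) s u
  | loopF {k φ P s} : φ (s k).head? = false → Runs M (.loop k φ P) s s

/-! ### Small steps -/

/-- One step of a program, given as the list of the programs that remain to be executed. -/
def next : List Prog × Store → Option (List Prog × Store)
  | ([], _) => none
  | (.skip :: c, s) => some (c, s)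
  | (.push k a :: c, s) => some (c, update s k (a :: s k))
  | (.pop k :: c, s) => some (c, update s k (s k).tail)
  | (.seq P Q :: c, s) => some (P :: Q :: c, s)
  | (.ite k φ P Q :: c, s) => some (if φ (s k).head? then P :: c else Q :: c, s)
  | (.loop k φ P :: c, s) => some (if φ (s k).head? then P :: .loop k φ P :: c else c, s)

/-- All stacks hold at most `M` entries. -/
def Bounded (M : ℕ) (s : Store) : Prop := ∀ k, (s k).length ≤ M

/-- A step to a store whose stacks hold at most `M` entries. -/
def BStep (M : ℕ) (a b : List Prog × Store) : Prop := next a = some b ∧ Bounded M b.2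

theorem Bounded.push {M : ℕ} {s : Store} (hs : Bounded M s) {k : ℕ} (a : ℕ)
    (h : (s k).length < M) : Bounded M (update s k (a :: s k)) := by
  intro j
  by_cases hj : j = k
  · subst hj; simpa using h
  · simpa [hj] using hs j

theorem Bounded.pop {M : ℕ} {s : Store} (hs : Bounded M s) (k : ℕ) :
    Bounded M (update s k (s k).tail) := by
  intro j
  by_cases hj : j = k
  · subst hj; have := hs j; simp; omega
  · simpa [hj] using hs j

/-- The small steps of a terminating execution, which keep the stacks bounded. -/
theorem Runs.steps {M : ℕ} {P : Prog} {s t : Store} (h : Runs M P s t) :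
    Bounded M s → Bounded M t ∧
      ∀ c, Relation.ReflTransGen (BStep M) (P :: c, s) (c, t) := by
  induction h with
  | skip s => exact fun hs => ⟨hs, fun c => .single ⟨rfl, hs⟩⟩
  | push a hl => exact fun hs => ⟨hs.push a hl, fun c => .single ⟨rfl, hs.push a hl⟩⟩
  | pop k s => exact fun hs => ⟨hs.pop k, fun c => .single ⟨rfl, hs.pop k⟩⟩
  | seq _ _ ih₁ ih₂ =>
    intro hs
    obtain ⟨ht, h₁⟩ := ih₁ hs
    obtain ⟨hu, h₂⟩ := ih₂ ht
    exact ⟨hu, fun c => .head ⟨rfl, hs⟩ ((h₁ _).trans (h₂ _))⟩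
  | iteT hφ _ ih =>
    intro hs
    obtain ⟨ht, h₁⟩ := ih hs
    exact ⟨ht, fun c => .head ⟨by simp only [next, hφ, if_true], hs⟩ (h₁ _)⟩
  | iteF hφ _ ih =>
    intro hs
    obtain ⟨ht, h₁⟩ := ih hs
    exact ⟨ht, fun c => .head ⟨by simp only [next, hφ]; rfl, hs⟩ (h₁ _)⟩
  | loopT hφ _ _ ih₁ ih₂ =>
    intro hs
    obtain ⟨ht, h₁⟩ := ih₁ hs
    obtain ⟨hu, h₂⟩ := ih₂ ht
    exact ⟨hu, fun c => .head ⟨by simp only [next, hφ, if_true], hs⟩ ((h₁ _).trans (h₂ _))⟩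
  | loopF hφ => exact fun hs => ⟨hs, fun c => .single ⟨by simp only [next, hφ]; rfl, hs⟩⟩

/-- The lists of remaining programs that occur in an execution of `P :: c`, except `c`. -/
def labels : Prog → List Prog → Set (List Prog)
  | .skip, c => {.skip :: c}
  | .push k a, c => {.push k a :: c}
  | .pop k, c => {.pop k :: c}
  | .seq P Q, c => insert (.seq P Q :: c) (labels P (Q :: c) ∪ labels Q c)
  | .ite k φ P Q, c => insert (.ite k φ P Q :: c) (labels P c ∪ labels Q c)
  | .loop k φ P, c => insert (.loop k φ P :: c) (labels P (.loop k φ P :: c))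

theorem labels_finite (P : Prog) (c : List Prog) : (labels P c).Finite := by
  induction P generalizing c with
  | skip | push | pop => exact Set.finite_singleton _
  | seq P Q ihP ihQ => exact ((ihP _).union (ihQ _)).insert _
  | ite k φ P Q ihP ihQ => exact ((ihP _).union (ihQ _)).insert _
  | loop k φ P ih => exact (ih _).insert _

theorem self_mem_labels (P : Prog) (c : List Prog) : P :: c ∈ labels P c := by
  cases P <;> simp [labels]

theorem next_mem_labels (P : Prog) (c : List Prog) {x y : List Prog} {s t : Store}
    (hx : x ∈ labels P c) (h : next (x, s) = some (y, t)) : y ∈ labels P c ∨ y = c := by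
  induction P generalizing c with
  | skip | push | pop =>
    obtain rfl := hx
    simp only [next, Option.some.injEq, Prod.mk.injEq] at h
    exact .inr h.1.symm
  | seq P Q ihP ihQ =>
    rcases hx with rfl | hx | hx
    · simp only [next, Option.some.injEq, Prod.mk.injEq] at h
      rw [← h.1]
      exact .inl (.inr (.inl (self_mem_labels _ _)))
    · rcases ihP _ hx with h | rfl
      · exact .inl (.inr (.inl h))
      · exact .inl (.inr (.inr (self_mem_labels _ _)))
    · rcases ihQ _ hx with h | rfl
      · exact .inl (.inr (.inr h))
      · exact .inr rfl
  | ite k φ P Q ihP ihQ =>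
    rcases hx with rfl | hx | hx
    · simp only [next, Option.some.injEq, Prod.mk.injEq] at h
      rw [← h.1]
      split_ifs
      · exact .inl (.inr (.inl (self_mem_labels _ _)))
      · exact .inl (.inr (.inr (self_mem_labels _ _)))
    · rcases ihP _ hx with h | rfl
      · exact .inl (.inr (.inl h))
      · exact .inr rfl
    · rcases ihQ _ hx with h | rfl
      · exact .inl (.inr (.inr h))
      · exact .inr rfl
  | loop k φ P ih =>
    rcases hx with rfl | hx
    · simp only [next, Option.some.injEq, Prod.mk.injEq] at h
      rw [← h.1]
      split_ifs
      · exact .inl (.inr (self_mem_labels _ _))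
      · exact .inr rfl
    · rcases ih _ hx with h | rfl
      · exact .inl (.inr h)
      · exact .inl (.inl rfl)

/-- The stacks and the pushed numbers that occur in the program are all less than `m`. -/
def Prog.Below (m : ℕ) : Prog → Prop
  | .skip => True
  | .push k a => k < m ∧ a < m
  | .pop k => k < m
  | .seq P Q => P.Below m ∧ Q.Below m
  | .ite k _ P Q => k < m ∧ P.Below m ∧ Q.Below m
  | .loop k _ P => k < m ∧ P.Below m

theorem Prog.Below.mono {m m' : ℕ} (h : m ≤ m') {P : Prog} (hP : P.Below m) : P.Below m' := by
  induction P with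
  | skip => trivial
  | push k a => exact ⟨hP.1.trans_le h, hP.2.trans_le h⟩
  | pop k => exact lt_of_lt_of_le hP h
  | seq P Q ihP ihQ => exact ⟨ihP hP.1, ihQ hP.2⟩
  | ite k φ P Q ihP ihQ => exact ⟨hP.1.trans_le h, ihP hP.2.1, ihQ hP.2.2⟩
  | loop k φ P ih => exact ⟨hP.1.trans_le h, ih hP.2⟩

theorem Prog.exists_below (P : Prog) : ∃ m, P.Below m := by
  induction P with
  | skip => exact ⟨0, trivial⟩
  | push k a => exact ⟨max k a + 1, by simp only [Below]; omega⟩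
  | pop k => exact ⟨k + 1, by simp only [Below]; omega⟩
  | seq P Q ihP ihQ =>
    obtain ⟨m, hm⟩ := ihP
    obtain ⟨m', hm'⟩ := ihQ
    exact ⟨max m m', hm.mono (le_max_left _ _), hm'.mono (le_max_right _ _)⟩
  | ite k φ P Q ihP ihQ =>
    obtain ⟨m, hm⟩ := ihP
    obtain ⟨m', hm'⟩ := ihQ
    exact ⟨max (k + 1) (max m m'), by omega, hm.mono (by omega), hm'.mono (by omega)⟩
  | loop k φ P ih =>
    obtain ⟨m, hm⟩ := ih
    exact ⟨max (k + 1) m, by omega, hm.mono (by omega)⟩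

theorem below_of_mem_labels {m : ℕ} (P : Prog) (c : List Prog) (hP : P.Below m)
    (hc : ∀ q ∈ c, q.Below m) : ∀ x ∈ labels P c, ∀ q ∈ x, q.Below m := by
  induction P generalizing c with
  | skip | push | pop =>
    rintro _ rfl
    simpa using ⟨hP, hc⟩
  | seq P Q ihP ihQ =>
    rintro x (rfl | hx | hx)
    · simpa using ⟨hP, hc⟩
    · exact ihP _ hP.1 (by simpa using ⟨hP.2, hc⟩) x hx
    · exact ihQ _ hP.2 hc x hx
  | ite k φ P Q ihP ihQ =>
    rintro x (rfl | hx | hx)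
    · simpa using ⟨hP, hc⟩
    · exact ihP _ hP.2.1 hc x hx
    · exact ihQ _ hP.2.2 hc x hx
  | loop k φ P ih =>
    rintro x (rfl | hx)
    · simpa using ⟨hP, hc⟩
    · exact ih _ hP.2 (by simpa using ⟨hP, hc⟩) x hx

end StackProg

namespace StackProg

open Turing Function

/-! ### Execution on a multi-stack Turing machine -/

/-- In a deterministic system, a property that holds along one halting run holds in every
configuration reached from its start. -/
theorem forall_reaches_of_halting_run {C : Type} {f : C → Option C} {good : C → Prop} {a e : C}
    (h : Relation.ReflTransGen (fun x y => f x = some y ∧ good y) a e) (ha : good a)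
    (he : f e = none) : ∀ c, StateTransition.Reaches f a c → good c := by
  induction h using Relation.ReflTransGen.head_induction_on with
  | refl =>
    intro c hc
    rcases hc.cases_head with rfl | ⟨x, hx, -⟩
    · exact ha
    · simp [he] at hx
  | head hxy _ ih =>
    intro c hc
    rcases hc.cases_head with rfl | ⟨x, hx, hxc⟩
    · exact ha
    · obtain rfl : _ = x := Option.some.inj (hxy.1.symm.trans hx)
      exact ih hxy.2 c hxc

section Machine

variable {α : Type} (m : ℕ) (code : α → ℕ) (P : Prog)

/-- The stack alphabets of the machine for a program: it has work stacks `Sum.inl k`, an input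
stack `Sum.inr false` and an output stack `Sum.inr true`. -/
abbrev Alphabet (α : Type) (m : ℕ) : Fin (m + 1) ⊕ Bool → Type
  | .inl _ => Fin (m + 1)
  | .inr false => α
  | .inr true => Bool

/-- The labels of the machine for `P`: `none` reads the input, and `some c` executes the remaining
programs `c`. -/
abbrev Label (P : Prog) : Type := Option ↥(insert [] (labels P []))

/-- The label at which the remaining programs `c` are executed. -/
noncomputable def labelOf (P : Prog) (c : List Prog) : Label P :=
  open Classical in if h : c ∈ insert [] (labels P []) then some ⟨c, h⟩ else none

/-- The code of the machine for `P` at the label for the remaining programs; a test loads the top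
of the stack into the internal state. -/
noncomputable def codeOf : List Prog → TM2.Stmt (Alphabet α m) (Label P) (Option (Fin (m + 1)))
  | [] => .peek (.inl 0) (fun _ x => x) <|
      .push (.inr true) (fun v => v == some (Fin.ofNat _ 1)) .halt
  | .skip :: c => .goto fun _ => labelOf P c
  | .push k a :: c => .push (.inl (Fin.ofNat _ k)) (fun _ => Fin.ofNat _ a) <|
      .goto fun _ => labelOf P c
  | .pop k :: c => .pop (.inl (Fin.ofNat _ k)) (fun v _ => v) <| .goto fun _ => labelOf P c
  | .seq Q R :: c => .goto fun _ => labelOf P (Q :: R :: c)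
  | .ite k φ Q R :: c => .peek (.inl (Fin.ofNat _ k)) (fun _ x => x) <|
      .branch (fun v => φ (v.map Fin.val)) (.goto fun _ => labelOf P (Q :: c))
        (.goto fun _ => labelOf P (R :: c))
  | .loop k φ Q :: c => .peek (.inl (Fin.ofNat _ k)) (fun _ x => x) <|
      .branch (fun v => φ (v.map Fin.val)) (.goto fun _ => labelOf P (Q :: .loop k φ Q :: c))
        (.goto fun _ => labelOf P c)

/-- The machine for `P`: at the label `none` it moves the input to the work stack `0`, thereby
reversing it, then it executes `P`, and finally it outputs whether the top of the work stack `0`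
is `1`. -/
noncomputable def machineCode : Label P → TM2.Stmt (Alphabet α m) (Label P) (Option (Fin (m + 1)))
  | none => .pop (.inr false) (fun _ x => x.map fun a => Fin.ofNat _ (code a)) <|
      .branch (fun v => v.isSome) (.push (.inl 0) (fun v => v.getD 0) (.goto fun _ => none))
        (.goto fun _ => labelOf P [P])
  | some c => codeOf m P c

/-- The configurations of the machine. -/
abbrev MCfg (α : Type) (m : ℕ) (P : Prog) : Type :=
  TM2.Cfg (Alphabet α m) (Label P) (Option (Fin (m + 1)))

/-- The number of memory cells in use. -/
def cells {α : Type} {m : ℕ} {P : Prog} (c : MCfg α m P) : ℕ :=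
  (∑ k : Fin (m + 1), (c.stk (.inl k)).length) +
    ((c.stk (.inr true)).length + (c.stk (.inr false)).length)

/-- The configuration `c` of the machine stands for the remaining programs and the store `x`. -/
structure Represents {α : Type} {m : ℕ} {P : Prog} (c : MCfg α m P) (x : List Prog × Store) :
    Prop where
  label : c.l = some (labelOf P x.1)
  work : ∀ k : Fin (m + 1), (c.stk (.inl k)).map Fin.val = x.2 k
  input : c.stk (.inr false) = []
  output : c.stk (.inr true) = []

theorem ofNat_val {m k : ℕ} (h : k < m + 1) : ((Fin.ofNat (m + 1) k : Fin (m + 1)) : ℕ) = k := by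
  simp [Nat.mod_eq_of_lt h]

theorem labelOf_eq {c : List Prog} (h : c ∈ insert [] (labels P [])) :
    labelOf P c = some ⟨c, h⟩ := by
  simp only [labelOf, dif_pos h]

theorem machineCode_labelOf {c : List Prog} (h : c ∈ insert [] (labels P [])) :
    machineCode m code P (labelOf P c) = codeOf (α := α) m P c := by
  rw [labelOf_eq P h]; rfl

variable {m code P}

/-- The machine simulates each step of a program by one step. -/
theorem Represents.step {c : MCfg α m P} {x y : List Prog × Store}
    (h : Represents c x) (hx : x.1 ∈ labels P []) (hm : P.Below (m + 1))
    (hxy : next x = some y) :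
    ∃ c', TM2.step (machineCode m code P) c = some c' ∧ Represents c' y := by
  obtain ⟨l, v, S⟩ := c
  obtain ⟨x, s⟩ := x
  obtain ⟨hl, hw, hi, ho⟩ := h
  dsimp only at hl hw hi ho hx
  subst hl
  refine ⟨_, rfl, ?_⟩
  rw [machineCode_labelOf m code P (.inr hx)]
  have hb := below_of_mem_labels P [] hm (by simp) x hx
  have head : ∀ k < m + 1, ((S (.inl (Fin.ofNat _ k))).head? : Option (Fin (m + 1))).map Fin.val
      = (s k).head? := by
    intro k hk
    have := hw (Fin.ofNat _ k)
    rw [ofNat_val hk] at this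
    rw [← this, List.head?_map]
  match x, hb with
  | [], _ => simp [next] at hxy
  | .skip :: d, _ =>
    simp only [next, Option.some.injEq] at hxy
    subst hxy
    exact ⟨rfl, hw, hi, ho⟩
  | .push k a :: d, hb =>
    simp only [next, Option.some.injEq] at hxy
    subst hxy
    have hk : k < m + 1 ∧ a < m + 1 := hb (.push k a) (by simp)
    refine ⟨rfl, fun j => ?_, ?_, ?_⟩
    · simp only [codeOf, TM2.stepAux]
      by_cases hj : j = Fin.ofNat _ k
      · subst hj
        have := hw (Fin.ofNat _ k)
        rw [ofNat_val hk.1] at this ⊢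
        simp only [update_self, List.map_cons, this, ofNat_val hk.2]
      · have hj' : (j : ℕ) ≠ k := fun e => hj (Fin.ext (by rw [ofNat_val hk.1, e]))
        rw [update_of_ne (by simpa using hj), update_of_ne hj', hw j]
    · simp only [codeOf, TM2.stepAux]
      rw [update_of_ne (by simp), hi]
    · simp only [codeOf, TM2.stepAux]
      rw [update_of_ne (by simp), ho]
  | .pop k :: d, hb =>
    simp only [next, Option.some.injEq] at hxy
    subst hxy
    have hk : k < m + 1 := hb (.pop k) (by simp)
    refine ⟨rfl, fun j => ?_, ?_, ?_⟩
    · simp only [codeOf, TM2.stepAux]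
      by_cases hj : j = Fin.ofNat _ k
      · subst hj
        have := hw (Fin.ofNat _ k)
        rw [ofNat_val hk] at this ⊢
        simp only [update_self, List.map_tail, this]
      · have hj' : (j : ℕ) ≠ k := fun e => hj (Fin.ext (by rw [ofNat_val hk, e]))
        rw [update_of_ne (by simpa using hj), update_of_ne hj', hw j]
    · simp only [codeOf, TM2.stepAux]
      rw [update_of_ne (by simp), hi]
    · simp only [codeOf, TM2.stepAux]
      rw [update_of_ne (by simp), ho]
  | .seq Q R :: d, _ =>
    simp only [next, Option.some.injEq] at hxy
    subst hxy
    exact ⟨rfl, hw, hi, ho⟩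
  | .ite k φ Q R :: d, hb =>
    simp only [next, Option.some.injEq] at hxy
    subst hxy
    have hk : k < m + 1 := (hb (.ite k φ Q R) (by simp)).1
    simp only [codeOf, TM2.stepAux, head k hk]
    cases φ (s k).head?
    · exact ⟨rfl, hw, hi, ho⟩
    · exact ⟨rfl, hw, hi, ho⟩
  | .loop k φ Q :: d, hb =>
    simp only [next, Option.some.injEq] at hxy
    subst hxy
    have hk : k < m + 1 := (hb (.loop k φ Q) (by simp)).1
    simp only [codeOf, TM2.stepAux, head k hk]
    cases φ (s k).head?
    · exact ⟨rfl, hw, hi, ho⟩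
    · exact ⟨rfl, hw, hi, ho⟩

theorem Represents.space_le {c : MCfg α m P} {x : List Prog × Store} {M : ℕ}
    (h : Represents c x) (hx : Bounded M x.2) :
    cells c ≤ (m + 1) * M := by
  rw [cells, h.input, h.output]
  have : ∀ k : Fin (m + 1), (c.stk (.inl k)).length ≤ M := fun k => by
    have := congrArg List.length (h.work k)
    rw [List.length_map] at this
    rw [this]; exact hx k
  simpa using Finset.sum_le_sum fun k (_ : k ∈ Finset.univ) => this k

/-- Reading the input. -/
theorem read_input {M : ℕ} (hm : ∀ a, code a < m + 1) (w : List α) (s : List (Fin (m + 1)))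
    (v : Option (Fin (m + 1))) (hM : w.length + s.length ≤ M)
    (S : ∀ k, List (Alphabet α m k)) (h₀ : S (.inl 0) = s) (hi : S (.inr false) = w)
    (ho : S (.inr true) = []) (hS : ∀ k ≠ 0, S (.inl k) = []) :
    ∃ c, Relation.ReflTransGen (fun x y => TM2.step (machineCode m code P) x = some y ∧
        cells y ≤ M) ⟨some none, v, S⟩ c ∧
      Represents c ([P], update (fun _ => []) 0 ((w.map code).reverse ++ s.map Fin.val)) := by
  induction w generalizing s v S with
  | nil =>
    have sp : cells ⟨some (labelOf P [P]), none, S⟩ ≤ M := by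
      rw [cells]
      have : ∀ k ≠ (0 : Fin (m + 1)), (S (.inl k)).length = 0 := fun k hk => by simp [hS k hk]
      dsimp only
      rw [Fintype.sum_eq_single 0 this, h₀, hi, ho]
      simpa using hM
    refine ⟨⟨some (labelOf P [P]), none, S⟩, .single ⟨?_, sp⟩, rfl, fun k => ?_, hi, ho⟩
    · simp only [TM2.step, machineCode, TM2.stepAux, hi]
      dsimp only [List.head?_nil, Option.map_none, Option.isSome_none, cond_false, List.tail_nil]
      congr 2
      funext k
      by_cases hk : k = .inr false
      · subst hk; rw [update_self, hi]
      · rw [update_of_ne hk]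
    · dsimp only
      by_cases hk : k = 0
      · subst hk; rw [h₀, Fin.val_zero, update_self]; rfl
      · rw [hS k hk, update_of_ne]
        · rfl
        · exact fun h => hk (Fin.ext h)
  | cons a w ih =>
    set S' : ∀ k, List (Alphabet α m k) :=
      update (update S (.inr false) w) (.inl 0) (Fin.ofNat (m + 1) (code a) :: s) with hS'
    have h0' : S' (.inl 0) = Fin.ofNat (m + 1) (code a) :: s := by rw [hS', update_self]
    have hi' : S' (.inr false) = w := by rw [hS', update_of_ne (by simp), update_self]
    have ho' : S' (.inr true) = [] := by
      rw [hS', update_of_ne (by simp), update_of_ne (by simp), ho]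
    have hS0 : ∀ k ≠ 0, S' (.inl k) = [] := fun k hk => by
      rw [hS', update_of_ne (by simpa using hk), update_of_ne (by simp), hS k hk]
    simp only [List.length_cons] at hM
    obtain ⟨c, h₁, h₂⟩ := ih (Fin.ofNat (m + 1) (code a) :: s) (some (Fin.ofNat _ (code a)))
      (by simp only [List.length_cons]; omega) S' h0' hi' ho' hS0
    have sp : cells (⟨some none, some (Fin.ofNat _ (code a)), S'⟩ : MCfg α m P)
        ≤ M := by
      rw [cells]
      have : ∀ k ≠ (0 : Fin (m + 1)), (S' (.inl k)).length = 0 := fun k hk => by simp [hS0 k hk]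
      dsimp only
      rw [Fintype.sum_eq_single 0 this, h0', hi', ho']
      simp only [List.length_cons, List.length_nil]
      omega
    refine ⟨c, .head ⟨?_, sp⟩ h₁, ?_⟩
    · simp only [TM2.step, machineCode, TM2.stepAux, hi, List.head?_cons, Option.map_some,
        Option.isSome_some, cond_true, Option.getD_some, List.tail_cons]
      rw [update_of_ne (by simp), h₀]
    · simpa [Nat.mod_eq_of_lt (hm a)] using h₂

theorem Represents.run {c : MCfg α m P} {x y : List Prog × Store} {M : ℕ}
    (hm : P.Below (m + 1)) (hx : x.1 ∈ insert [] (labels P []))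
    (h : Represents c x) (hxy : Relation.ReflTransGen (BStep M) x y) :
    ∃ c', Relation.ReflTransGen (fun a b => TM2.step (machineCode m code P) a = some b ∧
        cells b ≤ (m + 1) * M) c c' ∧
      Represents c' y := by
  induction hxy using Relation.ReflTransGen.head_induction_on generalizing c with
  | refl => exact ⟨c, .refl, h⟩
  | @head x z hxz _ ih =>
    obtain ⟨hn, hb⟩ := hxz
    have hx' : x.1 ∈ labels P [] := by
      rcases hx with hx | hx
      · obtain ⟨_, _⟩ := x
        dsimp only at hx
        subst hx
        simp [next] at hn
      · exact hx
    obtain ⟨c', h₁, h₂⟩ := h.step hx' hm hn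
    have hz : z.1 ∈ insert [] (labels P []) := by
      rcases next_mem_labels P [] hx' hn with h | h
      · exact .inr h
      · exact .inl h
    obtain ⟨c'', h₃, h₄⟩ := ih hz h₂
    exact ⟨c'', .head ⟨h₁, h₂.space_le hb⟩ h₃, h₄⟩

end Machine

/-- A language is in PSPACE if it is decided by a program that finds the word, reversed, on the
stack `0`, and whose stacks hold polynomially many entries. -/
theorem mem_PSPACE_of_runs {α : Type} [Fintype α] (code : α → ℕ) (P : Prog) (L : Language α)
    (d : ℕ) (h : ∀ w : List α, ∃ (t : Store) (b : Bool),
      Runs ((w.length + 2) ^ d) P (update (fun _ => []) 0 (w.map code).reverse) t ∧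
        (t 0).head? = some b.toNat ∧ (b = true ↔ w ∈ L)) :
    L ∈ PolySpace.PSPACE α := by
  classical
  obtain ⟨m₀, hm₀⟩ := P.exists_below
  obtain ⟨m₁, hm₁⟩ : ∃ m₁, ∀ a, code a < m₁ := by
    obtain ⟨m₁, h⟩ := (Set.finite_range code).bddAbove
    exact ⟨m₁ + 1, fun a => Nat.lt_succ_of_le (h ⟨a, rfl⟩)⟩
  set m := m₀ + m₁ + 1 with hm
  have hP : P.Below (m + 1) := hm₀.mono (by omega)
  have hc : ∀ a, code a < m + 1 := fun a => (hm₁ a).trans (by omega)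
  let T : FinTM2 :=
    letI : Fintype (Label P) :=
      letI := (((labels_finite P []).insert []).fintype)
      inferInstance
    { K := Fin (m + 1) ⊕ Bool
      k₀ := .inr false
      k₁ := .inr true
      Γ := Alphabet α m
      Λ := Label P
      main := none
      σ := Option (Fin (m + 1))
      initialState := none
      Γk₀Fin := inferInstanceAs (Fintype α)
      m := machineCode m code P }
  have hT : ∀ c : MCfg α m P, PolySpace.space T c = cells c := by
    intro c
    have : PolySpace.space T c = ∑ k : Fin (m + 1) ⊕ Bool, (c.stk k).length := rfl
    rw [this, Fintype.sum_sum_type, Fintype.sum_bool, cells]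
  have key : ∀ w : List α, ∃ (e : MCfg α m P) (b : Bool), Relation.ReflTransGen
      (fun x y => TM2.step (machineCode m code P) x = some y ∧
        cells y ≤ (m + 1) * (w.length + 2) ^ (d + 1) + 1)
        (initList T w : MCfg α m P) e ∧ e.l = none ∧ e.stk (.inr true) = [b] ∧ (b = true ↔ w ∈ L) ∧
      cells (initList T w : MCfg α m P) ≤ (m + 1) * (w.length + 2) ^ (d + 1) + 1 := by
    intro w
    obtain ⟨t, b, hr, hb, hL⟩ := h w
    set M := (w.length + 2) ^ (d + 1) with hM
    have hwM : w.length ≤ M :=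
      (by omega : w.length ≤ w.length + 2).trans (Nat.le_self_pow (by omega) _)
    have hMM : M ≤ (m + 1) * M := Nat.le_mul_of_pos_left _ (by omega)
    have hdM : (w.length + 2) ^ d ≤ M := Nat.pow_le_pow_right (by omega) (by omega)
    obtain ⟨c₁, r₁, p₁⟩ := read_input (P := P) (M := M) hc w [] none (by simpa using hwM)
      (initList T w).stk rfl rfl rfl (fun k _ => rfl)
    simp only [List.map_nil, List.append_nil] at p₁
    -- The program is run with the generous bound `M`, which also covers the input.
    have hr' : ∀ {Q s t}, Runs ((w.length + 2) ^ d) Q s t → Runs M Q s t := by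
      intro Q s t hr
      induction hr with
      | skip s => exact .skip s
      | push a hl => exact .push a (hl.trans_le hdM)
      | pop k s => exact .pop k s
      | seq _ _ h₁ h₂ => exact .seq h₁ h₂
      | iteT h _ h₁ => exact .iteT h h₁
      | iteF h _ h₁ => exact .iteF h h₁
      | loopT h _ _ h₁ h₂ => exact .loopT h h₁ h₂
      | loopF h => exact .loopF h
    have hb₀ : Bounded M (update (fun _ => []) 0 (w.map code).reverse) := by
      intro k
      by_cases hk : k = 0
      · subst hk; simpa using hwM
      · simp [hk]
    obtain ⟨hbt, hs⟩ := (hr' hr).steps hb₀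
    obtain ⟨c₂, r₂, p₂⟩ := p₁.run (M := M) hP (.inr (self_mem_labels _ _)) (hs [])
    have hsp := p₂.space_le hbt
    obtain ⟨l, v, S⟩ := c₂
    obtain ⟨hl, hw, hi, ho⟩ := p₂
    dsimp only at hl hw hi ho
    subst hl
    have hv : ((S (.inl 0)).head? == some (Fin.ofNat (m + 1) 1)) = b := by
      have h0 := hw 0
      rw [Fin.val_zero] at h0
      rw [← h0, List.head?_map] at hb
      cases hS : (S (.inl 0)).head? with
      | none => simp [hS] at hb
      | some x =>
        simp only [hS, Option.map_some, Option.some.injEq] at hb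
        have h1 : ((Fin.ofNat (m + 1) 1 : Fin (m + 1)) : ℕ) = 1 := ofNat_val (by omega)
        cases b
        · simp only [Bool.toNat_false] at hb
          simp [Fin.ext_iff, hb, Nat.mod_eq_of_lt (by omega : 1 < m + 1)]
        · simp only [Bool.toNat_true] at hb
          simp [Fin.ext_iff, hb, Nat.mod_eq_of_lt (by omega : 1 < m + 1)]
    have hstep : TM2.step (machineCode m code P) ⟨some (labelOf P []), v, S⟩ = some
        ⟨none, (S (.inl 0)).head?, update S (.inr true) [b]⟩ := by
      have : T.m (labelOf P []) = codeOf (α := α) m P [] := machineCode_labelOf m code P (.inl rfl)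
      change some (TM2.stepAux (T.m (labelOf P [])) v S) = _
      rw [this]
      simp only [codeOf, TM2.stepAux, hv, ho]
    refine ⟨⟨none, (S (.inl 0)).head?, update S (.inr true) [b]⟩, b, ?_, rfl,
      update_self (β := fun k => List (Alphabet α m k)) (.inr true) [b] S, hL, ?_⟩
    · refine .tail
        ((Relation.ReflTransGen.mono (fun x y h => ⟨h.1, h.2.trans (by omega)⟩) _ _ r₁).trans
        (Relation.ReflTransGen.mono (fun x y h => ⟨h.1, h.2.trans (by omega)⟩) _ _ r₂)) ⟨hstep, ?_⟩
      rw [cells] at hsp ⊢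
      dsimp only at hsp ⊢
      rw [hi, ho] at hsp
      have : ∀ k, update S (.inr true) [b] (.inl k) = S (.inl k) := fun k =>
        update_of_ne (by simp) ..
      simp only [this, update_self]
      rw [update_of_ne (by simp), hi]
      simpa using hsp
    · change (∑ k : Fin (m + 1), ((initList T w).stk (.inl k)).length) +
        (((initList T w).stk (.inr true)).length + ((initList T w).stk (.inr false)).length) ≤ _
      have h1 : ∀ k, (initList T w).stk (.inl k) = [] := fun k => rfl
      have h2 : (initList T w).stk (.inr true) = [] := rfl
      have h3 : (initList T w).stk (.inr false) = w := rfl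
      rw [h2, h3]
      simp only [h1, List.length_nil, Finset.sum_const_zero]
      omega
  refine ⟨⟨T, Equiv.refl α, Equiv.refl Bool⟩,
    (m + 1 : ℕ) * (.X + 2) ^ (d + 1) + 1, ?_, fun w => ?_, fun w c hc' => ?_⟩
  · rintro (k | _ | _)
    · exact inferInstanceAs (Finite (Fin (m + 1)))
    · exact inferInstanceAs (Finite α)
    · exact inferInstanceAs (Finite Bool)
  · obtain ⟨e, b, r, h₁, h₂, h₃, -⟩ := key w
    have hw : w.map (Equiv.refl α).symm = w := by simp
    have hr : StateTransition.Reaches T.step (initList T w) e :=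
      Relation.ReflTransGen.mono (fun x y h => h.1) _ _ r
    exact ⟨e, b, by rw [← hw] at hr; exact hr, h₁, h₂, h₃⟩
  · obtain ⟨e, b, r, h₁, h₂, h₃, h₄⟩ := key w
    have hw : w.map (Equiv.refl α).symm = w := by simp
    have hc : StateTransition.Reaches (TM2.step (machineCode m code P)) (initList T w) c := by
      rw [← hw]; exact hc'
    have he : TM2.step (machineCode m code P) e = none := by
      obtain ⟨_, _, _⟩ := e
      dsimp only at h₁
      subst h₁
      rfl
    have := forall_reaches_of_halting_run r h₄ he c hc
    refine (hT c).le.trans ?_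
    simpa using this

end StackProg

namespace StackProg

open Turing Function

/-! ### Basic programs -/

/-- A code of the letters of a finite alphabet by natural numbers. -/
noncomputable def cd {A : Type} [Finite A] (a : A) : ℕ := Finite.equivFin A a

theorem cd_injective {A : Type} [Finite A] : Injective (cd : A → ℕ) :=
  Fin.val_injective.comp (Finite.equivFin A).injective

/-- The store that agrees with `r` below `b` and has the stacks `l` from `b` on. -/
def frame (r : Store) (b : ℕ) (l : List (List ℕ)) : Store :=
  fun j => if j < b then r j else l.getD (j - b) []

theorem frame_apply (r : Store) (b : ℕ) (l : List (List ℕ)) (i : ℕ) :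
    frame r b l (b + i) = l.getD i [] := by
  simp [frame]

theorem frame_below (r : Store) {b j : ℕ} (h : j < b) (l : List (List ℕ)) :
    frame r b l j = r j := by
  simp [frame, h]

theorem update_frame (r : Store) (b : ℕ) (l : List (List ℕ)) {i : ℕ} (h : i < l.length)
    (v : List ℕ) : update (frame r b l) (b + i) v = frame r b (l.set i v) := by
  funext j
  by_cases hj : j = b + i
  · subst hj; simp [frame, h]
  · by_cases hb : j < b
    · simp [frame, hj, hb]
    · have : i ≠ j - b := by omega
      simp [frame, hj, hb, List.getElem?_set_ne this]

theorem update_frame_below (r : Store) {b j : ℕ} (h : j < b) (l : List (List ℕ)) (v : List ℕ) :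
    update (frame r b l) j v = frame (update r j v) b l := by
  funext i
  by_cases hi : i = j
  · subst hi; simp [frame, h]
  · simp [frame, hi]

theorem frame_append (r : Store) (b : ℕ) (l l' : List (List ℕ)) :
    frame r b (l ++ l') = frame (frame r b l) (b + l.length) l' := by
  funext j
  by_cases hb : j < b
  · have : j < b + l.length := by omega
    simp [frame, hb, this]
  · by_cases hj : j < b + l.length
    · simp [frame, hb, hj, List.getElem?_append_left (by omega : j - b < l.length)]
    · have : j - b - l.length = j - (b + l.length) := by omega
      simp [frame, hb, hj, List.getElem?_append_right (by omega : l.length ≤ j - b), this]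

theorem frame_append_nil (r : Store) (b : ℕ) (l : List (List ℕ)) :
    frame r b (l ++ [[]]) = frame r b l := by
  funext j
  by_cases hb : j < b
  · simp [frame, hb]
  · simp only [frame, hb, if_false, List.getD_eq_getElem?_getD]
    rcases lt_trichotomy (j - b) l.length with h | h | h
    · rw [List.getElem?_append_left h]
    · rw [h]; simp
    · rw [List.getElem?_eq_none (by simp; omega), List.getElem?_eq_none (by omega)]

theorem getD_set_ne {i j : ℕ} (h : i ≠ j) (l : List (List ℕ)) (v : List ℕ) :
    (l.set i v).getD j [] = l.getD j [] := by
  simp [List.getElem?_set_ne h]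

theorem getD_set_self {i : ℕ} {l : List (List ℕ)} (h : i < l.length) (v : List ℕ) :
    (l.set i v).getD i [] = v := by
  simp [h]

variable {M : ℕ} {r : Store} {b : ℕ} {l : List (List ℕ)}

theorem runs_push (i a : ℕ) (hi : i < l.length) (h : (l.getD i []).length < M) :
    Runs M (.push (b + i) a) (frame r b l) (frame r b (l.set i (a :: l.getD i []))) := by
  rw [← update_frame r b l hi, ← frame_apply r b l i]
  exact .push a (by rwa [frame_apply])

theorem runs_pop (i : ℕ) (hi : i < l.length) :
    Runs M (.pop (b + i)) (frame r b l) (frame r b (l.set i (l.getD i []).tail)) := by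
  rw [← update_frame r b l hi, ← frame_apply r b l i]
  exact .pop _ _

theorem runs_iteT {i : ℕ} {φ : Option ℕ → Bool} {P Q : Prog} {t : Store}
    (h : φ (l.getD i []).head? = true) (hP : Runs M P (frame r b l) t) :
    Runs M (.ite (b + i) φ P Q) (frame r b l) t :=
  .iteT (by rwa [frame_apply]) hP

theorem runs_iteF {i : ℕ} {φ : Option ℕ → Bool} {P Q : Prog} {t : Store}
    (h : φ (l.getD i []).head? = false) (hQ : Runs M Q (frame r b l) t) :
    Runs M (.ite (b + i) φ P Q) (frame r b l) t :=
  .iteF (by rwa [frame_apply]) hQ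

theorem runs_loopT {i : ℕ} {φ : Option ℕ → Bool} {P : Prog} {t u : Store}
    (h : φ (l.getD i []).head? = true) (hP : Runs M P (frame r b l) t)
    (ht : Runs M (.loop (b + i) φ P) t u) : Runs M (.loop (b + i) φ P) (frame r b l) u :=
  .loopT (by rwa [frame_apply]) hP ht

theorem runs_loopF {i : ℕ} {φ : Option ℕ → Bool} {P : Prog}
    (h : φ (l.getD i []).head? = false) :
    Runs M (.loop (b + i) φ P) (frame r b l) (frame r b l) :=
  .loopF (by rwa [frame_apply])

section Scan

variable {A : Type} [Finite A]

/-- Case distinction on the letter of `A` on top of the stack `k`. -/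
noncomputable def switch (k : ℕ) (body : A → Prog) : Prog :=
  letI := Fintype.ofFinite A
  (Finset.univ : Finset A).toList.foldr
    (fun a Q => .ite k (fun o => o == some (cd a)) (body a) Q) .skip

theorem runs_switch {k : ℕ} {body : A → Prog} {a : A} {s t : Store}
    (h : (s k).head? = some (cd a)) (hb : Runs M (body a) s t) : Runs M (switch k body) s t := by
  have : ∀ L : List A, a ∈ L → Runs M
      (L.foldr (fun a Q => .ite k (fun o => o == some (cd a)) (body a) Q) .skip) s t := by
    intro L
    induction L with
    | nil => simp
    | cons x L ih =>
      intro ha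
      by_cases hx : a = x
      · subst hx
        exact .iteT (by simp [h]) hb
      · refine .iteF ?_ (ih ((List.mem_cons.1 ha).resolve_left hx))
        simpa [h] using fun e => hx (cd_injective e)
  exact this _ (by simp)

open Classical in
/-- As long as there is a letter of `A` on top of the stack `k`, pop it and execute `body`. -/
noncomputable def scan (k : ℕ) (body : A → Prog) : Prog :=
  .loop k (fun o => decide (∃ a : A, o = some (cd a))) (switch k fun a => .seq (.pop k) (body a))

/-- The list does not begin with the code of a letter of `A`. -/
def Stops (A : Type) [Finite A] (rest : List ℕ) : Prop := ∀ a : A, rest.head? ≠ some (cd a)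

theorem stops_nil : Stops A [] := fun _ => by simp

theorem runs_scan_nil {k : ℕ} {body : A → Prog} {s : Store} (h : Stops A (s k)) :
    Runs M (scan k body) s s :=
  .loopF (by simpa [Stops] using h)

theorem runs_scan_cons {k : ℕ} {body : A → Prog} {a : A} {s t u : Store}
    (h : (s k).head? = some (cd a)) (hb : Runs M (body a) (update s k (s k).tail) t)
    (ht : Runs M (scan k body) t u) : Runs M (scan k body) s u :=
  .loopT (by simpa using ⟨a, h⟩) (runs_switch h (.seq (.pop k s) hb)) ht

/-- Move the letters on top of the stack `k` to the stacks `j` and `j'`, applying maps. -/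
noncomputable def move₂ (A : Type) [Finite A] (k j j' : ℕ) (f f' : A → ℕ) : Prog :=
  scan k fun a => .seq (.push j (f a)) (.push j' (f' a))

/-- Move the letters on top of the stack `k` to the stack `j`, applying a map. -/
noncomputable def move (A : Type) [Finite A] (k j : ℕ) (f : A → ℕ) : Prog :=
  scan k fun a => .push j (f a)

/-- Remove the letters on top of the stack `k`. -/
noncomputable def clear (A : Type) [Finite A] (k : ℕ) : Prog :=
  scan k fun _ : A => .skip

theorem runs_move {k j : ℕ} (hkj : k ≠ j) (hk : k < l.length) (hj : j < l.length) (f : A → ℕ)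
    (w : List A) {rest : List ℕ} (h : l.getD k [] = w.map cd ++ rest) (hr : Stops A rest)
    (hM : w.length + (l.getD j []).length ≤ M) :
    Runs M (move A (b + k) (b + j) f) (frame r b l)
      (frame r b ((l.set k rest).set j ((w.map f).reverse ++ l.getD j []))) := by
  induction w generalizing l with
  | nil =>
    have : (l.set k rest).set j (([].map f).reverse ++ l.getD j []) = l := by
      simp only [List.map_nil, List.nil_append] at h
      rw [← h]
      simp [hk, hj]
    rw [this]
    exact runs_scan_nil (by rw [frame_apply, h]; exact hr)
  | cons a w ih =>
    simp only [List.length_cons] at hM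
    simp only [List.map_cons, List.cons_append] at h
    set l₁ := l.set k (w.map cd ++ rest) with hl₁
    set l₂ := l₁.set j (f a :: l.getD j []) with hl₂
    have e₁ : l₁.getD j [] = l.getD j [] := getD_set_ne hkj _ _
    refine runs_scan_cons (a := a) (by rw [frame_apply, h]; rfl) (t := frame r b l₂) ?_ ?_
    · rw [update_frame _ _ _ hk, frame_apply, h, List.tail_cons, hl₂, ← e₁]
      refine runs_push j (f a) (by simpa [hl₁] using hj) ?_
      rw [← hl₁, e₁]; omega
    · have h1 : l₂.getD k [] = w.map cd ++ rest := by
        rw [hl₂, getD_set_ne hkj.symm, getD_set_self hk]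
      have h2 : l₂.getD j [] = f a :: l.getD j [] := getD_set_self (by simpa [hl₁] using hj) _
      have := ih (l := l₂) (by simpa [hl₂, hl₁] using hk) (by simpa [hl₂, hl₁] using hj) h1
        (by rw [h2, List.length_cons]; omega)
      have e : (l₂.set k rest).set j ((w.map f).reverse ++ f a :: l.getD j []) =
          (l.set k rest).set j (((a :: w).map f).reverse ++ l.getD j []) := by
        rw [hl₂, hl₁, List.set_comm _ _ hkj.symm, List.set_set, List.set_set]
        simp
      rw [h2, e] at this
      exact this

theorem runs_move₂ {k j j' : ℕ} (hkj : k ≠ j) (hkj' : k ≠ j') (hjj : j ≠ j') (hk : k < l.length)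
    (hj : j < l.length) (hj' : j' < l.length) (f f' : A → ℕ)
    (w : List A) {rest : List ℕ} (h : l.getD k [] = w.map cd ++ rest) (hr : Stops A rest)
    (hM : w.length + (l.getD j []).length ≤ M) (hM' : w.length + (l.getD j' []).length ≤ M) :
    Runs M (move₂ A (b + k) (b + j) (b + j') f f') (frame r b l)
      (frame r b (((l.set k rest).set j ((w.map f).reverse ++ l.getD j [])).set j'
        ((w.map f').reverse ++ l.getD j' []))) := by
  induction w generalizing l with
  | nil =>
    have : ((l.set k rest).set j (([].map f).reverse ++ l.getD j [])).set j'
        (([].map f').reverse ++ l.getD j' []) = l := by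
      simp only [List.map_nil, List.nil_append] at h
      rw [← h]
      simp [hk, hj, hj']
    rw [this]
    exact runs_scan_nil (by rw [frame_apply, h]; exact hr)
  | cons a w ih =>
    simp only [List.length_cons] at hM hM'
    simp only [List.map_cons, List.cons_append] at h
    set l₁ := l.set k (w.map cd ++ rest) with hl₁
    set l₂ := l₁.set j (f a :: l.getD j []) with hl₂
    set l₃ := l₂.set j' (f' a :: l.getD j' []) with hl₃
    have e₁ : l₁.getD j [] = l.getD j [] := getD_set_ne hkj _ _
    have e₂ : l₂.getD j' [] = l.getD j' [] := by
      rw [hl₂, getD_set_ne hjj, hl₁, getD_set_ne hkj']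
    refine runs_scan_cons (a := a) (by rw [frame_apply, h]; rfl) (t := frame r b l₃) ?_ ?_
    · rw [update_frame _ _ _ hk, frame_apply, h, List.tail_cons]
      refine .seq (t := frame r b l₂) ?_ ?_
      · rw [hl₂, ← e₁]
        refine runs_push j (f a) (by simpa [hl₁] using hj) ?_
        rw [← hl₁, e₁]; omega
      · rw [hl₃, ← e₂]
        refine runs_push j' (f' a) (by simpa [hl₂, hl₁] using hj') ?_
        rw [e₂]; omega
    · have h1 : l₃.getD k [] = w.map cd ++ rest := by
        rw [hl₃, getD_set_ne hkj'.symm, hl₂, getD_set_ne hkj.symm, getD_set_self hk]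
      have h2 : l₃.getD j [] = f a :: l.getD j [] := by
        rw [hl₃, getD_set_ne hjj.symm, hl₂, getD_set_self (by simpa [hl₁] using hj)]
      have h3 : l₃.getD j' [] = f' a :: l.getD j' [] :=
        getD_set_self (by simpa [hl₂, hl₁] using hj') _
      have := ih (l := l₃) (by simpa [hl₃, hl₂, hl₁] using hk) (by simpa [hl₃, hl₂, hl₁] using hj)
        (by simpa [hl₃, hl₂, hl₁] using hj') h1 (by rw [h2, List.length_cons]; omega)
        (by rw [h3, List.length_cons]; omega)
      have e : ((l₃.set k rest).set j ((w.map f).reverse ++ f a :: l.getD j [])).set j'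
          ((w.map f').reverse ++ f' a :: l.getD j' []) =
          ((l.set k rest).set j (((a :: w).map f).reverse ++ l.getD j [])).set j'
            (((a :: w).map f').reverse ++ l.getD j' []) := by
        rw [hl₃, hl₂, hl₁, List.set_comm _ _ hkj'.symm, List.set_comm _ _ hkj.symm, List.set_set,
          List.set_comm _ _ hjj.symm, List.set_set, List.set_set]
        simp
      rw [h2, h3, e] at this
      exact this

theorem runs_clear {k : ℕ} (hk : k < l.length) (w : List A) {rest : List ℕ}
    (h : l.getD k [] = w.map cd ++ rest) (hr : Stops A rest) :
    Runs M (clear A (b + k)) (frame r b l) (frame r b (l.set k rest)) := by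
  induction w generalizing l with
  | nil =>
    have : l.set k rest = l := by
      simp only [List.map_nil, List.nil_append] at h
      rw [← h]
      simp [hk]
    rw [this]
    exact runs_scan_nil (by rw [frame_apply, h]; exact hr)
  | cons a w ih =>
    refine runs_scan_cons (a := a) (by rw [frame_apply, h]; rfl) (.skip _) ?_
    rw [update_frame _ _ _ hk, frame_apply, h]
    have := ih (l := l.set k (w.map cd ++ rest)) (by simpa using hk) (by simp [hk])
    rw [List.set_set] at this
    exact this

end Scan

/-! ### Predicates on words decided in polynomial space -/

/-- The stack that holds the word `w`. -/
noncomputable abbrev stack {A : Type} [Finite A] {N : ℕ} (w : Fin N → A) : List ℕ :=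
  (List.ofFn w).map cd

/-- The predicate `L` on words is decided in polynomial space: for all stacks `r < b` there is a
program which, if the word is on stack `b` and all further stacks are empty, pushes the answer
onto the stack `r`. No stack ever holds more than polynomially many entries, except for the
stack `r` if it did so before. -/
def PS {A : Type} [Finite A] (L : ∀ N, (Fin N → A) → Prop) : Prop :=
  ∃ d : ℕ, ∀ b r, r < b → ∃ P : Prog, ∀ (N : ℕ) (w : Fin N → A) (s : Store) (M : ℕ) (c : Bool),
    (N + 2) ^ d ≤ M → (s r).length < M → (c = true ↔ L N w) →
      Runs M P (frame s b [stack w]) (frame (update s r (c.toNat :: s r)) b [stack w])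

namespace PS

variable {A B : Type} [Finite A] [Finite B] {L L' : ∀ N, (Fin N → A) → Prop}

theorem congr (h : PS L) (e : ∀ N w, L N w ↔ L' N w) : PS L' := by
  have : L = L' := by funext N w; exact propext (e N w)
  rwa [← this]

theorem runs_below {φ : Option ℕ → Bool} {r b : ℕ} {s t : Store} {l : List (List ℕ)} {P Q : Prog}
    (hr : r < b) (c : Bool) (h : φ (s r).head? = c)
    (hPQ : Runs M (if c then P else Q) (frame s b l) t) :
    Runs M (.ite r φ P Q) (frame s b l) t := by
  cases c
  · exact .iteF (by rwa [frame_below _ hr]) hPQ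
  · exact .iteT (by rwa [frame_below _ hr]) hPQ

protected theorem not (h : PS L) : PS fun N w => ¬ L N w := by
  obtain ⟨d, h⟩ := h
  refine ⟨d, fun b r hr => ?_⟩
  obtain ⟨P, hP⟩ := h b r hr
  refine ⟨.seq P (.ite r (fun o => o == some 1) (.seq (.pop r) (.push r 0))
    (.seq (.pop r) (.push r 1))), fun N w s M c hM hs hc => .seq (hP N w s M (!c) hM hs ?_) ?_⟩
  · cases c <;> simp_all
  · refine runs_below hr (!c) (by cases c <;> simp) ?_
    have : ∀ x y z, x = y → Runs M (.seq (.pop r) (.push r x))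
        (frame (update s r (z :: s r)) b [stack w])
        (frame (update s r (y :: s r)) b [stack w]) := by
      rintro x y z rfl
      refine .seq (.pop _ _) ?_
      rw [update_frame_below _ hr, frame_below _ hr]
      have := Runs.push (M := M) (k := r) (s := frame s b [stack w]) x
        (by rwa [frame_below _ hr])
      rw [update_frame_below _ hr, frame_below _ hr] at this
      simpa using this
    cases c
    · exact this 0 _ _ rfl
    · exact this 1 _ _ rfl

protected theorem and (h : PS L) (h' : PS L') : PS fun N w => L N w ∧ L' N w := by
  classical
  obtain ⟨d, h⟩ := h
  obtain ⟨d', h'⟩ := h'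
  refine ⟨max d d', fun b r hr => ?_⟩
  obtain ⟨P, hP⟩ := h b r hr
  obtain ⟨P', hP'⟩ := h' b r hr
  refine ⟨.seq P (.ite r (fun o => o == some 1) (.seq (.pop r) P') .skip),
    fun N w s M c hM hs hc => .seq (hP N w s M (decide (L N w))
      ((Nat.pow_le_pow_right (by omega) (le_max_left _ _)).trans hM) hs (by simp)) ?_⟩
  refine runs_below hr (decide (L N w)) (by by_cases hL : L N w <;> simp [hL]) ?_
  by_cases hL : L N w
  · simp only [hL, decide_true, if_true]
    refine .seq (.pop _ _) ?_
    rw [update_frame_below _ hr, frame_below _ hr]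
    simp only [update_self, List.tail_cons, update_idem, update_eq_self]
    exact hP' N w s M c ((Nat.pow_le_pow_right (by omega) (le_max_right _ _)).trans hM) hs
      (by simpa [hL] using hc)
  · have : c = false := by cases c <;> simp_all
    subst this
    simp only [hL, decide_false]
    exact .skip _

protected theorem or (h : PS L) (h' : PS L') : PS fun N w => L N w ∨ L' N w :=
  (h.not.and h'.not).not.congr fun N w => by tauto

protected theorem imp (h : PS L) (h' : PS L') : PS fun N w => L N w → L' N w :=
  (h.and h'.not).not.congr fun N w => by tauto

/-- Substitution of letters. -/
protected theorem comap (h : PS L) (f : B → A) : PS fun N w => L N (f ∘ w) := by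
  obtain ⟨d, h⟩ := h
  refine ⟨d + 1, fun b r hr => ?_⟩
  obtain ⟨P, hP⟩ := h (b + 2) r (by omega)
  refine ⟨.seq (move B (b + 0) (b + 1) cd) (.seq (move₂ B (b + 1) (b + 0) (b + 2) cd (cd ∘ f))
    (.seq P (clear A (b + 2)))), fun N w s M c hM hs hc => ?_⟩
  have hN : N ≤ M := by
    exact le_trans (by omega) ((Nat.le_self_pow (by omega) (N + 2)).trans hM)
  have e₀ : frame s b [stack w] = frame s b [stack w, [], []] := by
    rw [← frame_append_nil, ← frame_append_nil]; rfl
  have e₁ := frame_append s b [stack w, []] [stack (f ∘ w)]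
  have s₁ : Runs M (move B (b + 0) (b + 1) cd) (frame s b [stack w, [], []])
      (frame s b [[], (stack w).reverse, []]) := by
    have := runs_move (M := M) (r := s) (b := b) (l := [stack w, [], []]) (k := 0) (j := 1)
      (by simp) (by simp) (by simp) (cd : B → ℕ) (List.ofFn w) (rest := [])
      (by simp) stops_nil (by simpa using hN)
    simpa using this
  have s₂ : Runs M (move₂ B (b + 1) (b + 0) (b + 2) cd (cd ∘ f))
      (frame s b [[], (stack w).reverse, []]) (frame s b [stack w, [], stack (f ∘ w)]) := by
    have := runs_move₂ (M := M) (r := s) (b := b) (l := [[], (stack w).reverse, []]) (k := 1)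
      (j := 0) (j' := 2) (by simp) (by simp) (by simp) (by simp) (by simp) (by simp) (cd : B → ℕ)
      (cd ∘ f) (List.ofFn w).reverse (rest := []) (by simp) stops_nil (by simpa using hN)
      (by simpa using hN)
    simpa [List.map_ofFn, Function.comp_assoc] using this
  have s₃ := hP N (f ∘ w) (frame s b [stack w, []]) M c
    ((Nat.pow_le_pow_right (by omega) (by omega)).trans hM) (by rwa [frame_below _ hr]) hc
  have s₄ : Runs M (clear A (b + 2)) (frame (update s r (c.toNat :: s r)) b
      [stack w, [], stack (f ∘ w)]) (frame (update s r (c.toNat :: s r)) b [stack w, [], []]) :=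
    runs_clear (k := 2) (by simp) (List.ofFn (f ∘ w)) (rest := []) (by simp) stops_nil
  rw [e₀]
  refine .seq s₁ (.seq s₂ (.seq (t := frame (update s r (c.toNat :: s r)) b
    [stack w, [], stack (f ∘ w)]) ?_ ?_))
  · have e₂ := frame_append (update s r (c.toNat :: s r)) b [stack w, []] [stack (f ∘ w)]
    simp only [List.cons_append, List.nil_append, List.length_cons, List.length_nil] at e₁ e₂
    rw [e₁, e₂]
    rw [frame_below _ hr, update_frame_below _ hr] at s₃
    exact s₃
  · have : frame (update s r (c.toNat :: s r)) b [stack w] =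
        frame (update s r (c.toNat :: s r)) b [stack w, [], []] := by
      rw [← frame_append_nil, ← frame_append_nil]; rfl
    rw [this]
    exact s₄

end PS

/-- A language is in PSPACE if its words form a predicate decided in polynomial space. -/
theorem PS.mem_PSPACE {α : Type} [Fintype α] {L : Language α}
    (h : PS fun N (w : Fin N → α) => List.ofFn w ∈ L) : L ∈ PolySpace.PSPACE α := by
  classical
  obtain ⟨d, h⟩ := h
  obtain ⟨P, hP⟩ := h 1 0 (by omega)
  refine mem_PSPACE_of_runs cd (.seq (move α (0 + 0) (0 + 1) cd) P) L (d + 1) fun w => ?_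
  obtain ⟨N, v, rfl⟩ : ∃ (N : ℕ) (v : Fin N → α), w = List.ofFn v :=
    ⟨w.length, w.get, (List.ofFn_get w).symm⟩
  rw [List.length_ofFn]
  have hM : (N + 2) ^ d ≤ (N + 2) ^ (d + 1) := Nat.pow_le_pow_right (by omega) (by omega)
  have hN : N ≤ (N + 2) ^ (d + 1) := by
    exact le_trans (by omega) (Nat.le_self_pow (by omega) (N + 2))
  have e₀ : update (fun _ => []) 0 (List.map cd (List.ofFn v)).reverse =
      frame (fun _ => []) 0 [(stack v).reverse, []] := by
    funext j
    rcases j with _ | _ | j <;> simp [frame]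
  have e₁ : frame (fun _ => []) 0 [[], stack v] = frame (fun _ => []) 1 [stack v] := by
    funext j
    rcases j with _ | _ | j <;> simp [frame]
  refine ⟨_, decide (List.ofFn v ∈ L), .seq (t := frame (fun _ => []) 0 [[], stack v]) ?_
    (by
      rw [e₁]
      exact hP N v (fun _ => []) _ (decide (List.ofFn v ∈ L)) hM (by simp) (by simp)), ?_, by simp⟩
  · rw [e₀]
    have := runs_move (M := (N + 2) ^ (d + 1)) (r := fun _ => []) (b := 0)
      (l := [(stack v).reverse, []]) (k := 0) (j := 1) (by simp) (by simp) (by simp) (cd : α → ℕ)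
      (List.ofFn v).reverse (rest := []) (by simp) stops_nil (by simpa using hN)
    simpa using this
  · simp [frame]

end StackProg

namespace StackProg

open Turing Function

/-! ### Weighted automata -/

/-- The total weight of the run of a finite automaton with transition function `δ` and weights
`ω` on a word, starting in state `q`. -/
def wsum {Q A : Type} (δ : Q → A → Q) (ω : Q → A → ℤ) : Q → List A → ℤ
  | _, [] => 0
  | q, a :: w => ω q a + wsum δ ω (δ q a) w

variable {M : ℕ} {r : Store} {b : ℕ} {l : List (List ℕ)}

/-- Push `n` zeros. -/
def pushZeros (k : ℕ) : ℕ → Prog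
  | 0 => .skip
  | n + 1 => .seq (.push k 0) (pushZeros k n)

theorem runs_pushZeros (i n m : ℕ) (hi : i < l.length) (h : l.getD i [] = List.replicate m 0)
    (hM : m + n ≤ M) : Runs M (pushZeros (b + i) n) (frame r b l)
      (frame r b (l.set i (List.replicate (m + n) 0))) := by
  induction n generalizing l m with
  | zero =>
    have : l.set i (List.replicate (m + 0) 0) = l := by
      rw [Nat.add_zero, ← h]; simp [hi]
    rw [this]
    exact .skip _
  | succ n ih =>
    refine .seq (runs_push i 0 hi (by rw [h, List.length_replicate]; omega)) ?_
    have := ih (l := l.set i (0 :: l.getD i [])) (m + 1) (by simpa using hi)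
      (by rw [getD_set_self hi, h]; rfl) (by omega)
    rw [List.set_set, add_assoc, add_comm 1 n] at this
    exact this

/-- Pop everything. -/
def popAll (k : ℕ) : Prog := .loop k Option.isSome (.pop k)

theorem runs_popAll (i : ℕ) (hi : i < l.length) :
    Runs M (popAll (b + i)) (frame r b l) (frame r b (l.set i [])) := by
  obtain ⟨x, hx⟩ : ∃ x, l.getD i [] = x := ⟨_, rfl⟩
  induction x generalizing l with
  | nil =>
    have : l.set i [] = l := by rw [← hx]; simp [hi]
    rw [this]
    exact runs_loopF (by rw [hx]; rfl)
  | cons a x ih =>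
    refine runs_loopT (by rw [hx]; rfl) (runs_pop i hi) ?_
    have := ih (l := l.set i x) (by simpa using hi) (getD_set_self hi _)
    rw [List.set_set] at this
    rw [hx]
    exact this

/-- Pop from both stacks until the first one is empty. -/
def cancel (k j : ℕ) : Prog := .loop k Option.isSome (.seq (.pop k) (.pop j))

theorem runs_cancel {i j : ℕ} (hij : i ≠ j) (hi : i < l.length) (hj : j < l.length) (p m : ℕ)
    (hp : l.getD i [] = List.replicate p 0) (hm : l.getD j [] = List.replicate m 0) :
    Runs M (cancel (b + i) (b + j)) (frame r b l)
      (frame r b ((l.set i []).set j (List.replicate (m - p) 0))) := by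
  induction p generalizing l m with
  | zero =>
    have : (l.set i []).set j (List.replicate (m - 0) 0) = l := by
      rw [Nat.sub_zero, ← hm]
      have : l.set i [] = l := by
        have : [] = l.getD i [] := hp.symm
        rw [this]; simp [hi]
      rw [this]; simp [hj]
    rw [this]
    exact runs_loopF (by rw [hp]; rfl)
  | succ p ih =>
    refine runs_loopT (by rw [hp]; rfl) (.seq (runs_pop i hi)
      (runs_pop j (by simpa using hj))) ?_
    rw [hp, getD_set_ne hij, hm, List.tail_replicate, List.tail_replicate, Nat.add_sub_cancel]
    have := ih (l := (l.set i (List.replicate p 0)).set j (List.replicate (m - 1) 0))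
      (by simpa using hi) (by simpa using hj) (m - 1)
      (by rw [getD_set_ne hij.symm, getD_set_self hi])
      (by rw [getD_set_self (by simpa using hj)])
    rw [List.set_comm _ _ hij.symm, List.set_set, List.set_set, Nat.sub_sub, add_comm 1 p] at this
    exact this

section

variable {A Q : Type} [Finite A] [Finite Q] (δ : Q → A → Q) (ω : Q → A → ℤ)

/-- Run the automaton on the stack `b`; its state is on the stack `b + 2`, and the weights are
added up in unary notation, the positive ones on the stack `b + 3` and the negative ones on the
stack `b + 4`. -/
noncomputable def runAutomaton (b : ℕ) : Prog :=
  scan (b + 0) fun a : A => switch (b + 2) fun q : Q => .seq (.pop (b + 2)) <|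
    .seq (.push (b + 2) (cd (δ q a))) <| .seq (pushZeros (b + 3) (ω q a).toNat) <|
      .seq (pushZeros (b + 4) (-ω q a).toNat) (.push (b + 1) (cd a))

theorem runs_runAutomaton {K : ℕ} (hK : ∀ q a, (ω q a).natAbs ≤ K) (w : List A) (R : List ℕ)
    (q : Q) (p m : ℕ) (hR : w.length + R.length ≤ M) (h0 : 1 ≤ M) (hp : p + K * w.length ≤ M)
    (hm : m + K * w.length ≤ M) :
    ∃ (q' : Q) (p' m' : ℕ), (p' : ℤ) - m' = p - m + wsum δ ω q w ∧
      Runs M (runAutomaton δ ω b)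
        (frame r b [w.map cd, R, [cd q], List.replicate p 0, List.replicate m 0])
        (frame r b [[], (w.map cd).reverse ++ R, [cd q'], List.replicate p' 0,
          List.replicate m' 0]) := by
  induction w generalizing R q p m with
  | nil => exact ⟨q, p, m, by simp [wsum], runs_scan_nil (by rw [frame_apply]; exact stops_nil)⟩
  | cons a w ih =>
    have hω := hK q a
    rw [List.length_cons, Nat.mul_succ] at hp hm
    rw [List.length_cons] at hR
    obtain ⟨q', p', m', h₁, h₂⟩ := ih (cd a :: R) (δ q a) (p + (ω q a).toNat)
      (m + (-ω q a).toNat) (by rw [List.length_cons]; omega) (by omega) (by omega)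
    refine ⟨q', p', m', by rw [h₁, wsum]; omega, ?_⟩
    refine runs_scan_cons (a := a) (by rw [frame_apply]; rfl)
      (t := frame r b [w.map cd, cd a :: R, [cd (δ q a)], List.replicate (p + (ω q a).toNat) 0,
        List.replicate (m + (-ω q a).toNat) 0]) ?_ (by simpa [runAutomaton] using h₂)
    rw [update_frame _ _ _ (Nat.succ_pos _), frame_apply]
    refine runs_switch (a := q) (by rw [frame_apply]; rfl)
      (.seq (t := frame r b [w.map cd, R, [], List.replicate p 0, List.replicate m 0]) ?_ <|
      .seq (t := frame r b [w.map cd, R, [cd (δ q a)], List.replicate p 0, List.replicate m 0])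
        ?_ <|
      .seq (t := frame r b [w.map cd, R, [cd (δ q a)], List.replicate (p + (ω q a).toNat) 0,
        List.replicate m 0]) ?_ <|
      .seq (t := frame r b [w.map cd, R, [cd (δ q a)], List.replicate (p + (ω q a).toNat) 0,
        List.replicate (m + (-ω q a).toNat) 0]) ?_ ?_)
    · exact runs_pop 2 (by simp)
    · exact runs_push 2 _ (by simp) h0
    · exact runs_pushZeros 3 _ _ (by simp) rfl (by omega)
    · exact runs_pushZeros 4 _ _ (by simp) rfl (by omega)
    · exact runs_push 1 _ (by simp) (by change R.length < M; omega)

end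

theorem frame_nils (r : Store) (b n : ℕ) (l : List (List ℕ)) :
    frame r b (l ++ List.replicate n []) = frame r b l := by
  induction n with
  | zero => simp
  | succ n ih => rw [List.replicate_succ', ← List.append_assoc, frame_append_nil, ih]

theorem le_pow_of_linear (C N : ℕ) : C * N + C ≤ (N + 2) ^ (C + 1) := by
  have h1 : C ≤ 2 ^ C := Nat.lt_two_pow_self.le
  have h2 : 2 ^ C ≤ (N + 2) ^ C := Nat.pow_le_pow_left (by omega) C
  calc C * N + C = C * (N + 1) := by ring
    _ ≤ (N + 2) ^ C * (N + 2) := Nat.mul_le_mul (h1.trans h2) (by omega)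
    _ = (N + 2) ^ (C + 1) := by ring

/-- The words on which the run of a weighted automaton has nonnegative weight. -/
theorem PS.automaton {A Q : Type} [Finite A] [Finite Q] (δ : Q → A → Q) (ω : Q → A → ℤ) (q₀ : Q)
    (c : ℤ) : PS fun _ w => 0 ≤ c + wsum δ ω q₀ (List.ofFn w) := by
  obtain ⟨K, hK⟩ : ∃ K, ∀ q a, (ω q a).natAbs ≤ K := by
    obtain ⟨K, h⟩ := (Set.finite_range fun x : Q × A => (ω x.1 x.2).natAbs).bddAbove
    exact ⟨K, fun q a => h ⟨(q, a), rfl⟩⟩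
  set C := K + c.natAbs + 1 with hC
  refine ⟨C + 1, fun b r hr => ⟨.seq (.push (b + 2) (cd q₀)) <|
    .seq (pushZeros (b + 3) c.toNat) <| .seq (pushZeros (b + 4) (-c).toNat) <|
    .seq (runAutomaton δ ω b) <| .seq (move A (b + 1) (b + 0) cd) <|
    .seq (cancel (b + 3) (b + 4)) <| .seq (popAll (b + 2)) <|
    .seq (.ite (b + 4) Option.isSome (.push r 0) (.push r 1)) (popAll (b + 4)),
    fun N w s M e hM hs he => ?_⟩⟩
  have hM' : C * N + C ≤ M := (le_pow_of_linear C N).trans hM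
  have hCN : N * 1 ≤ C * N := by rw [mul_comm]; exact Nat.mul_le_mul_right N (by omega)
  have hKN : C * N = K * N + c.natAbs * N + N := by rw [hC]; ring
  obtain ⟨q', p', m', h₁, h₂⟩ := runs_runAutomaton (M := M) (r := s) (b := b) δ ω hK
    (List.ofFn w) [] q₀ c.toNat (-c).toNat (by simp; omega) (by omega) (by simp; omega)
    (by simp; omega)
  have ez : frame s b [stack w] = frame s b [stack w, [], [], [], []] :=
    (frame_nils s b 4 [stack w]).symm
  set s' := update s r (e.toNat :: s r) with hs'
  have ez' : frame s' b [stack w, [], [], [], []] = frame s' b [stack w] :=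
    frame_nils s' b 4 [stack w]
  have hev : (e = true ↔ m' - p' = 0) := by rw [he]; omega
  rw [ez, ← ez']
  refine .seq (runs_push 2 _ (by simp) (by simp; omega)) <|
    .seq (runs_pushZeros 3 c.toNat 0 (by simp) rfl (by omega)) <|
    .seq (runs_pushZeros 4 (-c).toNat 0 (by simp) rfl (by omega)) ?_
  simp only [List.set_cons_succ, List.set_cons_zero, List.getD_cons_succ, List.getD_cons_zero,
    Nat.zero_add]
  refine .seq h₂ ?_
  refine .seq (t := frame s b [stack w, [], [cd q'], List.replicate p' 0, List.replicate m' 0])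
    ?_ <|
    .seq (runs_cancel (p := p') (m := m') (by decide) (by simp) (by simp) rfl rfl) <|
    .seq (runs_popAll 2 (by simp)) ?_
  · have := runs_move (M := M) (r := s) (b := b) (l := [[], ((List.ofFn w).map cd).reverse ++ [],
      [cd q'], List.replicate p' 0, List.replicate m' 0]) (k := 1) (j := 0) (by decide) (by simp)
      (by simp) (cd : A → ℕ) (List.ofFn w).reverse (rest := []) (by simp) stops_nil
      (by simp; omega)
    simpa using this
  · simp only [List.set_cons_succ, List.set_cons_zero]
    refine .seq (t := frame s' b [stack w, [], [], [], List.replicate (m' - p') 0]) ?_ ?_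
    · rw [hs', ← update_frame_below _ hr, ← frame_below s hr
        [stack w, [], [], [], List.replicate (m' - p') 0]]
      cases e
      · refine runs_iteT ?_ (.push _ (by rwa [frame_below _ hr]))
        obtain ⟨x, hx⟩ : ∃ x, m' - p' = x + 1 :=
          Nat.exists_eq_succ_of_ne_zero (fun h => by simpa using hev.2 h)
        simp only [List.getD_cons_succ, List.getD_cons_zero, hx]
        rfl
      · refine runs_iteF ?_ (.push _ (by rwa [frame_below _ hr]))
        simp only [List.getD_cons_succ, List.getD_cons_zero, hev.1 rfl]
        rfl
    · exact runs_popAll 4 (by simp)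

end StackProg

namespace StackProg

open Turing Function

/-! ### Reachability by repeated halving -/

section Halving

variable {X : Type} (R : X → X → Prop)

/-- There is a chain of `n` steps. -/
def Chain : ℕ → X → X → Prop
  | 0, s, t => s = t
  | n + 1, s, t => ∃ u, Chain n s u ∧ R u t

/-- There is a chain of `2 ^ k` steps, expressed by recursion on `k` with a midpoint. -/
def Halving : ℕ → X → X → Prop
  | 0, s, t => R s t
  | k + 1, s, t => ∃ m, Halving k s m ∧ Halving k m t

variable {R}

theorem chain_add {m n : ℕ} {s t : X} :
    Chain R (m + n) s t ↔ ∃ u, Chain R m s u ∧ Chain R n u t := by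
  induction n generalizing t with
  | zero => simp [Chain]
  | succ n ih =>
    change (∃ v, Chain R (m + n) s v ∧ R v t) ↔ _
    simp only [Chain, ih]
    constructor
    · rintro ⟨v, ⟨u, h1, h2⟩, h3⟩; exact ⟨u, h1, v, h2, h3⟩
    · rintro ⟨u, h1, v, h2, h3⟩; exact ⟨v, ⟨u, h1, h2⟩, h3⟩

theorem halving_iff_chain {k : ℕ} {s t : X} : Halving R k s t ↔ Chain R (2 ^ k) s t := by
  induction k generalizing s t with
  | zero => simp [Halving, Chain]
  | succ k ih => simp only [Halving, ih, pow_succ, mul_two, chain_add]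

theorem Chain.reflTransGen {n : ℕ} {s t : X} (h : Chain R n s t) : Relation.ReflTransGen R s t := by
  induction n generalizing t with
  | zero => obtain rfl := h; exact .refl
  | succ n ih => obtain ⟨u, h1, h2⟩ := h; exact (ih h1).tail h2

/-- If `R` is reflexive on a type with at most `2 ^ k` elements, then `k` halvings suffice: the
sets of the elements reachable in `n` steps increase, and they are constant once two consecutive
ones agree. -/
theorem halving_iff_reflTransGen [Finite X] (hR : ∀ x, R x x) {k : ℕ} (hk : Nat.card X ≤ 2 ^ k)
    {s t : X} : Halving R k s t ↔ Relation.ReflTransGen R s t := by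
  rw [halving_iff_chain]
  refine ⟨Chain.reflTransGen, fun h => ?_⟩
  have mono : ∀ n, {t | Chain R n s t} ⊆ {t | Chain R (n + 1) s t} :=
    fun n t h => ⟨t, h, hR t⟩
  have stab : ∀ n, {t | Chain R n s t}.ncard = {t | Chain R (n + 1) s t}.ncard →
      {t | Chain R (n + 1) s t}.ncard = {t | Chain R (n + 2) s t}.ncard := by
    intro n h
    have e := Set.eq_of_subset_of_ncard_le (mono n) h.ge (Set.toFinite _)
    congr 1
    ext t
    constructor
    · exact fun h => mono _ h
    · rintro ⟨u, h1, h2⟩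
      exact ⟨u, e.symm.subset h1, h2⟩
  have key : ∀ n, Nat.card X ≤ n →
      {t | Chain R n s t}.ncard = {t | Chain R (Nat.card X) s t}.ncard := fun n hn =>
    Nat.stabilises_of_monotone (f := fun n => {t | Chain R n s t}.ncard)
      (monotone_nat_of_le_succ fun n => Set.ncard_le_ncard (mono n) (Set.toFinite _))
      (fun n => Set.ncard_le_card _) stab hn
  have e := Set.eq_of_subset_of_ncard_le (mono (2 ^ k))
    ((key _ (by omega)).trans (key _ hk).symm).le (Set.toFinite _)
  induction h with
  | refl =>
    have : ∀ n, Chain R n s s := fun n => by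
      induction n with
      | zero => rfl
      | succ n ih => exact ⟨s, ih, hR s⟩
    exact this _
  | tail _ h ih => exact e.symm.subset ⟨_, ih, h⟩

end Halving

/-! ### Enumeration of the words of a given length -/

section Enumeration

variable {S : Type} [Finite S]

theorem cd_lt (a : S) : cd a < Nat.card S := (Finite.equivFin S a).2

/-- The letter that follows `a` in the enumeration of the alphabet. -/
noncomputable def nxt (a : S) : Option S :=
  if h : cd a + 1 < Nat.card S then some ((Finite.equivFin S).symm ⟨cd a + 1, h⟩) else none

/-- The first letter of the alphabet. -/
noncomputable def first (S : Type) [Finite S] [Nonempty S] : S :=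
  (Finite.equivFin S).symm ⟨0, Nat.card_pos⟩

theorem cd_first [Nonempty S] : cd (first S) = 0 := by simp [cd, first]

theorem cd_of_nxt_eq_some {a a' : S} (h : nxt a = some a') : cd a' = cd a + 1 := by
  unfold nxt at h
  split_ifs at h with h'
  obtain rfl := Option.some.inj h
  simp [cd]

theorem cd_of_nxt_eq_none {a : S} (h : nxt a = none) : cd a + 1 = Nat.card S := by
  unfold nxt at h
  split_ifs at h with h'
  have := cd_lt a
  omega

/-- The words of length `N`, enumerated as numerals. -/
noncomputable def num {N : ℕ} : (Fin N → S) ≃ Fin (Nat.card S ^ N) :=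
  (Equiv.arrowCongr (Equiv.refl _) (Finite.equivFin S)).trans finFunctionFinEquiv

theorem num_val {N : ℕ} (m : Fin N → S) :
    (num m : ℕ) = ∑ i, cd (m i) * Nat.card S ^ (i : ℕ) := by
  simp [num, cd]

end Enumeration

/-! ### Depth-first evaluation of the halving recursion -/

section Search

variable {A S : Type} [Finite A] [Finite S]

/-- The letters of the frames of the recursion: a letter of the parameter, and the letters of the
start, the current midpoint and the end. -/
abbrev FLetter (A S : Type) : Type := A × S × S × S

/-- The separator of frames. -/
noncomputable def sep (A S : Type) : ℕ := Nat.card (FLetter A S)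

theorem stops_sep (rest : List ℕ) : Stops (FLetter A S) (sep A S :: rest) := by
  intro a h
  have := cd_lt a
  simp only [List.head?_cons, Option.some.injEq, sep] at h
  omega

/-- Push a frame for a subproblem of the problem in the frame on top of the stack `b + 1`. -/
noncomputable def descend (b : ℕ) (f : FLetter A S → FLetter A S) : Prog :=
  .seq (move₂ (FLetter A S) (b + 1) (b + 2) (b + 3) cd (cd ∘ f)) <|
    .seq (move (FLetter A S) (b + 2) (b + 1) cd) <| .seq (.push (b + 1) (sep A S)) <|
      move (FLetter A S) (b + 3) (b + 1) cd

variable {M : ℕ} {r : Store} {b : ℕ} {N : ℕ} {W C Ph Mo Cy : List ℕ}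

/-- The stack that has the frame `g` on top. -/
noncomputable abbrev withFrame (g : Fin N → FLetter A S) (rest : List ℕ) : List ℕ :=
  stack g ++ sep A S :: rest

theorem length_stack {B : Type} [Finite B] (g : Fin N → B) : (stack g).length = N := by simp

theorem runs_descend (f : FLetter A S → FLetter A S) (g : Fin N → FLetter A S) (rest : List ℕ)
    (hM : rest.length + 2 * (N + 1) ≤ M) :
    Runs M (descend b f) (frame r b [W, withFrame g rest, [], [], C, Ph, Mo, Cy, []])
      (frame r b [W, withFrame (f ∘ g) (withFrame g rest), [], [], C, Ph, Mo, Cy, []]) := by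
  refine .seq (t := frame r b [W, sep A S :: rest, (stack g).reverse, (stack (f ∘ g)).reverse,
      C, Ph, Mo, Cy, []]) ?_ <|
    .seq (t := frame r b [W, withFrame g rest, [], (stack (f ∘ g)).reverse, C, Ph, Mo, Cy, []])
      ?_ <|
    .seq (t := frame r b [W, sep A S :: withFrame g rest, [], (stack (f ∘ g)).reverse,
      C, Ph, Mo, Cy, []]) ?_ ?_
  · have := runs_move₂ (M := M) (r := r) (b := b)
      (l := [W, withFrame g rest, [], [], C, Ph, Mo, Cy, []]) (k := 1) (j := 2) (j' := 3)
      (by decide) (by decide) (by decide) (by simp) (by simp) (by simp)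
      (cd : FLetter A S → ℕ) (cd ∘ f) (List.ofFn g) rfl (stops_sep rest)
      (by simp; omega) (by simp; omega)
    simp only [List.set_cons_succ, List.set_cons_zero, List.getD_cons_succ, List.getD_cons_zero,
      List.append_nil] at this
    have e : stack (f ∘ g) = (List.ofFn g).map (cd ∘ f) := by
      simp [List.map_ofFn, Function.comp_assoc]
    rw [e]
    exact this
  · have := runs_move (M := M) (r := r) (b := b)
      (l := [W, sep A S :: rest, (stack g).reverse, (stack (f ∘ g)).reverse, C, Ph, Mo, Cy, []])
      (k := 2) (j := 1) (by decide) (by simp) (by simp)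
      (cd : FLetter A S → ℕ) (List.ofFn g).reverse (rest := []) (by simp) stops_nil
      (by simp; omega)
    simp only [List.set_cons_succ, List.set_cons_zero, List.getD_cons_succ, List.getD_cons_zero,
      List.map_reverse, List.reverse_reverse] at this
    exact this
  · exact runs_push 1 _ (by simp) (by
      simp only [List.getD_cons_succ, List.getD_cons_zero, List.length_append, length_stack,
        List.length_cons]
      omega)
  · have := runs_move (M := M) (r := r) (b := b)
      (l := [W, sep A S :: withFrame g rest, [], (stack (f ∘ g)).reverse, C, Ph, Mo, Cy, []])
      (k := 3) (j := 1) (by decide) (by simp) (by simp)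
      (cd : FLetter A S → ℕ) (List.ofFn (f ∘ g)).reverse (rest := []) (by simp) stops_nil
      (by
        simp only [List.getD_cons_succ, List.getD_cons_zero, List.length_append, length_stack,
          List.length_cons, List.length_reverse, List.length_ofFn]
        omega)
    simp only [List.set_cons_succ, List.set_cons_zero, List.getD_cons_succ, List.getD_cons_zero,
      List.map_reverse, List.reverse_reverse] at this
    exact this

/-- The number of the midpoint in a frame. -/
noncomputable def mid {A S : Type} [Finite S] {N : ℕ} (g : Fin N → FLetter A S) : ℕ :=
  num fun i => (g i).2.2.1

theorem mid_cons {A S : Type} [Finite S] {N : ℕ} (x : FLetter A S) (g : Fin N → FLetter A S) :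
    mid (Fin.cons x g : Fin (N + 1) → FLetter A S) = cd x.2.2.1 + Nat.card S * mid g := by
  rw [mid, mid, num_val, num_val, Fin.sum_univ_succ, Finset.mul_sum]
  simp only [Fin.cons_zero, Fin.cons_succ, Fin.val_zero, pow_zero, mul_one, Fin.val_succ]
  congr 1
  exact Finset.sum_congr rfl fun i _ => by ring

variable [Nonempty S]

/-- From a frame to the frame of the first half of the problem. -/
noncomputable def half₁ (x : FLetter A S) : FLetter A S := (x.1, x.2.1, first S, x.2.2.1)

/-- From a frame to the frame of the second half of the problem. -/
noncomputable def half₂ (x : FLetter A S) : FLetter A S := (x.1, x.2.2.1, first S, x.2.2.2)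

/-- One step of adding a carry to the midpoint in a frame, which is moved from the stack `b + 1`
to the stack `b + 2`; the carry is on the stack `b + 7`. -/
noncomputable def addCarry (b : ℕ) (x : FLetter A S) : Prog :=
  .ite (b + 7) (fun o => o == some 1)
    (match nxt x.2.2.1 with
      | some m => .seq (.push (b + 2) (cd ((x.1, x.2.1, m, x.2.2.2) : FLetter A S)))
          (.seq (.pop (b + 7)) (.push (b + 7) 0))
      | none => .push (b + 2) (cd ((x.1, x.2.1, first S, x.2.2.2) : FLetter A S)))
    (.push (b + 2) (cd x))

/-- Go on to the next midpoint in the frame on top of the stack `b + 1`, or return `false` if there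
is none. -/
noncomputable def advance (A S : Type) [Finite A] [Finite S] [Nonempty S] (b : ℕ) : Prog :=
  .seq (.push (b + 7) 1) <| .seq (scan (b + 1) (addCarry (A := A) (S := S) b)) <|
    .ite (b + 7) (fun o => o == some 1)
      (.seq (.pop (b + 7)) <| .seq (clear (FLetter A S) (b + 2)) <| .seq (.pop (b + 1)) <|
        .push (b + 4) 0)
      (.seq (.pop (b + 7)) <| .seq (move (FLetter A S) (b + 2) (b + 1) cd) <|
        .seq (descend (A := A) (S := S) b half₁) <| .seq (.push (b + 5) 1) <|
          .seq (.pop (b + 6)) <| .push (b + 6) 2)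

/-- Evaluate a problem at the bottom of the recursion by the program `P`. -/
noncomputable def evalLeaf (A S : Type) [Finite A] [Finite S] (b : ℕ) (P : Prog) : Prog :=
  .seq (.pop (b + 6)) <| .seq (move (FLetter A S) (b + 1) (b + 2) cd) <| .seq (.pop (b + 1)) <|
    .seq (move (FLetter A S) (b + 2) (b + 8) fun x => cd ((x.1, x.2.1, x.2.2.2) : A × S × S)) <|
      .seq P <| clear (A × S × S) (b + 8)

/-- One step of the depth-first evaluation. The stack `b + 1` holds the frames of the open problems,
the stack `b + 4` the depth of the recursion that is left, and the stack `b + 5` tells for each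
frame except the top one whether its first or its second half is being evaluated. The stack
`b + 6` holds `2` if the problem on top is to be evaluated, and else the value that has been found.
The final value goes to the stack `r`. -/
noncomputable def searchStep (A S : Type) [Finite A] [Finite S] [Nonempty S] (b r : ℕ)
    (P : Prog) : Prog :=
  .ite (b + 6) (fun o => o == some 2)
    (.ite (b + 4) Option.isSome
      (.seq (.pop (b + 4)) <| .seq (descend (A := A) (S := S) b half₁) (.push (b + 5) 1))
      (evalLeaf A S b P))
    (.ite (b + 5) Option.isSome
      (.ite (b + 6) (fun o => o == some 1)
        (.ite (b + 5) (fun o => o == some 1)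
          (.seq (.pop (b + 5)) <| .seq (descend (A := A) (S := S) b half₂) <|
            .seq (.push (b + 5) 2) <| .seq (.pop (b + 6)) <| .push (b + 6) 2)
          (.seq (.pop (b + 5)) <| .seq (clear (FLetter A S) (b + 1)) <| .seq (.pop (b + 1)) <|
            .push (b + 4) 0))
        (.seq (.pop (b + 5)) (advance A S b)))
      (.seq (.ite (b + 6) (fun o => o == some 1) (.push r 1) (.push r 0)) (.pop (b + 6))))

/-- Reading the midpoint of a frame as a numeral with the least significant digit on top, the carry
`c` is added to it, and `c'` is the carry that is left over. -/
theorem runs_addCarry (c : Bool) (g : Fin N → FLetter A S) (T rest : List ℕ)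
    (hr : Stops (FLetter A S) rest) (hM : T.length + N < M) :
    ∃ (g' : Fin N → FLetter A S) (c' : Bool),
      (∀ i, (g' i).1 = (g i).1 ∧ (g' i).2.1 = (g i).2.1 ∧ (g' i).2.2.2 = (g i).2.2.2) ∧
      mid g' + Nat.card S ^ N * c'.toNat = mid g + c.toNat ∧
      Runs M (scan (b + 1) (addCarry (A := A) (S := S) b))
        (frame r b [W, stack g ++ rest, T, [], C, Ph, Mo, [c.toNat], []])
        (frame r b [W, rest, (stack g').reverse ++ T, [], C, Ph, Mo, [c'.toNat], []]) := by
  induction N generalizing c T with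
  | zero =>
    refine ⟨g, c, fun i => i.elim0, by simp, runs_scan_nil ?_⟩
    rw [frame_apply]; simpa using hr
  | succ N ih =>
    obtain ⟨x, g, rfl⟩ : ∃ x g₀, g = Fin.cons x g₀ := ⟨_, _, (Fin.cons_self_tail g).symm⟩
    have hs : ∀ (y : FLetter A S) (h : Fin N → FLetter A S),
        stack (Fin.cons y h : Fin (N + 1) → FLetter A S) = cd y :: stack h := fun y h => by
      simp [List.ofFn_succ, Function.comp_def]
    -- The effect on the first letter.
    obtain ⟨y, c₁, hy, hcd, hrun⟩ : ∃ (y : FLetter A S) (c₁ : Bool),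
        (y.1 = x.1 ∧ y.2.1 = x.2.1 ∧ y.2.2.2 = x.2.2.2) ∧
        cd y.2.2.1 + Nat.card S * c₁.toNat = cd x.2.2.1 + c.toNat ∧
        Runs M (addCarry (A := A) (S := S) b x)
          (frame r b [W, stack g ++ rest, T, [], C, Ph, Mo, [c.toNat], []])
          (frame r b [W, stack g ++ rest, cd y :: T, [], C, Ph, Mo, [c₁.toNat], []]) := by
      cases c
      · exact ⟨x, false, ⟨rfl, rfl, rfl⟩, by simp,
          runs_iteF (i := 7) rfl (runs_push 2 _ (by simp) (by change T.length < M; omega))⟩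
      · cases hn : nxt x.2.2.1 with
        | none =>
          refine ⟨(x.1, x.2.1, first S, x.2.2.2), true, ⟨rfl, rfl, rfl⟩, ?_,
            runs_iteT (i := 7) rfl ?_⟩
          · have := cd_of_nxt_eq_none hn
            simp [cd_first, this]
          · rw [hn]
            exact runs_push 2 _ (by simp) (by change T.length < M; omega)
        | some m =>
          refine ⟨(x.1, x.2.1, m, x.2.2.2), false, ⟨rfl, rfl, rfl⟩, ?_,
            runs_iteT (i := 7) rfl ?_⟩
          · have := cd_of_nxt_eq_some hn
            simp [this]
          · rw [hn]
            exact .seq (runs_push 2 _ (by simp) (by change T.length < M; omega))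
              (.seq (runs_pop 7 (by simp)) (runs_push 7 0 (by simp) (by change 0 < M; omega)))
    obtain ⟨g', c', hg, hc, hrun'⟩ := ih c₁ g (cd y :: T) (by rw [List.length_cons]; omega)
    refine ⟨Fin.cons y g', c', fun i => ?_, ?_, ?_⟩
    · refine Fin.cases ?_ (fun i => ?_) i
      · simpa using hy
      · simpa using hg i
    · rw [mid_cons, mid_cons, pow_succ]
      have : Nat.card S * (mid g' + Nat.card S ^ N * c'.toNat) =
        Nat.card S * (mid g + c₁.toNat) := by rw [hc]
      nlinarith
    · rw [hs, hs, List.cons_append]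
      refine runs_scan_cons (a := x) (by rw [frame_apply]; rfl) (t := frame r b
        [W, stack g ++ rest, cd y :: T, [], C, Ph, Mo, [c₁.toNat], []]) ?_ (by simpa using hrun')
      rw [update_frame _ _ _ (by simp), frame_apply]
      exact hrun

end Search

end StackProg

namespace StackProg

open Turing Function

section Search

variable {A S : Type} [Finite A] [Finite S] [Nonempty S]
variable {M : ℕ} {s : Store} {b r : ℕ} {N : ℕ} {W : List ℕ}

/-- The frame of the problem to get from `u` to `v`, with midpoint `m`. -/
abbrev frameOf (a : Fin N → A) (u m v : Fin N → S) : Fin N → FLetter A S :=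
  fun i => (a i, u i, m i, v i)

/-- The store during the search, see `searchStep`. -/
abbrev searchStore (s : Store) (b : ℕ) (W Fr C Ph Mo : List ℕ) : Store :=
  frame s b [W, Fr, [], [], C, Ph, Mo, [], []]

theorem searchStore_six {Fr C Ph Mo : List ℕ} :
    searchStore s b W Fr C Ph Mo (b + 6) = Mo := frame_apply ..

/-- The execution of one step of the search. -/
def SearchStep (A S : Type) [Finite A] [Finite S] [Nonempty S] (M b r : ℕ) (P : Prog)
    (σ τ : Store) : Prop :=
  (σ (b + 6)).head?.isSome = true ∧ Runs M (searchStep A S b r P) σ τ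

/-- The search: execute `searchStep` until the stack `b + 6` is empty. -/
noncomputable def search (A S : Type) [Finite A] [Finite S] [Nonempty S] (b r : ℕ) (P : Prog) :
    Prog :=
  .loop (b + 6) Option.isSome (searchStep A S b r P)

theorem runs_search {P : Prog} {σ τ : Store}
    (h : Relation.ReflTransGen (SearchStep A S M b r P) σ τ) (hτ : τ (b + 6) = []) :
    Runs M (search A S b r P) σ τ := by
  induction h using Relation.ReflTransGen.head_induction_on with
  | refl => exact .loopF (by rw [hτ]; rfl)
  | head h _ ih => exact .loopT h.1 h.2 ih

/-- If no depth is left, the problem is evaluated by `P`. -/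
theorem searchStep_evalLeaf {a : Fin N → A} {u m v : Fin N → S} {rest Ph : List ℕ} {P : Prog}
    (hM : rest.length + (N + 1) ≤ M) (c : Bool)
    (hP : ∀ s : Store, (s (b + 6)).length < M →
      Runs M P (frame s (b + 8) [stack fun i => (a i, u i, v i)])
        (frame (update s (b + 6) (c.toNat :: s (b + 6))) (b + 8)
          [stack fun i => (a i, u i, v i)])) :
    SearchStep A S M b r P (searchStore s b W (withFrame (frameOf a u m v) rest) [] Ph [2])
      (searchStore s b W rest [] Ph [c.toNat]) := by
  refine ⟨by rw [searchStore_six]; rfl, runs_iteT (i := 6) rfl (runs_iteF (i := 4) rfl ?_)⟩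
  set g := frameOf a u m v
  have e₁ : ∀ Mo x, frame s b [W, rest, [], [], [], Ph, Mo, [], x] =
      frame (frame s b [W, rest, [], [], [], Ph, Mo, []]) (b + 8) [x] := fun Mo x =>
    frame_append s b [W, rest, [], [], [], Ph, Mo, []] [x]
  refine .seq (runs_pop 6 (by simp)) <|
    .seq (t := frame s b [W, sep A S :: rest, (stack g).reverse, [], [], Ph, [], [], []]) ?_ <|
    .seq (runs_pop 1 (by simp)) <|
    .seq (t := frame s b [W, rest, [], [], [], Ph, [], [], stack fun i => (a i, u i, v i)]) ?_ <|
    .seq (t := frame s b [W, rest, [], [], [], Ph, [c.toNat], [],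
      stack fun i => (a i, u i, v i)]) ?_ ?_
  · have := runs_move (M := M) (r := s) (b := b)
      (l := [W, withFrame g rest, [], [], [], Ph, [], [], []]) (k := 1) (j := 2)
      (by decide) (by simp) (by simp) (cd : FLetter A S → ℕ) (List.ofFn g) rfl (stops_sep rest)
      (by simp; omega)
    simp only [List.set_cons_succ, List.set_cons_zero, List.getD_cons_succ, List.getD_cons_zero,
      List.append_nil] at this
    exact this
  · have := runs_move (M := M) (r := s) (b := b)
      (l := [W, rest, (stack g).reverse, [], [], Ph, [], [], []]) (k := 2) (j := 8)
      (by decide) (by simp) (by simp)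
      (fun x : FLetter A S => cd ((x.1, x.2.1, x.2.2.2) : A × S × S)) (List.ofFn g).reverse
      (rest := []) (by simp) stops_nil (by simp; omega)
    simp only [List.set_cons_succ, List.set_cons_zero, List.getD_cons_succ, List.getD_cons_zero,
      List.map_reverse, List.reverse_reverse, List.append_nil] at this
    have e : (stack fun i => (a i, u i, v i)) = (List.ofFn g).map
        fun x : FLetter A S => cd ((x.1, x.2.1, x.2.2.2) : A × S × S) := by
      simp only [stack, List.map_ofFn]; rfl
    rw [e]
    exact this
  · have := hP (frame s b [W, rest, [], [], [], Ph, [], []])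
      (by rw [frame_apply]; change 0 < M; omega)
    rw [frame_apply, update_frame _ _ _ (by simp)] at this
    rw [e₁, e₁]
    exact this
  · exact runs_clear (k := 8) (by simp) (List.ofFn fun i => (a i, u i, v i)) (rest := [])
      (by simp) stops_nil

variable {a : Fin N → A} {u m v : Fin N → S} {rest C Ph : List ℕ} {P : Prog}

/-- If depth is left, the evaluation of a problem begins with its first half, for the first
midpoint. -/
theorem searchStep_descend {k : ℕ} (hM : rest.length + 2 * (N + 1) ≤ M) (hPh : Ph.length < M) :
    SearchStep A S M b r P
      (searchStore s b W (withFrame (frameOf a u m v) rest) (List.replicate (k + 1) 0) Ph [2])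
      (searchStore s b W (withFrame (frameOf a u (fun _ => first S) m)
        (withFrame (frameOf a u m v) rest)) (List.replicate k 0) (1 :: Ph) [2]) :=
  ⟨by rw [searchStore_six]; rfl, runs_iteT (i := 6) rfl <| runs_iteT (i := 4) rfl <|
    .seq (runs_pop 4 (by simp)) <|
      .seq (runs_descend half₁ (frameOf a u m v) rest hM) (runs_push 5 1 (by simp) hPh)⟩

/-- If the first half is true, the second half is evaluated. -/
theorem searchStep_second (hM : rest.length + 2 * (N + 1) ≤ M) (hPh : Ph.length < M) :
    SearchStep A S M b r P
      (searchStore s b W (withFrame (frameOf a u m v) rest) C (1 :: Ph) [1])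
      (searchStore s b W (withFrame (frameOf a m (fun _ => first S) v)
        (withFrame (frameOf a u m v) rest)) C (2 :: Ph) [2]) :=
  ⟨by rw [searchStore_six]; rfl, runs_iteF (i := 6) rfl <| runs_iteT (i := 5) rfl <|
    runs_iteT (i := 6) rfl <| runs_iteT (i := 5) rfl <| .seq (runs_pop 5 (by simp)) <|
      .seq (runs_descend half₂ (frameOf a u m v) rest hM) <| .seq (runs_push 5 2 (by simp) hPh) <|
        .seq (runs_pop 6 (by simp)) (runs_push 6 2 (by simp) (by change 0 < M; omega))⟩

/-- If both halves are true, so is the problem. -/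
theorem searchStep_found (hC : C.length < M) :
    SearchStep A S M b r P
      (searchStore s b W (withFrame (frameOf a u m v) rest) C (2 :: Ph) [1])
      (searchStore s b W rest (0 :: C) Ph [1]) :=
  ⟨by rw [searchStore_six]; rfl, runs_iteF (i := 6) rfl <| runs_iteT (i := 5) rfl <|
    runs_iteT (i := 6) rfl <| runs_iteF (i := 5) rfl <| .seq (runs_pop 5 (by simp)) <|
      .seq (runs_clear (A := FLetter A S) (k := 1) (by simp) (List.ofFn (frameOf a u m v)) rfl
        (stops_sep rest)) <| .seq (runs_pop 1 (by simp)) (runs_push 4 0 (by simp) hC)⟩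

/-- If a half is false, the next midpoint is tried; after the last midpoint the problem is false. -/
theorem searchStep_advance (hM : rest.length + 2 * (N + 1) ≤ M) (hPh : Ph.length < M)
    (hC : C.length < M) (p : ℕ) :
    ((num m : ℕ) + 1 = Nat.card S ^ N ∧ SearchStep A S M b r P
      (searchStore s b W (withFrame (frameOf a u m v) rest) C (p :: Ph) [0])
      (searchStore s b W rest (0 :: C) Ph [0])) ∨
    ∃ m' : Fin N → S, (num m' : ℕ) = num m + 1 ∧ SearchStep A S M b r P
      (searchStore s b W (withFrame (frameOf a u m v) rest) C (p :: Ph) [0])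
      (searchStore s b W (withFrame (frameOf a u (fun _ => first S) m')
        (withFrame (frameOf a u m' v) rest)) C (1 :: Ph) [2]) := by
  obtain ⟨g, c, hg, hc, hr⟩ := runs_addCarry (M := M) (r := s) (b := b) (W := W) (C := C)
    (Ph := Ph) (Mo := [0]) true (frameOf a u m v) [] (sep A S :: rest) (stops_sep rest)
    (by simp; omega)
  obtain ⟨m', rfl⟩ : ∃ m', g = frameOf a u m' v :=
    ⟨fun i => (g i).2.2.1, funext fun i => by
      obtain ⟨h1, h2, h3⟩ := hg i
      exact Prod.ext h1 (Prod.ext h2 (Prod.ext rfl h3))⟩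
  rw [List.append_nil] at hr
  have hm' : (num m' : ℕ) + Nat.card S ^ N * c.toNat = num m + 1 := hc
  have start : ∀ {Q t}, Runs M Q
      (frame s b [W, sep A S :: rest, (stack (frameOf a u m' v)).reverse, [], C, Ph, [0],
        [c.toNat], []]) t →
      Runs M (.seq (.pop (b + 5)) (.seq (.push (b + 7) 1) <|
        .seq (scan (b + 1) (addCarry (A := A) (S := S) b)) Q))
        (searchStore s b W (withFrame (frameOf a u m v) rest) C (p :: Ph) [0]) t := fun hQ =>
    .seq (runs_pop 5 (by simp)) <|
      .seq (runs_push 7 1 (by simp) (by change 0 < M; omega)) <| .seq hr hQ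
  have wrap : ∀ {t}, Runs M (.seq (.pop (b + 5)) (advance A S b))
        (searchStore s b W (withFrame (frameOf a u m v) rest) C (p :: Ph) [0]) t →
      SearchStep A S M b r P
        (searchStore s b W (withFrame (frameOf a u m v) rest) C (p :: Ph) [0]) t := fun h =>
    ⟨by rw [searchStore_six]; rfl, runs_iteF (i := 6) rfl <| runs_iteT (i := 5) rfl <|
      runs_iteF (i := 6) rfl h⟩
  cases c
  · refine .inr ⟨m', by simpa using hm', wrap <| start <| runs_iteF (i := 7) rfl <|
      .seq (runs_pop 7 (by simp)) <|
      .seq (t := searchStore s b W (withFrame (frameOf a u m' v) rest) C Ph [0]) ?_ <|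
      .seq (runs_descend half₁ (frameOf a u m' v) rest hM) <| .seq (runs_push 5 1 (by simp) hPh) <|
      .seq (runs_pop 6 (by simp)) (runs_push 6 2 (by simp) (by change 0 < M; omega))⟩
    have := runs_move (M := M) (r := s) (b := b)
      (l := [W, sep A S :: rest, (stack (frameOf a u m' v)).reverse, [], C, Ph, [0], [], []])
      (k := 2) (j := 1) (by decide) (by simp) (by simp) (cd : FLetter A S → ℕ)
      (List.ofFn (frameOf a u m' v)).reverse (rest := []) (by simp) stops_nil (by simp; omega)
    simp only [List.set_cons_succ, List.set_cons_zero, List.getD_cons_succ, List.getD_cons_zero,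
      List.map_reverse, List.reverse_reverse] at this
    exact this
  · have hlt := (num m).2
    have : (num m : ℕ) + 1 = Nat.card S ^ N := by
      simp only [Bool.toNat_true, mul_one] at hm'
      omega
    exact .inl ⟨this, wrap <| start <| runs_iteT (i := 7) rfl <| .seq (runs_pop 7 (by simp)) <|
      .seq (runs_clear (A := FLetter A S) (k := 2) (by simp) (List.ofFn (frameOf a u m' v)).reverse
        (rest := []) (by simp) stops_nil) <| .seq (runs_pop 1 (by simp))
        (runs_push 4 0 (by simp) hC)⟩

open Classical in
/-- The search evaluates the problem on top of the stack of frames. -/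
theorem search_halving {Q : (Fin N → S) → (Fin N → S) → Prop}
    (hP : ∀ (u v : Fin N → S) (s : Store) (c : Bool), (s (b + 6)).length < M →
      (c = true ↔ Q u v) →
      Runs M P (frame s (b + 8) [stack fun i => (a i, u i, v i)])
        (frame (update s (b + 6) (c.toNat :: s (b + 6))) (b + 8)
          [stack fun i => (a i, u i, v i)])) (k : ℕ) :
    ∀ (u v : Fin N → S) (rest Ph : List ℕ), rest.length + (k + 1) * (N + 1) ≤ M → k ≤ M →
      Ph.length + k ≤ M →
      Relation.ReflTransGen (SearchStep A S M b r P)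
        (searchStore s b W (withFrame (frameOf a u (fun _ => first S) v) rest)
          (List.replicate k 0) Ph [2])
        (searchStore s b W rest (List.replicate k 0) Ph [(decide (Halving Q k u v)).toNat]) := by
  induction k with
  | zero =>
    intro u v rest Ph hM _ _
    exact .single (searchStep_evalLeaf (by omega) _ fun s hs =>
      hP u v s _ hs (by rw [decide_eq_true_iff]; exact Iff.rfl))
  | succ k ih =>
    intro u v rest Ph hM hk hPh
    have hM' : rest.length + (N + 1) + (k + 1) * (N + 1) ≤ M := by
      rw [add_mul (k + 1), one_mul] at hM; omega
    have hN : N + 1 ≤ (k + 1) * (N + 1) := Nat.le_mul_of_pos_left _ (by omega)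
    have hl : ∀ m : Fin N → S, (withFrame (frameOf a u m v) rest).length =
        rest.length + (N + 1) := fun m => by
      simp only [List.length_append, length_stack, List.length_cons]; omega
    -- The search from a given midpoint on.
    have inner : ∀ (j : ℕ) (m : Fin N → S), (num m : ℕ) + (j + 1) = Nat.card S ^ N →
        Relation.ReflTransGen (SearchStep A S M b r P)
          (searchStore s b W (withFrame (frameOf a u (fun _ => first S) m)
            (withFrame (frameOf a u m v) rest)) (List.replicate k 0) (1 :: Ph) [2])
          (searchStore s b W rest (List.replicate (k + 1) 0) Ph
            [(decide (∃ m', num m ≤ num m' ∧ Halving Q k u m' ∧ Halving Q k m' v)).toNat]) := by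
      intro j
      induction j with
      | zero =>
        intro m hj
        have hlast : ∀ m', num m ≤ num m' → m' = m := fun m' h => by
          have h1 : (num m : ℕ) ≤ num m' := h
          have h2 := (num m').2
          exact num.injective (Fin.ext (by omega))
        have fail : ∀ p, Relation.ReflTransGen (SearchStep A S M b r P)
            (searchStore s b W (withFrame (frameOf a u m v) rest) (List.replicate k 0) (p :: Ph)
              [0]) (searchStore s b W rest (List.replicate (k + 1) 0) Ph [0]) := fun p => by
          rcases searchStep_advance (s := s) (b := b) (r := r) (W := W) (a := a) (u := u) (m := m)
            (v := v) (rest := rest) (Ph := Ph) (C := List.replicate k 0) (P := P) (M := M)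
            (by omega) (by omega) (by simp; omega) p with ⟨-, h⟩ | ⟨m', hm', -⟩
          · exact .single h
          · have := (num m').2
            omega
        refine (ih u m _ (1 :: Ph) (by rw [hl]; omega) (by omega)
          (by rw [List.length_cons]; omega)).trans ?_
        by_cases h1 : Halving Q k u m
        · refine .head (by simpa [h1] using searchStep_second (by omega) (by omega)) ?_
          refine (ih m v _ (2 :: Ph) (by rw [hl]; omega) (by omega)
            (by rw [List.length_cons]; omega)).trans ?_
          by_cases h2 : Halving Q k m v
          · have : ∃ m', num m ≤ num m' ∧ Halving Q k u m' ∧ Halving Q k m' v := ⟨m, le_rfl, h1, h2⟩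
            simp only [h2, this, decide_true]
            exact .single (searchStep_found (by simp; omega))
          · have : ¬ ∃ m', num m ≤ num m' ∧ Halving Q k u m' ∧ Halving Q k m' v := by
              rintro ⟨m', h, -, h'⟩
              rw [hlast m' h] at h'
              exact h2 h'
            simp only [h2, this, decide_false]
            exact fail 2
        · have : ¬ ∃ m', num m ≤ num m' ∧ Halving Q k u m' ∧ Halving Q k m' v := by
            rintro ⟨m', h, h', -⟩
            rw [hlast m' h] at h'
            exact h1 h'
          simp only [h1, this, decide_false]
          exact fail 1
      | succ j ihj =>
        intro m hj
        have fail : ∀ p, ¬ (Halving Q k u m ∧ Halving Q k m v) →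
            Relation.ReflTransGen (SearchStep A S M b r P)
            (searchStore s b W (withFrame (frameOf a u m v) rest) (List.replicate k 0) (p :: Ph)
              [0]) (searchStore s b W rest (List.replicate (k + 1) 0) Ph
            [(decide (∃ m', num m ≤ num m' ∧ Halving Q k u m' ∧ Halving Q k m' v)).toNat]) := by
          intro p hp
          rcases searchStep_advance (s := s) (b := b) (r := r) (W := W) (a := a) (u := u) (m := m)
            (v := v) (rest := rest) (Ph := Ph) (C := List.replicate k 0) (P := P) (M := M)
            (by omega) (by omega) (by simp; omega) p with ⟨h, -⟩ | ⟨m₁, hm₁, h⟩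
          · omega
          · refine .head h ?_
            have e : (∃ m', num m ≤ num m' ∧ Halving Q k u m' ∧ Halving Q k m' v) ↔
                ∃ m', num m₁ ≤ num m' ∧ Halving Q k u m' ∧ Halving Q k m' v := by
              refine exists_congr fun m' => ⟨fun ⟨h1, h2⟩ => ⟨?_, h2⟩, fun ⟨h1, h2⟩ => ⟨?_, h2⟩⟩
              · have hne : (num m : ℕ) ≠ num m' := fun e => hp (num.injective (Fin.ext e) ▸ h2)
                have h3 : (num m : ℕ) < num m' := lt_of_le_of_ne h1 hne
                change (num m₁ : ℕ) ≤ num m'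
                omega
              · have h3 : (num m₁ : ℕ) ≤ num m' := h1
                change (num m : ℕ) ≤ num m'
                omega
            simp only [e]
            exact ihj m₁ (by omega)
        refine (ih u m _ (1 :: Ph) (by rw [hl]; omega) (by omega)
          (by rw [List.length_cons]; omega)).trans ?_
        by_cases h1 : Halving Q k u m
        · refine .head (by simpa [h1] using searchStep_second (by omega) (by omega)) ?_
          refine (ih m v _ (2 :: Ph) (by rw [hl]; omega) (by omega)
            (by rw [List.length_cons]; omega)).trans ?_
          by_cases h2 : Halving Q k m v
          · have : ∃ m', num m ≤ num m' ∧ Halving Q k u m' ∧ Halving Q k m' v := ⟨m, le_rfl, h1, h2⟩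
            simp only [h2, this, decide_true]
            exact .single (searchStep_found (by simp; omega))
          · simp only [h2, decide_false]
            exact fail 2 (fun h => h2 h.2)
        · simp only [h1, decide_false]
          exact fail 1 (fun h => h1 h.1)
    refine .head (searchStep_descend (by omega) (by omega)) ?_
    have h0 : (num fun _ : Fin N => first S : ℕ) = 0 := by
      rw [num_val]; simp [cd_first]
    have hpos : 0 < Nat.card S ^ N := Nat.pow_pos Nat.card_pos
    have := inner (Nat.card S ^ N - 1) (fun _ => first S) (by omega)
    have e : (∃ m', num (fun _ : Fin N => first S) ≤ num m' ∧ Halving Q k u m' ∧ Halving Q k m' v) ↔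
        Halving Q (k + 1) u v :=
      exists_congr fun m' => ⟨fun h => h.2, fun h => ⟨by
        change ((num fun _ : Fin N => first S) : ℕ) ≤ num m'; omega, h⟩⟩
    simp only [e] at this
    exact this

end Search

end StackProg

namespace StackProg

open Turing Function

/-! ### Closure under sums, quantifiers and transitive closure -/

namespace PS

variable {A S : Type} [Finite A] [Finite S]

/-- Comparison of weighted numbers of letters, by an automaton with one state. -/
theorem sum (ω : A → ℤ) (c : ℤ) : PS fun _ w => 0 ≤ c + ∑ i, ω (w i) := by
  refine (PS.automaton (fun (_ : Unit) _ => ()) (fun _ a => ω a) () c).congr fun N w => ?_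
  have : ∀ l : List A, wsum (fun (_ : Unit) _ => ()) (fun _ a => ω a) () l = (l.map ω).sum := by
    intro l
    induction l with
    | nil => rfl
    | cons a l ih => simp [wsum, ih]
  rw [this, List.map_ofFn, List.sum_ofFn]
  rfl

theorem any (φ : A → Prop) : PS fun _ w => ∃ i, φ (w i) := by
  classical
  refine (PS.sum (fun a => if φ a then 1 else 0) (-1)).congr fun N w => ?_
  rw [Finset.sum_boole]
  have : (∃ i, φ (w i)) ↔ 0 < (Finset.univ.filter fun i => φ (w i)).card := by
    rw [Finset.card_pos, Finset.filter_nonempty_iff]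
    simp
  rw [this]
  omega

theorem all (φ : A → Prop) : PS fun _ w => ∀ i, φ (w i) :=
  (PS.any fun a => ¬ φ a).not.congr fun N w => by push Not; rfl

variable [Nonempty S]

/-- Moving a word `w` to another stack while pushing `q * w.length` zeros, the depth of the search.
-/
theorem runs_loadDepth {M : ℕ} {s : Store} {b : ℕ} {B : Type} [Finite B] (q : ℕ) (w : List B)
    (T : List ℕ) (n : ℕ) (hT : T.length + w.length ≤ M) (hn : n + q * w.length ≤ M) :
    Runs M (scan (b + 0) fun x : B => .seq (.push (b + 2) (cd x)) (pushZeros (b + 4) q))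
      (frame s b [w.map cd, [], T, [], List.replicate n 0, [], [], [], []])
      (frame s b [[], [], (w.map cd).reverse ++ T, [], List.replicate (n + q * w.length) 0,
        [], [], [], []]) := by
  induction w generalizing T n with
  | nil => exact runs_scan_nil (by rw [frame_apply]; exact stops_nil)
  | cons a w ih =>
    rw [List.length_cons] at hT hn
    rw [Nat.mul_succ] at hn
    refine runs_scan_cons (a := a) (by rw [frame_apply]; rfl) (t := frame s b
      [w.map cd, [], cd a :: T, [], List.replicate (n + q) 0, [], [], [], []]) ?_ ?_
    · rw [update_frame _ _ _ (by simp), frame_apply]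
      exact .seq (runs_push 2 _ (by simp) (by change T.length < M; omega))
        (runs_pushZeros 4 _ _ (by simp) rfl (by omega))
    · have := ih (cd a :: T) (n + q) (by rw [List.length_cons]; omega) (by omega)
      rw [List.length_cons, Nat.mul_succ, List.map_cons, List.reverse_cons, List.append_assoc,
        show n + (q * w.length + q) = n + q + q * w.length by omega]
      exact this

/-- Chains of words, with respect to a relation that may depend on a parameter. There are at most
`2 ^ (q * N)` words of length `N` over an alphabet with `q` letters, so that `q * N` halvings
suffice. -/
theorem reflTransGen {L : ∀ N, (Fin N → A × S × S) → Prop} (h : PS L) :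
    PS fun N (w : Fin N → A × S × S) =>
      Relation.ReflTransGen (fun u v : Fin N → S => L N fun i => ((w i).1, u i, v i))
        (fun i => (w i).2.1) (fun i => (w i).2.2) := by
  classical
  obtain ⟨d, h'⟩ := h.or (PS.all fun x : A × S × S => x.2.1 = x.2.2)
  set q := Nat.card S with hq
  refine ⟨d + (q + 3), fun b r hr => ?_⟩
  obtain ⟨P, hP⟩ := h' (b + 8) (b + 6) (by omega)
  refine ⟨.seq (scan (b + 0) fun x : A × S × S =>
      .seq (.push (b + 2) (cd x)) (pushZeros (b + 4) q)) <|
    .seq (.push (b + 1) (sep A S)) <|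
    .seq (move₂ (A × S × S) (b + 2) (b + 0) (b + 1) cd
      fun x => cd ((x.1, x.2.1, first S, x.2.2) : FLetter A S)) <|
    .seq (.push (b + 6) 2) <| .seq (search A S b r P) (popAll (b + 4)),
    fun N w s M c hM hs hc => ?_⟩
  have hd : (N + 2) ^ d ≤ M := (Nat.pow_le_pow_right (by omega) (by omega)).trans hM
  have hqM : (q * N + 1) * (N + 1) ≤ M := by
    refine le_trans ?_ ((Nat.pow_le_pow_right (by omega) (by omega : q + 1 + 1 + 1 ≤ _)).trans hM)
    rw [pow_succ]
    refine Nat.mul_le_mul (le_trans ?_ (le_pow_of_linear (q + 1) N)) (by omega)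
    rw [add_mul]; omega
  have hN1 : q * N + 1 ≤ M := le_trans (Nat.le_mul_of_pos_right _ (by omega)) hqM
  have hN2 : N + 1 ≤ M := le_trans (Nat.le_mul_of_pos_left _ (by omega)) hqM
  set a : Fin N → A := fun i => (w i).1
  set u : Fin N → S := fun i => (w i).2.1
  set v : Fin N → S := fun i => (w i).2.2
  let Q : (Fin N → S) → (Fin N → S) → Prop := fun x y =>
    L N (fun i => (a i, x i, y i)) ∨ ∀ i, x i = y i
  have hQ : ∀ x, Q x x := fun x => .inr fun _ => rfl
  have hcard : Nat.card (Fin N → S) ≤ 2 ^ (q * N) := by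
    rw [Nat.card_fun, Nat.card_fin, pow_mul]
    exact Nat.pow_le_pow_left Nat.lt_two_pow_self.le N
  have hbit : c = decide (Halving Q (q * N) u v) := by
    have e : Relation.ReflTransGen Q u v ↔ Relation.ReflTransGen
        (fun x y : Fin N → S => L N fun i => (a i, x i, y i)) u v := by
      have : Q = Relation.ReflGen (fun x y : Fin N → S => L N fun i => (a i, x i, y i)) := by
        funext x y
        rw [Relation.reflGen_iff, eq_comm, or_comm, funext_iff]
        simp only [Q, eq_comm]
      rw [this, Relation.reflTransGen_reflGen]
    rw [Bool.eq_iff_iff, decide_eq_true_iff, halving_iff_reflTransGen hQ hcard, e]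
    exact hc
  have hrun := search_halving (M := M) (s := s) (b := b) (r := r) (W := stack w) (a := a) (P := P)
    (Q := Q) (fun x y s' c' hs' hc' => hP N _ s' M c' hd hs' hc') (q * N) u v [] []
    (by rw [List.length_nil]; omega) (by omega) (by rw [List.length_nil]; omega)
  rw [← hbit] at hrun
  set s' := update s r (c.toNat :: s r) with hs'
  have hlast : SearchStep A S M b r P
      (searchStore s b (stack w) [] (List.replicate (q * N) 0) [] [c.toNat])
      (searchStore s' b (stack w) [] (List.replicate (q * N) 0) [] []) := by
    refine ⟨by rw [searchStore_six]; rfl, ?_⟩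
    have e := update_frame_below s hr
      [stack w, [], [], [], List.replicate (q * N) 0, [], [c.toNat], [], []] (c.toNat :: s r)
    rw [← hs'] at e
    refine runs_iteF (i := 6) (by cases c <;> rfl) <| runs_iteF (i := 5) rfl <|
      .seq (t := searchStore s' b (stack w) [] (List.replicate (q * N) 0) [] [c.toNat]) ?_
      (runs_pop 6 (by simp))
    unfold searchStore
    rw [← e, ← frame_below s hr
      [stack w, [], [], [], List.replicate (q * N) 0, [], [c.toNat], [], []]]
    cases c
    · exact runs_iteF (i := 6) rfl (.push _ (by rwa [frame_below _ hr]))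
    · exact runs_iteT (i := 6) rfl (.push _ (by rwa [frame_below _ hr]))
  have ez : frame s b [stack w] = frame s b [stack w, [], [], [], [], [], [], [], []] :=
    (frame_nils s b 8 [stack w]).symm
  have ez' : frame s' b [stack w, [], [], [], [], [], [], [], []] = frame s' b [stack w] :=
    frame_nils s' b 8 [stack w]
  have e₁ : (List.ofFn w).map (fun x => cd ((x.1, x.2.1, first S, x.2.2) : FLetter A S)) =
      stack (frameOf a u (fun _ => first S) v) := by
    simp only [stack, List.map_ofFn]; rfl
  rw [ez, ← ez']
  refine .seq (t := frame s b [[], [], (stack w).reverse, [], List.replicate (q * N) 0, [], [], [],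
      []]) ?_ <|
    .seq (runs_push 1 _ (by simp) (by change 0 < M; omega)) <|
    .seq (t := frame s b [stack w, withFrame (frameOf a u (fun _ => first S) v) [], [], [],
      List.replicate (q * N) 0, [], [], [], []]) ?_ <|
    .seq (runs_push 6 2 (by simp) (by change 0 < M; omega)) <|
    .seq (runs_search (hrun.tail hlast) searchStore_six) (runs_popAll 4 (by simp))
  · have := runs_loadDepth (M := M) (s := s) (b := b) q (List.ofFn w) [] 0 (by simp; omega)
      (by simp; omega)
    simpa using this
  · have := runs_move₂ (M := M) (r := s) (b := b) (l := [[], [sep A S], (stack w).reverse, [],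
      List.replicate (q * N) 0, [], [], [], []]) (k := 2) (j := 0) (j' := 1) (by decide)
      (by decide) (by decide) (by simp) (by simp) (by simp) (cd : A × S × S → ℕ)
      (fun x => cd ((x.1, x.2.1, first S, x.2.2) : FLetter A S)) (List.ofFn w).reverse
      (rest := []) (by simp) stops_nil (by simp; omega) (by simp; omega)
    simp only [List.set_cons_succ, List.set_cons_zero, List.getD_cons_succ, List.getD_cons_zero,
      List.map_reverse, List.reverse_reverse, List.append_nil, e₁] at this
    exact this

/-- The existence of a word: it is a chain of two steps, from a start to the word and from the
word to an end. -/
protected theorem ex {L : ∀ N, (Fin N → A × S) → Prop} (h : PS L) :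
    PS fun N (w : Fin N → A) => ∃ u : Fin N → S, L N fun i => (w i, u i) := by
  classical
  -- Words over `Option (Option S)`: the start is `none` everywhere, the end is `some none`.
  let T := Option (Option S)
  let f : T → S := fun x => (x.getD none).getD (Classical.arbitrary S)
  have h0 : PS (A := A × T × T) fun N w => (∀ i, (w i).2.1 = none) ∧
      ∀ i, ∃ x, (w i).2.2 = some (some x) :=
    (PS.all fun x : A × T × T => x.2.1 = none).and
      (PS.all fun x : A × T × T => ∃ y, x.2.2 = some (some y))
  have h1 : PS (A := A × T × T) fun N w => ((∀ i, ∃ x, (w i).2.1 = some (some x)) ∧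
      ∀ i, (w i).2.2 = some none) ∧ L N fun i => ((w i).1, f (w i).2.1) :=
    ((PS.all fun x : A × T × T => ∃ y, x.2.1 = some (some y)).and
      (PS.all fun x : A × T × T => x.2.2 = some none)).and
      (h.comap fun x : A × T × T => (x.1, f x.2.1))
  refine (((h0.or h1).reflTransGen.comap fun x : A => (x, (none, some none))).and
    (PS.any fun _ : A => True)).or
    (((PS.any fun _ : A => True).not).and
      (h.comap fun x : A => (x, Classical.arbitrary S))) |>.congr fun N w => ?_
  rcases isEmpty_or_nonempty (Fin N) with hN | hN
  · have : ∀ u u' : Fin N → S, u = u' := fun u u' => Subsingleton.elim _ _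
    simp only [IsEmpty.exists_iff, and_false, not_false_eq_true, true_and, false_or]
    constructor
    · exact fun h => ⟨_, h⟩
    · rintro ⟨u, hu⟩
      rw [this u fun _ => Classical.arbitrary S] at hu
      exact hu
  · simp only [exists_const, and_true, not_true_eq_false, false_and, or_false, Function.comp_def]
    obtain ⟨i₀⟩ := hN
    constructor
    · intro hc
      rcases hc.cases_head with e | ⟨x, hx, hc⟩
      · simpa using congrFun e i₀
      · rcases hx with ⟨-, hx⟩ | ⟨⟨hx, -⟩, -⟩
        · rcases hc.cases_head with e | ⟨y, hy, -⟩
          · obtain ⟨z, hz⟩ := hx i₀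
            rw [e] at hz
            exact absurd (Option.some.inj hz) (by simp)
          · rcases hy with ⟨hy, -⟩ | ⟨-, hL⟩
            · obtain ⟨z, hz⟩ := hx i₀
              simp [hy i₀] at hz
            · exact ⟨_, hL⟩
        · obtain ⟨z, hz⟩ := hx i₀
          simp at hz
    · rintro ⟨u, hu⟩
      refine .head (b := fun i => some (some (u i))) (.inl ⟨fun _ => rfl, fun i => ⟨_, rfl⟩⟩)
        (.single (.inr ⟨⟨fun i => ⟨_, rfl⟩, fun _ => rfl⟩, ?_⟩))
      exact hu

end PS

end StackProg

namespace StackProg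

open Function

/-! ### Shifts of words -/

/-- The word moved `k` places to the right; what leaves the word is lost. -/
def shiftBy {N : ℕ} (k : ℕ) (x : Fin N → Bool) : Fin N → Bool :=
  fun i => if h : k ≤ i then x ⟨i - k, by omega⟩ else false

theorem shiftBy_eq_true {N k : ℕ} {x : Fin N → Bool} {i : Fin N} :
    shiftBy k x i = true ↔ ∃ j : Fin N, x j = true ∧ (i : ℕ) = j + k := by
  unfold shiftBy
  split_ifs with h
  · constructor
    · exact fun hx => ⟨_, hx, by simp; omega⟩
    · rintro ⟨j, hj, e⟩
      rwa [show (⟨i - k, by omega⟩ : Fin N) = j from Fin.ext (by simp; omega)]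
  · simp only [false_iff]
    rintro ⟨j, -, e⟩
    omega

theorem shiftBy_zero {N : ℕ} (x : Fin N → Bool) : shiftBy 0 x = x := by
  funext i; simp [shiftBy]

theorem shiftBy_shiftBy {N : ℕ} (k l : ℕ) (x : Fin N → Bool) :
    shiftBy l (shiftBy k x) = shiftBy (k + l) x := by
  funext i
  rw [Bool.eq_iff_iff, shiftBy_eq_true, shiftBy_eq_true]
  constructor
  · rintro ⟨j, hj, e⟩
    obtain ⟨j', hj', e'⟩ := shiftBy_eq_true.1 hj
    exact ⟨j', hj', by omega⟩
  · rintro ⟨j, hj, e⟩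
    exact ⟨⟨j + k, by omega⟩, shiftBy_eq_true.2 ⟨j, hj, rfl⟩, by simp; omega⟩

namespace PS

variable {A S : Type} [Finite A] [Finite S]

/-- The automaton for a shift by one place remembers the preceding letter. -/
theorem wsum_shift {N : ℕ} (q : Bool) (w : Fin N → Bool × Bool) :
    wsum (fun _ a => a.1) (fun q (a : Bool × Bool) => if a.2 = q then 0 else -1) q
      (List.ofFn w) ≤ 0 ∧
    (0 ≤ wsum (fun _ a => a.1) (fun q (a : Bool × Bool) => if a.2 = q then 0 else -1) q
        (List.ofFn w) ↔
      ∀ i : Fin N, (w i).2 =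
        (Fin.cons q (fun i => (w i).1) : Fin (N + 1) → Bool) i.castSucc) := by
  induction N generalizing q with
  | zero => simp [wsum]
  | succ N ih =>
    obtain ⟨h1, h2⟩ := ih (w 0).1 (fun i => w i.succ)
    rw [List.ofFn_succ, wsum, Fin.forall_fin_succ]
    have e : ∀ i : Fin N, (Fin.cons q (fun i => (w i).1) : Fin (N + 2) → Bool) i.succ.castSucc =
        (Fin.cons (w 0).1 (fun i => (w i.succ).1) : Fin (N + 1) → Bool) i.castSucc := by
      intro i
      rw [← Fin.succ_castSucc, Fin.cons_succ]
      refine Fin.cases ?_ (fun j => ?_) i.castSucc <;> simp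
    simp only [e, Fin.castSucc_zero, Fin.cons_zero, ← h2]
    split_ifs with h
    · simp [h, h1]
    · simp only [h, false_and, iff_false]
      omega

theorem shift_one : PS fun _ (w : Fin _ → Bool × Bool) =>
    (fun i => (w i).2) = shiftBy 1 fun i => (w i).1 := by
  refine (PS.automaton (fun _ a => a.1) (fun q (a : Bool × Bool) => if a.2 = q then 0 else -1)
    false 0).congr fun N w => ?_
  rw [zero_add, (wsum_shift false w).2, funext_iff]
  refine forall_congr' fun i => ?_
  have : (Fin.cons false (fun i => (w i).1) : Fin (N + 1) → Bool) i.castSucc =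
      shiftBy 1 (fun i => (w i).1) i := by
    obtain ⟨i, hi⟩ := i
    cases i with
    | zero => simp [shiftBy]
    | succ i =>
      have : (⟨i + 1, hi⟩ : Fin N).castSucc = (⟨i, by omega⟩ : Fin N).succ := rfl
      rw [this, Fin.cons_succ]
      simp [shiftBy]
  rw [this]

/-- Simultaneous shifts of two words by an arbitrary number of places. -/
theorem shift : PS fun _ (w : Fin _ → (Bool × Bool) × (Bool × Bool)) =>
    ∃ k, (fun i => (w i).2.1) = shiftBy k (fun i => (w i).1.1) ∧
      (fun i => (w i).2.2) = shiftBy k fun i => (w i).1.2 := by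
  have h : PS fun N (w : Fin N → Unit × (Bool × Bool) × (Bool × Bool)) =>
      (fun i => (w i).2.2.1) = shiftBy 1 (fun i => (w i).2.1.1) ∧
      (fun i => (w i).2.2.2) = shiftBy 1 fun i => (w i).2.1.2 :=
    (shift_one.comap fun x : Unit × (Bool × Bool) × (Bool × Bool) => (x.2.1.1, x.2.2.1)).and
      (shift_one.comap fun x : Unit × (Bool × Bool) × (Bool × Bool) => (x.2.1.2, x.2.2.2))
  refine (h.reflTransGen.comap fun x => ((), x)).congr fun N w => ?_
  constructor
  · intro hc
    have : ∀ v : Fin N → Bool × Bool, Relation.ReflTransGen (fun u v : Fin N → Bool × Bool =>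
        (fun i => (v i).1) = shiftBy 1 (fun i => (u i).1) ∧
        (fun i => (v i).2) = shiftBy 1 fun i => (u i).2) (fun i => (w i).1) v →
        ∃ k, (fun i => (v i).1) = shiftBy k (fun i => (w i).1.1) ∧
          (fun i => (v i).2) = shiftBy k fun i => (w i).1.2 := by
      intro v hv
      induction hv with
      | refl => exact ⟨0, (shiftBy_zero _).symm, (shiftBy_zero _).symm⟩
      | tail _ hs ih =>
        obtain ⟨k, h1, h2⟩ := ih
        refine ⟨k + 1, ?_, ?_⟩
        · rw [hs.1, h1, shiftBy_shiftBy]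
        · rw [hs.2, h2, shiftBy_shiftBy]
    exact this _ hc
  · rintro ⟨k, h1, h2⟩
    have : ∀ (k : ℕ) (v : Fin N → Bool × Bool),
        (fun i => (v i).1) = shiftBy k (fun i => (w i).1.1) →
        (fun i => (v i).2) = shiftBy k (fun i => (w i).1.2) →
        Relation.ReflTransGen (fun u v : Fin N → Bool × Bool =>
        (fun i => (v i).1) = shiftBy 1 (fun i => (u i).1) ∧
        (fun i => (v i).2) = shiftBy 1 fun i => (u i).2) (fun i => (w i).1) v := by
      intro k
      induction k with
      | zero =>
        intro v h1 h2
        have : v = fun i => (w i).1 := by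
          funext i
          rw [shiftBy_zero] at h1 h2
          exact Prod.ext (congrFun h1 i) (congrFun h2 i)
        rw [this]
      | succ k ih =>
        intro v h1 h2
        refine (ih (fun i => (shiftBy k (fun i => (w i).1.1) i, shiftBy k (fun i => (w i).1.2) i))
          rfl rfl).tail ⟨?_, ?_⟩
        · rw [h1, ← shiftBy_shiftBy]
        · rw [h2, ← shiftBy_shiftBy]
    exact this k _ h1 h2

/-- A shift of the second word to the third, by a period of the first word. -/
theorem period : PS fun _ (w : Fin _ → Bool × Bool × Bool) =>
    ∃ k, (∀ i : Fin _, shiftBy k (fun i => (w i).1) i = ((w i).1 && decide (0 < (i : ℕ)))) ∧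
      (fun i => (w i).2.2) = shiftBy k fun i => (w i).2.1 := by
  -- The auxiliary word marks all places except the first one.
  have h : PS fun N (w : Fin N → (Bool × Bool × Bool) × Bool) =>
      ((fun i => (w i).2) = shiftBy 1 fun _ => true) ∧
      ∃ k, (fun i => (w i).1.1 && (w i).2) = shiftBy k (fun i => (w i).1.1) ∧
        (fun i => (w i).1.2.2) = shiftBy k fun i => (w i).1.2.1 :=
    (shift_one.comap fun x : (Bool × Bool × Bool) × Bool => (true, x.2)).and
      (shift.comap fun x : (Bool × Bool × Bool) × Bool =>
        ((x.1.1, x.1.2.1), (x.1.1 && x.2, x.1.2.2)))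
  refine h.ex.congr fun N w => ?_
  have e : shiftBy 1 (fun _ : Fin N => true) = fun i : Fin N => decide (0 < (i : ℕ)) := by
    funext i
    by_cases h : 0 < (i : ℕ) <;> simp [shiftBy, h, Nat.one_le_iff_ne_zero] <;> omega
  constructor
  · rintro ⟨u, hu, k, h1, h2⟩
    rw [e] at hu
    refine ⟨k, fun i => ?_, h2⟩
    have hu' : u = fun i : Fin N => decide (0 < (i : ℕ)) := hu
    rw [hu'] at h1
    exact (congrFun h1 i).symm
  · rintro ⟨k, h1, h2⟩
    refine ⟨fun i : Fin N => decide (0 < (i : ℕ)), e.symm, k, ?_, h2⟩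
    funext i
    exact (h1 i).symm

end PS

/-! ### The shape of the words for positions -/

/-- The length of the words for positions on a board of size `n`, see `Chess.Position.encode`. The
places divisible by `n + 1` hold the player to move and the ends of the ranks. -/
def len (n : ℕ) : ℕ := n * (n + 1) + 1

namespace PS

/-- The words whose first and last letters are marked. -/
theorem first_and_last : PS fun N (d : Fin N → Bool) =>
    (∀ i : Fin N, (i : ℕ) = 0 → d i = true) ∧ ∀ i : Fin N, (i : ℕ) + 1 = N → d i = true := by
  have h1 : PS fun N (w : Fin N → Bool × Bool) =>
      ((fun i => (w i).2) = shiftBy 1 fun _ => true) ∧ ∀ i, (w i).2 = false → (w i).1 = true :=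
    (shift_one.comap fun x : Bool × Bool => (true, x.2)).and
      (PS.all fun x : Bool × Bool => x.2 = false → x.1 = true)
  -- The words `f` that mark all places except possibly the last one.
  have h2 : PS fun N (w : Fin N → (Bool × Bool) × Bool) =>
      (((fun i => (w i).2) = shiftBy 1 fun _ => true) ∧
        (fun i => (w i).2) = shiftBy 1 fun i => (w i).1.2) ∧
      ¬ ∀ i, (w i).1.2 = true ∨ (w i).1.1 = true :=
    ((shift_one.comap fun x : (Bool × Bool) × Bool => (true, x.2)).and
      (shift_one.comap fun x : (Bool × Bool) × Bool => (x.1.2, x.2))).and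
      (PS.all fun x : (Bool × Bool) × Bool => x.1.2 = true ∨ x.1.1 = true).not
  refine (h1.ex.and h2.ex.ex.not).congr fun N d => ?_
  have e : ∀ i, shiftBy 1 (fun _ : Fin N => true) i = decide (0 < (i : ℕ)) := by
    intro i
    by_cases h : 0 < (i : ℕ) <;> simp [shiftBy, h, Nat.one_le_iff_ne_zero] <;> omega
  refine and_congr ⟨?_, fun h => ?_⟩ ⟨fun h i hi => ?_, ?_⟩
  · rintro ⟨u, hu, h⟩ i hi
    have hu' : u = shiftBy 1 fun _ => true := hu
    refine h i ?_
    change u i = false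
    rw [hu', e, hi]; simp
  · refine ⟨shiftBy 1 fun _ => true, rfl, fun i hi => h i ?_⟩
    change shiftBy 1 (fun _ => true) i = false at hi
    rw [e] at hi
    simpa using hi
  · by_contra hd
    refine h ⟨fun i => decide ((i : ℕ) + 1 < N), shiftBy 1 fun _ => true, ⟨rfl, ?_⟩,
      fun hall => ?_⟩
    · funext i
      change shiftBy 1 (fun _ => true) i = shiftBy 1 (fun i : Fin N => decide ((i : ℕ) + 1 < N)) i
      rw [Bool.eq_iff_iff, shiftBy_eq_true, shiftBy_eq_true]
      refine exists_congr fun j => and_congr_left fun hj => ?_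
      simp only [true_iff, decide_eq_true_eq]
      omega
    · rcases hall i with h | h
      · simp only [decide_eq_true_eq] at h
        omega
      · exact hd h
  · rintro h ⟨f, u, ⟨hu, hf⟩, hne⟩
    have hu' : u = shiftBy 1 fun _ => true := hu
    have hf' : u = shiftBy 1 f := hf
    refine hne fun i => ?_
    by_cases hi : (i : ℕ) + 1 = N
    · exact .inr (h i hi)
    · left
      have h1 : u ⟨i + 1, by omega⟩ = true := by rw [hu', e]; simp
      rw [hf'] at h1
      obtain ⟨j, hj, hj'⟩ := shiftBy_eq_true.1 h1
      have : j = i := Fin.ext (by simp at hj'; omega)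
      rwa [this] at hj

theorem card_multiples {r k : ℕ} (hk : 0 < k) :
    (Finset.univ.filter fun i : Fin (r * k + 1) => (i : ℕ) % k = 0).card = r + 1 := by
  let f : Fin (r + 1) → Fin (r * k + 1) := fun j => ⟨j * k, by
    have := Nat.mul_le_mul_right k (Nat.le_of_lt_succ j.2); omega⟩
  have hf : Injective f := fun a b h => by
    have : (a : ℕ) * k = b * k := congrArg Fin.val h
    exact Fin.ext (Nat.eq_of_mul_eq_mul_right hk this)
  have : (Finset.univ.filter fun i : Fin (r * k + 1) => (i : ℕ) % k = 0) =
      Finset.univ.image f := by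
    ext i
    simp only [Finset.mem_filter, Finset.mem_univ, true_and, Finset.mem_image]
    constructor
    · intro hi
      refine ⟨⟨i / k, ?_⟩, Fin.ext (Nat.div_mul_cancel (Nat.dvd_of_mod_eq_zero hi))⟩
      have : (i : ℕ) ≤ r * k := Nat.le_of_lt_succ i.2
      exact Nat.lt_succ_of_le (Nat.div_le_of_le_mul (this.trans (Nat.mul_comm r k).le))
    · rintro ⟨j, rfl⟩
      exact Nat.mul_mod_left _ _
  rw [this, Finset.card_image_of_injective _ hf, Finset.card_univ, Fintype.card_fin]

theorem card_le {N k : ℕ} (h : k ≤ N) :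
    (Finset.univ.filter fun i : Fin N => ¬ k ≤ (i : ℕ)).card = k := by
  simp only [not_le, Fin.card_filter_val_lt]
  omega

/-- The marks at the multiples of `n + 1` determine this distance: moved by `k` places, they are all
the marks except the first one if and only if `k = n + 1`. -/
theorem period_iff {n k : ℕ} (hn : 0 < n) {d : Fin (len n) → Bool}
    (hd : ∀ i : Fin (len n), d i = true ↔ (i : ℕ) % (n + 1) = 0) :
    (∀ i, shiftBy k d i = (d i && decide (0 < (i : ℕ)))) ↔ k = n + 1 := by
  have hlen : n + 1 < len n := by unfold len; nlinarith
  constructor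
  · intro h
    have h1 := h ⟨n + 1, hlen⟩
    rw [(hd ⟨n + 1, hlen⟩).2 (Nat.mod_self _)] at h1
    obtain ⟨j, hj, e⟩ := shiftBy_eq_true.1 (h1.trans (by simp))
    rw [hd] at hj
    obtain ⟨r, hr⟩ := Nat.dvd_of_mod_eq_zero hj
    rcases Nat.eq_zero_or_pos k with rfl | hk
    · have h0 := h ⟨0, by omega⟩
      rw [shiftBy_zero, (hd ⟨0, by omega⟩).2 rfl] at h0
      simp at h0
    · rcases r with _ | r
      · simp only at e
        omega
      · have : n + 1 ≤ (n + 1) * (r + 1) := Nat.le_mul_of_pos_right _ r.succ_pos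
        simp only at e
        omega
  · rintro rfl i
    rw [Bool.eq_iff_iff, shiftBy_eq_true, Bool.and_eq_true, hd, decide_eq_true_eq]
    constructor
    · rintro ⟨j, hj, e⟩
      rw [hd] at hj
      rw [e, Nat.add_mod_right]
      exact ⟨hj, by omega⟩
    · rintro ⟨h, hpos⟩
      have hle : n + 1 ≤ (i : ℕ) := Nat.le_of_dvd hpos (Nat.dvd_of_mod_eq_zero h)
      refine ⟨⟨i - (n + 1), by omega⟩, (hd _).2 ?_, by simp; omega⟩
      rw [Nat.mod_eq_sub_mod hle] at h
      exact h

/-- The words that mark exactly the places divisible by `n + 1` and have length `len n`, for some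
`n > 0`. The marks are periodic, and the number of marks equals the period. -/
theorem shape : PS fun N (d : Fin N → Bool) =>
    ∃ n > 0, N = len n ∧ ∀ i : Fin N, d i = true ↔ (i : ℕ) % (n + 1) = 0 := by
  have h : PS fun N (w : Fin N → Bool × Bool) =>
      (∃ k, (∀ i, shiftBy k (fun i => (w i).1) i = ((w i).1 && decide (0 < (i : ℕ)))) ∧
        (fun i => (w i).2) = shiftBy k fun _ => true) ∧
      (0 ≤ 0 + ∑ i, ((if (w i).2 = true then 0 else 1) - if (w i).1 = true then 1 else 0 : ℤ)) ∧
      (0 ≤ 0 + ∑ i, ((if (w i).1 = true then 1 else 0) - if (w i).2 = true then 0 else 1 : ℤ)) :=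
    (period.comap fun x : Bool × Bool => (x.1, true, x.2)).and
      ((PS.sum (fun x : Bool × Bool =>
        (if x.2 = true then 0 else 1) - if x.1 = true then 1 else 0) 0).and
      (PS.sum (fun x : Bool × Bool =>
        (if x.1 = true then 1 else 0) - if x.2 = true then 0 else 1) 0))
  refine ((first_and_last.and (PS.any fun x : Bool => x = false)).and h.ex).congr fun N d => ?_
  have hsum : ∀ k, (∑ i : Fin N, (if shiftBy k (fun _ => true) i = true then 0 else 1 : ℤ)) =
      (Finset.univ.filter fun i : Fin N => ¬ k ≤ (i : ℕ)).card := fun k => by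
    rw [← Finset.sum_boole]
    refine Finset.sum_congr rfl fun i _ => ?_
    by_cases hk : k ≤ (i : ℕ) <;> simp [shiftBy, hk]
  simp only [Finset.sum_sub_distrib, zero_add, sub_nonneg, ← le_antisymm_iff]
  constructor
  · rintro ⟨⟨⟨h0, hl⟩, ⟨i₁, hi₁⟩⟩, u, ⟨k, hk, hu⟩, hc⟩
    have hN : 0 < N := i₁.pos
    have hk0 : 0 < k := by
      rcases Nat.eq_zero_or_pos k with rfl | h
      · have := hk ⟨0, hN⟩
        rw [shiftBy_zero, h0 ⟨0, hN⟩ rfl] at this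
        simp at this
      · exact h
    have hd : ∀ (j : ℕ) (hj : j < N), d ⟨j, hj⟩ = true ↔ j % k = 0 := by
      intro j
      induction j using Nat.strong_induction_on with
      | _ j ih =>
        intro hj
        rcases Nat.eq_zero_or_pos j with rfl | hpos
        · simpa using h0 ⟨0, hN⟩ rfl
        · have e := hk ⟨j, hj⟩
          simp only [hpos, decide_true, Bool.and_true] at e
          rw [← e]
          by_cases hkj : k ≤ j
          · rw [Nat.mod_eq_sub_mod hkj, ← ih (j - k) (by omega) (by omega)]
            simp [shiftBy, hkj]
          · rw [Nat.mod_eq_of_lt (by omega)]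
            simp only [shiftBy, hkj, dif_neg, not_false_eq_true, Bool.false_eq_true, false_iff]
            omega
    have hlast : (N - 1) % k = 0 := (hd (N - 1) (by omega)).1 (hl _ (by simp; omega))
    obtain ⟨r, hr⟩ := Nat.dvd_of_mod_eq_zero hlast
    obtain rfl : N = r * k + 1 := by rw [mul_comm] at hr; omega
    have hkN : k ≤ r * k + 1 := by
      rcases Nat.eq_zero_or_pos r with rfl | h
      · have := h0 i₁ (by omega)
        rw [hi₁] at this
        simp at this
      · have := Nat.mul_le_mul_right k h
        omega
    have c1 : (∑ i, (if u i = true then 0 else 1 : ℤ)) = k := by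
      have hu' : u = shiftBy k fun _ => true := hu
      rw [hu', hsum, card_le hkN]
    have c2 : (∑ i, (if d i = true then 1 else 0 : ℤ)) = (r + 1 : ℕ) := by
      rw [Finset.sum_boole, ← card_multiples (r := r) hk0]
      congr 2
      ext i
      simp [hd i i.2]
    rw [c1, c2] at hc
    obtain rfl : k = r + 1 := by omega
    refine ⟨r, ?_, by rw [len], fun i => hd i i.2⟩
    rcases Nat.eq_zero_or_pos r with rfl | h
    · have := h0 i₁ (by omega)
      rw [hi₁] at this
      simp at this
    · exact h
  · rintro ⟨n, hn, rfl, hd⟩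
    have h1 : n + 1 ≤ len n := by unfold len; nlinarith
    refine ⟨⟨⟨fun i hi => (hd i).2 (by rw [hi]; simp), fun i hi => (hd i).2 ?_⟩,
      ⟨⟨1, by omega⟩, ?_⟩⟩, _, ⟨n + 1, (period_iff hn hd).2 rfl, rfl⟩, ?_⟩
    · have : (i : ℕ) = n * (n + 1) := by unfold len at hi; omega
      rw [this]; simp
    · rw [← Bool.not_eq_true, hd, Nat.mod_eq_of_lt (by omega : 1 < n + 1)]
      simp
    · rw [hsum, card_le h1, Finset.sum_boole]
      have c : (Finset.univ.filter fun i : Fin (len n) => (i : ℕ) % (n + 1) = 0).card = n + 1 :=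
        card_multiples n.succ_pos
      rw [Finset.filter_congr fun i _ => hd i, c]

end PS

end StackProg

namespace StackProg

open Chess Function

/-! ### Definable predicates on boards -/

theorem index_lt {n : ℕ} (z : Square n) : (z.1 : ℕ) * (n + 1) + z.2 + 1 < len n := by
  have h1 : ((z.1 : ℕ) + 1) * (n + 1) ≤ n * (n + 1) := Nat.mul_le_mul_right _ z.1.2
  have h2 := z.2.2
  unfold len
  rw [Nat.succ_mul] at h1
  omega

/-- The place of a square in the words for positions. -/
def index {n : ℕ} (z : Square n) : Fin (len n) := ⟨z.1 * (n + 1) + z.2 + 1, index_lt z⟩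

theorem index_mod {n : ℕ} (z : Square n) : (index z : ℕ) % (n + 1) = z.2 + 1 := by
  have := z.2.2
  unfold index
  rw [Fin.val_mk, add_assoc, Nat.mul_add_mod_self_right, Nat.mod_eq_of_lt (by omega)]

theorem index_div {n : ℕ} (z : Square n) : (index z : ℕ) / (n + 1) = z.1 := by
  have := z.2.2
  unfold index
  rw [Fin.val_mk, add_assoc, mul_comm, Nat.mul_add_div n.succ_pos, Nat.div_eq_of_lt (by omega),
    add_zero]

theorem index_injective {n : ℕ} : Injective (index (n := n)) := fun x y h => by
  have h1 := index_div x
  have h2 := index_mod x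
  rw [h] at h1 h2
  rw [index_div] at h1
  rw [index_mod] at h2
  exact Prod.ext (Fin.ext h1.symm) (Fin.ext (by omega))

theorem exists_index {n : ℕ} {i : Fin (len n)} (h : (i : ℕ) % (n + 1) ≠ 0) :
    ∃ z, index z = i := by
  have h1 : (i : ℕ) % (n + 1) < n + 1 := Nat.mod_lt _ n.succ_pos
  have h2 := Nat.div_add_mod (i : ℕ) (n + 1)
  have h3 : (i : ℕ) / (n + 1) < n := by
    have := i.2
    unfold len at this
    rcases Nat.lt_or_ge (i : ℕ) (n * (n + 1)) with h' | h'
    · exact Nat.div_lt_of_lt_mul (h'.trans_eq (mul_comm _ _))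
    · have : (i : ℕ) = n * (n + 1) := by omega
      simp [this] at h
  refine ⟨(⟨i / (n + 1), h3⟩, ⟨i % (n + 1) - 1, by omega⟩), Fin.ext ?_⟩
  unfold index
  simp only
  rw [mul_comm]
  omega

open Classical in
/-- The word for an assignment of letters to the squares; `none` stands for the places that do not
belong to squares. -/
noncomputable def word {A : Type} {n : ℕ} (v : Square n → A) (i : Fin (len n)) : Option A :=
  if h : ∃ z, index z = i then some (v h.choose) else none

section Words

variable {A B : Type} {n : ℕ}

@[simp]
theorem word_index (v : Square n → A) (z : Square n) : word v (index z) = some (v z) := by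
  have h : ∃ z', index z' = index z := ⟨z, rfl⟩
  rw [word, dif_pos h, index_injective h.choose_spec]

theorem word_eq_none {v : Square n → A} {i : Fin (len n)} :
    word v i = none ↔ (i : ℕ) % (n + 1) = 0 := by
  unfold word
  split_ifs with h
  · obtain ⟨z, rfl⟩ := h
    rw [index_mod]
    simp
  · simp only [true_iff]
    by_contra h'
    exact h (exists_index h')

theorem eq_word {v : Square n → A} {w : Fin (len n) → Option A} (h1 : ∀ z, w (index z) = some (v z))
    (h2 : ∀ i : Fin (len n), (i : ℕ) % (n + 1) = 0 → w i = none) : w = word v := by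
  funext i
  by_cases h : (i : ℕ) % (n + 1) = 0
  · rw [h2 i h, word_eq_none.2 h]
  · obtain ⟨z, rfl⟩ := exists_index h
    rw [h1, word_index]

theorem map_word (g : A → B) (v : Square n → A) : Option.map g ∘ word v = word (g ∘ v) :=
  eq_word (by simp) fun i h => by simp [word_eq_none.2 h]

theorem word_map (v : Square n → A) (u : Fin (len n) → B) :
    (fun i => (word v i).map fun a => (a, u i)) = word fun z => (v z, u (index z)) :=
  eq_word (by simp) fun i h => by simp [word_eq_none.2 h]

end Words

/-- A property of assignments of letters to the squares of boards of any positive size that can be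
recognized in polynomial space. -/
def Recognizable {A : Type} [Finite A] (R : ∀ n, (Square n → A) → Prop) : Prop :=
  ∃ L : ∀ N, (Fin N → Option A) → Prop,
    PS L ∧ ∀ n, 0 < n → ∀ v : Square n → A, L (len n) (word v) ↔ R n v

/-- A way to represent the objects of a sort by assignments of letters to the squares. The sort may
depend on the size of the board, the alphabet may not. -/
class Coding (X : ℕ → Type) where
  Letter : Type
  finite : Finite Letter
  nonempty : Nonempty Letter
  enc : ∀ {n}, X n → Square n → Letter
  inj : ∀ {n}, 0 < n → Injective (enc (n := n))
  range : Recognizable fun n v => v ∈ Set.range (enc (n := n))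

attribute [instance] Coding.finite Coding.nonempty

open Coding (Letter enc)

/-- A predicate on the objects of a sort that is decidable in polynomial space, given the words for
the objects. The variables on which a formula depends are grouped into a tuple, whose sort is a
product. Instances for the logical operations make the class inference prove that a formula
is definable. -/
class Definable {E : ℕ → Type} [Coding E] (P : ∀ n, E n → Prop) : Prop where
  out : ∃ L : ∀ N, (Fin N → Option (Letter E)) → Prop,
    PS L ∧ ∀ n, 0 < n → ∀ e : E n, L (len n) (word (enc e)) ↔ P n e

/-- A function whose value has, on every square, a letter that depends only on the letter of the
argument on that square. -/
class Letterwise {E Y : ℕ → Type} [Coding E] [Coding Y] (f : ∀ n, E n → Y n) : Prop where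
  out : ∃ g : Letter E → Letter Y, ∀ n (e : E n) z, enc (f n e) z = g (enc e z)

/-- An assignment of letters represents itself. -/
instance gridCoding (A : Type) [Finite A] [Nonempty A] : Coding fun n => Square n → A where
  Letter := A
  finite := inferInstance
  nonempty := inferInstance
  enc v := v
  inj _ := injective_id
  range := ⟨_, PS.all fun _ => True, by simp⟩

section Logic

variable {E Y : ℕ → Type} [Coding E] [Coding Y] {P Q : ∀ n, E n → Prop}

theorem Definable.congr (h : Definable P) (e : ∀ n (x : E n), P n x ↔ Q n x) : Definable Q := by
  obtain ⟨L, h1, h2⟩ := h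
  exact ⟨L, h1, fun n hn x => (h2 n hn x).trans (e n x)⟩

instance Definable.const (p : Prop) : Definable fun n (_ : E n) => p := by
  by_cases hp : p
  · exact ⟨_, PS.all fun _ => True, by simp [hp]⟩
  · exact ⟨_, (PS.all fun _ => True).not, by simp [hp]⟩

instance Definable.not [h : Definable P] : Definable fun n e => ¬ P n e := by
  obtain ⟨L, h1, h2⟩ := h
  exact ⟨_, h1.not, fun n hn x => not_congr (h2 n hn x)⟩

instance Definable.and [h : Definable P] [h' : Definable Q] :
    Definable fun n e => P n e ∧ Q n e := by
  obtain ⟨L, h1, h2⟩ := h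
  obtain ⟨L', h1', h2'⟩ := h'
  exact ⟨_, h1.and h1', fun n hn x => and_congr (h2 n hn x) (h2' n hn x)⟩

instance Definable.or [h : Definable P] [h' : Definable Q] :
    Definable fun n e => P n e ∨ Q n e := by
  obtain ⟨L, h1, h2⟩ := h
  obtain ⟨L', h1', h2'⟩ := h'
  exact ⟨_, h1.or h1', fun n hn x => or_congr (h2 n hn x) (h2' n hn x)⟩

instance Definable.imp [h : Definable P] [h' : Definable Q] :
    Definable fun n e => P n e → Q n e := by
  obtain ⟨L, h1, h2⟩ := h
  obtain ⟨L', h1', h2'⟩ := h'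
  exact ⟨_, h1.imp h1', fun n hn x => imp_congr (h2 n hn x) (h2' n hn x)⟩

/-- Substitution of functions that act square by square. -/
theorem Definable.comp {P : ∀ n, Y n → Prop} (h : Definable P) (f : ∀ n, E n → Y n)
    [hf : Letterwise f] : Definable fun n e => P n (f n e) := by
  obtain ⟨L, h1, h2⟩ := h
  obtain ⟨g, hg⟩ := hf
  refine ⟨_, h1.comap (Option.map g), fun n hn e => ?_⟩
  rw [map_word, ← h2 n hn]
  exact iff_of_eq (congrArg _ (congrArg _ (funext fun z => (hg n e z).symm)))

theorem Definable.forall_square (φ : Letter E → Prop) :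
    Definable fun n (e : E n) => ∀ z, φ (enc e z) := by
  refine ⟨_, PS.all fun o : Option (Letter E) => ∀ a, o = some a → φ a, fun n _ e => ?_⟩
  constructor
  · exact fun h z => h (index z) _ (word_index _ z)
  · intro h i a hi
    have : ¬ (i : ℕ) % (n + 1) = 0 := fun h' => by
      rw [word_eq_none.2 h'] at hi
      simp at hi
    obtain ⟨z, rfl⟩ := exists_index this
    rw [word_index, Option.some_inj] at hi
    exact hi ▸ h z

theorem Definable.exists_square (φ : Letter E → Prop) :
    Definable fun n (e : E n) => ∃ z, φ (enc e z) := by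
  have := Definable.forall_square fun a : Letter E => ¬ φ a
  exact Definable.not.congr (P := fun n (e : E n) => ¬ ∀ z, ¬ φ (enc e z)) fun n e => by
    push Not; rfl

/-- Counting squares. The size of the board is available as well, since `n + 1` places do not belong
to squares. -/
theorem Definable.sum_nonneg (ω : Letter E → ℤ) (a b : ℤ) :
    Definable fun n (e : E n) => 0 ≤ a + b * n + ∑ z, ω (enc e z) := by
  classical
  refine ⟨_, PS.sum (fun o : Option (Letter E) => o.elim b ω) (a - b), fun n _ e => ?_⟩
  have h1 : ∑ i ∈ Finset.univ.filter fun i : Fin (len n) => (i : ℕ) % (n + 1) = 0,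
      (word (enc e) i).elim b ω = (n + 1) * b := by
    rw [Finset.sum_congr rfl fun i hi => by
      rw [word_eq_none.2 (Finset.mem_filter.1 hi).2, Option.elim_none], Finset.sum_const]
    have c : (Finset.univ.filter fun i : Fin (len n) => (i : ℕ) % (n + 1) = 0).card = n + 1 :=
      PS.card_multiples n.succ_pos
    rw [c]
    simp
  have h2 : ∑ i ∈ Finset.univ.filter fun i : Fin (len n) => ¬ (i : ℕ) % (n + 1) = 0,
      (word (enc e) i).elim b ω = ∑ z, ω (enc e z) := by
    have : (Finset.univ.filter fun i : Fin (len n) => ¬ (i : ℕ) % (n + 1) = 0) =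
        Finset.univ.image index := by
      ext i
      simp only [Finset.mem_filter, Finset.mem_univ, true_and, Finset.mem_image]
      refine ⟨exists_index, ?_⟩
      rintro ⟨z, rfl⟩
      rw [index_mod]
      simp
    rw [this, Finset.sum_image index_injective.injOn]
    simp
  rw [← Finset.sum_filter_add_sum_filter_not _ fun i : Fin (len n) => (i : ℕ) % (n + 1) = 0, h1, h2]
  constructor <;> intro h <;> linarith

instance Definable.eq (f g : ∀ n, E n → Y n) [hf : Letterwise f] [hg : Letterwise g] :
    Definable fun n e => f n e = g n e := by
  obtain ⟨f', hf⟩ := hf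
  obtain ⟨g', hg⟩ := hg
  obtain ⟨L, h1, h2⟩ := Definable.forall_square fun a : Letter E => f' a = g' a
  refine ⟨L, h1, fun n hn e => (h2 n hn e).trans ?_⟩
  rw [← (Coding.inj hn).eq_iff, funext_iff]
  exact forall_congr' fun z => by rw [hf, hg]

end Logic

section Products

variable {E X Y : ℕ → Type} [Coding E] [Coding X] [Coding Y]

theorem Recognizable.comap {A B : Type} [Finite A] [Finite B] {R : ∀ n, (Square n → A) → Prop}
    (h : Recognizable R) (g : B → A) : Recognizable fun n v => R n (g ∘ v) := by
  obtain ⟨L, h1, h2⟩ := h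
  exact ⟨_, h1.comap (Option.map g), fun n hn v => by rw [map_word, h2 n hn]⟩

theorem Recognizable.and {A : Type} [Finite A] {R R' : ∀ n, (Square n → A) → Prop}
    (h : Recognizable R) (h' : Recognizable R') : Recognizable fun n v => R n v ∧ R' n v := by
  obtain ⟨L, h1, h2⟩ := h
  obtain ⟨L', h1', h2'⟩ := h'
  exact ⟨_, h1.and h1', fun n hn x => and_congr (h2 n hn x) (h2' n hn x)⟩

/-- The letters of a pair are pairs of letters. -/
instance prodCoding : Coding fun n => X n × Y n where
  Letter := Letter X × Letter Y
  finite := inferInstance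
  nonempty := inferInstance
  enc x z := (enc x.1 z, enc x.2 z)
  inj hn x y h := by
    have h' := fun z => Prod.ext_iff.1 (congrFun h z)
    exact Prod.ext (Coding.inj hn (funext fun z => (h' z).1))
      (Coding.inj hn (funext fun z => (h' z).2))
  range := by
    obtain ⟨L, h1, h2⟩ := ((Coding.range (X := X)).comap Prod.fst).and
      ((Coding.range (X := Y)).comap Prod.snd)
    refine ⟨L, h1, fun n hn v => (h2 n hn v).trans ?_⟩
    constructor
    · rintro ⟨⟨x, hx⟩, y, hy⟩
      exact ⟨(x, y), funext fun z => Prod.ext (congrFun hx z) (congrFun hy z)⟩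
    · rintro ⟨x, rfl⟩
      exact ⟨⟨x.1, rfl⟩, x.2, rfl⟩

/-- The words without restriction on the places that do not belong to squares. -/
theorem PS.ex_word {A S : Type} [Finite A] [Finite S] [Nonempty S]
    {L : ∀ N, (Fin N → Option (A × S)) → Prop} (h : PS L) :
    PS fun N (w : Fin N → Option A) =>
      ∃ u : Fin N → S, L N fun i => (w i).map fun a => (a, u i) :=
  (h.comap fun x : Option A × S => x.1.map fun a => (a, x.2)).ex

/-- Extension of an assignment of letters to all places of the words. -/
theorem exists_extension {S : Type} [Nonempty S] {n : ℕ} (v : Square n → S) :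
    ∃ u : Fin (len n) → S, ∀ z, u (index z) = v z :=
  ⟨fun i => (word v i).getD (Classical.arbitrary S), fun z => by simp⟩

/-- An existential quantifier ranges over all words; those that do not represent an object are
excluded by `Coding.range`. -/
instance Definable.ex {P : ∀ n, E n → Y n → Prop}
    [h : Definable fun n (e : E n × Y n) => P n e.1 e.2] :
    Definable fun n e => ∃ y, P n e y := by
  obtain ⟨L, h1, h2⟩ := h
  obtain ⟨L', h1', h2'⟩ := (Coding.range (X := Y)).comap fun x : Letter E × Letter Y => x.2
  refine ⟨_, (h1.and h1').ex_word, fun n hn e => ?_⟩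
  simp only [word_map]
  constructor
  · rintro ⟨u, hL, hL'⟩
    obtain ⟨y, hy⟩ := (h2' n hn _).1 hL'
    have : (fun z => (enc e z, u (index z))) = enc (X := fun n => E n × Y n) (e, y) :=
      funext fun z => Prod.ext rfl (congrFun hy z).symm
    rw [this] at hL
    exact ⟨y, (h2 n hn _).1 hL⟩
  · rintro ⟨y, hy⟩
    obtain ⟨u, hu⟩ := exists_extension (enc y)
    have : (fun z => (enc e z, u (index z))) = enc (X := fun n => E n × Y n) (e, y) :=
      funext fun z => Prod.ext rfl (hu z)
    refine ⟨u, ?_, (h2' n hn _).2 ⟨y, ?_⟩⟩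
    · rw [this]
      exact (h2 n hn _).2 hy
    · exact funext fun z => (hu z).symm

instance Definable.all {P : ∀ n, E n → Y n → Prop}
    [h : Definable fun n (e : E n × Y n) => P n e.1 e.2] :
    Definable fun n e => ∀ y, P n e y :=
  Definable.not.congr (P := fun n (e : E n) => ¬ ∃ y, ¬ P n e y) fun n e => by
    push Not; rfl

instance Definable.existsUnique {P : ∀ n, E n → Y n → Prop} [h : Definable fun n (e : E n) =>
    ∃ y, P n e y ∧ ∀ y', P n e y' → y' = y] : Definable fun n e => ∃! y, P n e y := h

/-- The transitive closure of a definable relation, with parameters. -/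
theorem Definable.tc {R : ∀ n, E n → Y n → Y n → Prop}
    (h : Definable fun n (e : E n × Y n × Y n) => R n e.1 e.2.1 e.2.2) :
    Definable fun n (e : E n × Y n × Y n) => Relation.ReflTransGen (R n e.1) e.2.1 e.2.2 := by
  obtain ⟨L, h1, h2⟩ := h
  obtain ⟨L', h1', h2'⟩ := (Coding.range (X := Y)).comap
    fun x : Letter E × Letter Y × Letter Y => x.2.2
  let d : Letter Y := Classical.arbitrary _
  have h := ((h1.and h1').comap fun x : Option (Letter E) × Letter Y × Letter Y =>
    x.1.map fun a => (a, x.2)).reflTransGen.comap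
      fun o : Option (Letter E × Letter Y × Letter Y) =>
        (o.map Prod.fst, (o.map fun x => x.2.1).getD d, (o.map fun x => x.2.2).getD d)
  refine ⟨_, h, fun n hn ⟨e, y, y'⟩ => ?_⟩
  let ext : Y n → Fin (len n) → Letter Y := fun y i => (word (enc y) i).getD d
  have hext : ∀ y z, ext y (index z) = enc y z := fun y z => by simp [ext]
  have e1 : (fun i => (word (enc (X := fun n => E n × Y n × Y n) (e, y, y')) i).map Prod.fst) =
      word (enc e) := map_word _ _
  have e2 : (fun i => ((word (enc (X := fun n => E n × Y n × Y n) (e, y, y')) i).map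
      fun x => x.2.1).getD d) = ext y := funext fun i => congrArg (·.getD d) (congrFun
        (map_word (fun x : Letter E × Letter Y × Letter Y => x.2.1) _) i)
  have e3 : (fun i => ((word (enc (X := fun n => E n × Y n × Y n) (e, y, y')) i).map
      fun x => x.2.2).getD d) = ext y' := funext fun i => congrArg (·.getD d) (congrFun
        (map_word (fun x : Letter E × Letter Y × Letter Y => x.2.2) _) i)
  have hstep : ∀ (y₁ : Y n) (u : Fin (len n) → Letter Y), (∀ z, u (index z) = enc y₁ z) →
      ∀ v : Fin (len n) → Letter Y,
      ((L (len n) (fun i => (word (enc e) i).map fun a => (a, u i, v i)) ∧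
        L' (len n) (fun i => (word (enc e) i).map fun a => (a, u i, v i))) ↔
      ∃ y₂, (∀ z, v (index z) = enc y₂ z) ∧ R n e y₁ y₂) := by
    intro y₁ u hu v
    rw [word_map (enc e) fun i => (u i, v i), h2' n hn]
    have key : ∀ y₂, (∀ z, v (index z) = enc y₂ z) →
        (fun z => (enc e z, u (index z), v (index z))) =
          enc (X := fun n => E n × Y n × Y n) (e, y₁, y₂) := fun y₂ hv =>
      funext fun z => Prod.ext rfl (Prod.ext (hu z) (hv z))
    constructor
    · rintro ⟨hL, y₂, hy₂⟩
      have hv : ∀ z, v (index z) = enc y₂ z := fun z => (congrFun hy₂ z).symm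
      rw [key y₂ hv] at hL
      exact ⟨y₂, hv, (h2 n hn _).1 hL⟩
    · rintro ⟨y₂, hv, hR⟩
      refine ⟨?_, y₂, funext fun z => (hv z).symm⟩
      rw [key y₂ hv]
      exact (h2 n hn _).2 hR
  have key : ∀ (W : Fin (len n) → Option (Letter E)) (U V : Fin (len n) → Letter Y),
      W = word (enc e) → U = ext y → V = ext y' →
      (Relation.ReflTransGen (fun u v : Fin (len n) → Letter Y =>
        L (len n) (fun i => (W i).map fun a => (a, u i, v i)) ∧
        L' (len n) (fun i => (W i).map fun a => (a, u i, v i))) U V ↔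
      Relation.ReflTransGen (R n e) y y') := by
    rintro _ _ _ rfl rfl rfl
    constructor
    · suffices ∀ v, Relation.ReflTransGen (fun u v : Fin (len n) → Letter Y =>
          L (len n) (fun i => (word (enc e) i).map fun a => (a, u i, v i)) ∧
          L' (len n) (fun i => (word (enc e) i).map fun a => (a, u i, v i))) (ext y) v →
          ∃ y₂, (∀ z, v (index z) = enc y₂ z) ∧ Relation.ReflTransGen (R n e) y y₂ by
        intro hc
        obtain ⟨y₂, hy₂, hc⟩ := this _ hc
        obtain rfl : y' = y₂ := Coding.inj hn (funext fun z => (hext y' z).symm.trans (hy₂ z))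
        exact hc
      intro v hv
      induction hv with
      | refl => exact ⟨y, hext y, .refl⟩
      | tail _ hs ih =>
        obtain ⟨y₁, hy₁, hc⟩ := ih
        obtain ⟨y₂, hy₂, hR⟩ := (hstep y₁ _ hy₁ _).1 hs
        exact ⟨y₂, hy₂, hc.tail hR⟩
    · intro hc
      clear e1 e2 e3
      induction hc with
      | refl => exact .refl
      | tail _ hs ih => exact .tail ih ((hstep _ _ (hext _) _).2 ⟨_, hext _, hs⟩)
  exact key _ _ _ e1 e2 e3

end Products

end StackProg

namespace StackProg

open Chess Function
open Coding (Letter enc)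

/-! ### The sorts of chess -/

theorem PS.exists_finite {A K : Type} [Finite A] [Finite K] {L : K → ∀ N, (Fin N → A) → Prop}
    (h : ∀ k, PS (L k)) : PS fun N w => ∃ k, L k N w := by
  have := Fintype.ofFinite K
  have h : ∀ l : List K, PS fun N w => ∃ k ∈ l, L k N w := by
    intro l
    induction l with
    | nil => exact (PS.all fun _ => True).not.congr (by simp)
    | cons k l ih => exact ((h k).or ih).congr (by simp)
  exact (h Finset.univ.toList).congr (by simp)

/-- A set of squares is represented by its indicator function. -/
instance finsetCoding : Coding fun n => Finset (Square n) where
  Letter := Bool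
  finite := inferInstance
  nonempty := inferInstance
  enc T z := decide (z ∈ T)
  inj _ T T' h := Finset.ext fun z => by simpa using congrFun h z
  range := ⟨_, PS.all fun _ => True, fun n _ v => by
    simp only [true_iff, implies_true]
    exact ⟨Finset.univ.filter fun z => v z = true, by simp⟩⟩

/-- A square is represented as a set with one element. -/
instance squareCoding : Coding Square where
  Letter := Bool
  finite := inferInstance
  nonempty := inferInstance
  enc s z := decide (z = s)
  inj _ s s' h := by simpa using congrFun h s
  range := by
    -- A set has one element if it is not empty and all its nonempty subsets are equal to it.
    have h1 : Definable fun n (v : Square n → Bool) => ∃ z, v z = true :=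
      Definable.exists_square (E := fun n => Square n → Bool) fun a => a = true
    have h2 : Definable fun n (v : (Square n → Bool) × (Square n → Bool)) =>
        (∃ z, v.2 z = true) → (∀ z, v.2 z = true → v.1 z = true) →
          ∀ z, v.1 z = true → v.2 z = true := by
      have := h1.comp (E := fun n => (Square n → Bool) × (Square n → Bool)) (fun _ v => v.2)
        (hf := ⟨Prod.snd, fun _ _ _ => rfl⟩)
      have := Definable.forall_square (E := fun n => (Square n → Bool) × (Square n → Bool))
        fun a : Bool × Bool => a.2 = true → a.1 = true
      have := Definable.forall_square (E := fun n => (Square n → Bool) × (Square n → Bool))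
        fun a : Bool × Bool => a.1 = true → a.2 = true
      infer_instance
    obtain ⟨L, h3, h4⟩ := (Definable.and (h := h1) (h' := Definable.all
      (P := fun n (v u : Square n → Bool) => (∃ z, u z = true) → (∀ z, u z = true → v z = true) →
        ∀ z, v z = true → u z = true) (h := h2))).out
    refine ⟨L, h3, fun n hn v => (h4 n hn v).trans ⟨?_, ?_⟩⟩
    · rintro ⟨⟨s, hs⟩, h⟩
      refine ⟨s, funext fun z => ?_⟩
      have := h (fun z => decide (z = s)) ⟨s, by simp⟩ (by simp [hs]) z
      by_cases hz : z = s
      · simp [hz, hs]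
      · have h' : v z ≠ true := fun hv => hz (by simpa using this hv)
        simp [hz, h']
    · rintro ⟨s, rfl⟩
      refine ⟨⟨s, by simp⟩, ?_⟩
      rintro u ⟨z, hz⟩ hu z' hz'
      have h1 := hu z hz
      simp only [decide_eq_true_eq] at h1 hz'
      rwa [hz', ← h1]

/-- The additional object `none` is represented by an additional letter on all squares. -/
instance optionCoding (X : ℕ → Type) [Coding X] : Coding fun n => Option (X n) where
  Letter := Option (Letter X)
  finite := inferInstance
  nonempty := inferInstance
  enc o z := o.map fun x => enc x z
  inj {n} hn o o' h := by
    cases o <;> cases o'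
    · rfl
    · simpa using congrFun h (⟨0, hn⟩, ⟨0, hn⟩)
    · simpa using congrFun h (⟨0, hn⟩, ⟨0, hn⟩)
    · exact congrArg _ (Coding.inj hn (funext fun z => Option.some.inj (congrFun h z)))
  range := by
    obtain ⟨L, h1, h2⟩ := Definable.forall_square (E := fun n => Square n → Option (Letter X))
      fun a => a = none
    obtain ⟨L', h1', h2'⟩ := Definable.forall_square (E := fun n => Square n → Option (Letter X))
      fun a : Option (Letter X) => a.isSome
    obtain ⟨L'', h1'', h2''⟩ := (Coding.range (X := X)).comap
      fun a : Option (Letter X) => a.getD (Classical.arbitrary _)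
    refine ⟨_, h1.or (h1'.and h1''), fun n hn v =>
      (or_congr (h2 n hn v) (and_congr (h2' n hn v) (h2'' n hn v))).trans ⟨?_, ?_⟩⟩
    · rintro (h | ⟨h, x, hx⟩)
      · exact ⟨none, funext fun z => (h z).symm⟩
      · refine ⟨some x, funext fun z => ?_⟩
        obtain ⟨a, ha⟩ := Option.isSome_iff_exists.1 (h z)
        have : enc x z = (v z).getD _ := congrFun hx z
        simp only [Option.map_some, this]
        change v z = some a at ha
        rw [ha]
        rfl
    · rintro ⟨o, rfl⟩
      cases o with
      | none => exact .inl fun _ => rfl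
      | some x => exact .inr ⟨fun _ => rfl, x, rfl⟩

-- This instance stands behind the one for `Option`, so that it is found first for sorts that do not
-- depend on the size of the board.
/-- An element of a finite type is represented by the same letter on all squares. A board without
squares has no place for it, so that boards are required to have positive size. -/
instance constCoding (K : Type) [Finite K] [Nonempty K] : Coding fun _ => K where
  Letter := K
  finite := inferInstance
  nonempty := inferInstance
  enc k _ := k
  inj hn _ _ h := congrFun h (⟨0, hn⟩, ⟨0, hn⟩)
  range := by
    choose L h1 h2 using fun k : K => (Definable.forall_square
      (E := fun n => Square n → K) fun a => k = a).out
    refine ⟨_, PS.exists_finite h1, fun n hn v => exists_congr fun k => (h2 k n hn v).trans ?_⟩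
    exact funext_iff.symm

/-- The objects of a sort may be represented by those of an equivalent sort. -/
@[reducible]
def Coding.ofEquiv {X Y : ℕ → Type} [Coding Y] (f : ∀ n, X n ≃ Y n) : Coding X where
  Letter := Letter Y
  finite := inferInstance
  nonempty := inferInstance
  enc x := enc (f _ x)
  inj hn := (Coding.inj hn).comp (f _).injective
  range := by
    obtain ⟨L, h1, h2⟩ := Coding.range (X := Y)
    refine ⟨L, h1, fun n hn v => (h2 n hn v).trans ⟨?_, ?_⟩⟩
    · rintro ⟨y, rfl⟩
      exact ⟨(f n).symm y, by simp⟩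
    · rintro ⟨x, rfl⟩
      exact ⟨_, rfl⟩

instance : Fintype Color := ⟨{.white, .black}, fun c => by cases c <;> simp⟩

instance : Fintype Kind :=
  ⟨{.pawn, .rook, .knight, .bishop, .queen, .king}, fun k => by cases k <;> simp⟩

instance : Finite Piece :=
  Finite.of_injective (fun p : Piece => (p.color, p.kind)) fun p p' h => by
    cases p; cases p'; simpa using h

instance : Nonempty Color := ⟨.white⟩

instance : Nonempty Kind := ⟨.pawn⟩

instance : Nonempty Piece := ⟨⟨.white, .pawn⟩⟩

instance positionCoding : Coding Position :=
  .ofEquiv (Y := fun n => Board n × Color) fun _ =>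
    ⟨fun p => (p.board, p.turn), fun p => ⟨p.1, p.2⟩, fun _ => rfl, fun _ => rfl⟩

instance stateCoding : Coding State :=
  .ofEquiv (Y := fun n => Position n × Finset (Square n) × Option (Square n)) fun _ =>
    ⟨fun s => (s.toPosition, s.touched, s.passed), fun s => ⟨s.1, s.2.1, s.2.2⟩, fun _ => rfl,
      fun _ => rfl⟩

/-! ### Letterwise functions -/

section Letterwise

variable {E X Y : ℕ → Type} [Coding E] [Coding X] [Coding Y]

instance Letterwise.pair {f : ∀ n, E n → X n} {f' : ∀ n, E n → Y n} [h : Letterwise f]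
    [h' : Letterwise f'] : Letterwise fun n e => (f n e, f' n e) := by
  obtain ⟨g, h⟩ := h
  obtain ⟨g', h'⟩ := h'
  exact ⟨fun a => (g a, g' a), fun n e z => Prod.ext (h n e z) (h' n e z)⟩

instance Letterwise.fst {f : ∀ n, E n → X n × Y n} [h : Letterwise f] :
    Letterwise fun n e => (f n e).1 := by
  obtain ⟨g, h⟩ := h
  exact ⟨fun a => (g a).1, fun n e z => congrArg Prod.fst (h n e z)⟩

instance Letterwise.snd {f : ∀ n, E n → X n × Y n} [h : Letterwise f] :
    Letterwise fun n e => (f n e).2 := by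
  obtain ⟨g, h⟩ := h
  exact ⟨fun a => (g a).2, fun n e z => congrArg Prod.snd (h n e z)⟩

instance Letterwise.some {f : ∀ n, E n → X n} [h : Letterwise f] :
    Letterwise fun n e => some (f n e) := by
  obtain ⟨g, h⟩ := h
  exact ⟨fun a => Option.some (g a), fun n e z => congrArg Option.some (h n e z)⟩

instance Letterwise.none : Letterwise fun n (_ : E n) => (none : Option (X n)) :=
  ⟨fun _ => Option.none, fun _ _ _ => rfl⟩

instance Letterwise.const {K : Type} [Finite K] [Nonempty K] (k : K) :
    Letterwise fun n (_ : E n) => k :=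
  ⟨fun _ => k, fun _ _ _ => rfl⟩

instance Letterwise.other {c : ∀ n, E n → Color} [h : Letterwise c] :
    Letterwise fun n e => (c n e).other := by
  obtain ⟨g, h⟩ := h
  exact ⟨fun a => (g a).other, fun n e z => congrArg Color.other (h n e z)⟩

instance Letterwise.piece {c : ∀ n, E n → Color} {k : ∀ n, E n → Kind} [h : Letterwise c]
    [h' : Letterwise k] : Letterwise fun n e => Piece.mk (c n e) (k n e) := by
  obtain ⟨g, h⟩ := h
  obtain ⟨g', h'⟩ := h'
  exact ⟨fun a => ⟨g a, g' a⟩, fun n e z => congrArg₂ Piece.mk (h n e z) (h' n e z)⟩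

instance Letterwise.color {p : ∀ n, E n → Piece} [h : Letterwise p] :
    Letterwise fun n e => (p n e).color := by
  obtain ⟨g, h⟩ := h
  exact ⟨fun a => (g a).color, fun n e z => congrArg Piece.color (h n e z)⟩

instance Letterwise.kind {p : ∀ n, E n → Piece} [h : Letterwise p] :
    Letterwise fun n e => (p n e).kind := by
  obtain ⟨g, h⟩ := h
  exact ⟨fun a => (g a).kind, fun n e z => congrArg Piece.kind (h n e z)⟩

instance Letterwise.singleton {s : ∀ n, E n → Square n} [h : Letterwise s] :
    Letterwise fun n e => ({s n e} : Finset (Square n)) := by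
  obtain ⟨g, h⟩ := h
  exact ⟨g, fun n e z => by rw [← h]; simp [enc]⟩

instance Letterwise.insert {s : ∀ n, E n → Square n} {T : ∀ n, E n → Finset (Square n)}
    [h : Letterwise s] [h' : Letterwise T] : Letterwise fun n e => insert (s n e) (T n e) := by
  obtain ⟨g, h⟩ := h
  obtain ⟨g', h'⟩ := h'
  exact ⟨fun a => Bool.or (g a) (g' a), fun n e z => by
    simp only [← h, ← h']; simp [enc]⟩

instance Letterwise.update {A : Type} [Finite A] [Nonempty A] {b : ∀ n, E n → Square n → A}
    {s : ∀ n, E n → Square n} {a : ∀ n, E n → A}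
    [h : Letterwise b] [h' : Letterwise s] [h'' : Letterwise a] :
    Letterwise fun n e => update (b n e) (s n e) (a n e) := by
  obtain ⟨g, h⟩ := h
  obtain ⟨g', h'⟩ := h'
  obtain ⟨g'', h''⟩ := h''
  exact ⟨fun a => bif g' a then g'' a else g a, fun n e z => by
    simp only [← h, ← h', ← h'']; simp [enc, update_apply, Bool.cond_decide]⟩

instance Letterwise.constSome {K : Type} [Finite K] [Nonempty K] {f : ∀ n, E n → K}
    [h : Letterwise f] : Letterwise (Y := fun _ => Option K) fun n e => Option.some (f n e) := by
  obtain ⟨g, h⟩ := h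
  exact ⟨fun a => Option.some (g a), fun n e z => congrArg Option.some (h n e z)⟩

instance Letterwise.toPosition {s : ∀ n, E n → State n} [h : Letterwise s] :
    Letterwise fun n e => (s n e).toPosition := by
  obtain ⟨g, h⟩ := h
  exact ⟨fun a => (g a).1, fun n e z => congrArg Prod.fst (h n e z)⟩

instance Letterwise.touched {s : ∀ n, E n → State n} [h : Letterwise s] :
    Letterwise fun n e => (s n e).touched := by
  obtain ⟨g, h⟩ := h
  exact ⟨fun a => (g a).2.1, fun n e z => congrArg (fun x => x.2.1) (h n e z)⟩

instance Letterwise.passed {s : ∀ n, E n → State n} [h : Letterwise s] :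
    Letterwise fun n e => (s n e).passed := by
  obtain ⟨g, h⟩ := h
  exact ⟨fun a => (g a).2.2, fun n e z => congrArg (fun x => x.2.2) (h n e z)⟩

instance Letterwise.board {p : ∀ n, E n → Position n} [h : Letterwise p] :
    Letterwise (Y := Board) fun n e => (p n e).board := by
  obtain ⟨g, h⟩ := h
  exact ⟨fun a => (g a).1, fun n e z => congrArg Prod.fst (h n e z)⟩

instance Letterwise.turn {p : ∀ n, E n → Position n} [h : Letterwise p] :
    Letterwise fun n e => (p n e).turn := by
  obtain ⟨g, h⟩ := h
  exact ⟨fun a => (g a).2, fun n e z => congrArg Prod.snd (h n e z)⟩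

instance Letterwise.move {b : ∀ n, E n → Board n} {x y : ∀ n, E n → Square n}
    {p : ∀ n, E n → Piece} [Letterwise b] [Letterwise x] [Letterwise y] [Letterwise p] :
    Letterwise (Y := Board) fun n e => Board.move (b n e) (x n e) (y n e) (p n e) :=
  inferInstanceAs (Letterwise (Y := fun n => Square n → Option Piece) fun n e =>
    Function.update (Function.update (b n e) (x n e) Option.none) (y n e) (Option.some (p n e)))

instance Letterwise.next {s : ∀ n, E n → State n} {b : ∀ n, E n → Board n}
    {T : ∀ n, E n → Finset (Square n)} {o : ∀ n, E n → Option (Square n)}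
    [h₁ : Letterwise s] [h₂ : Letterwise (Y := Board) b] [h₃ : Letterwise T] [h₄ : Letterwise o] :
    Letterwise fun n e => (s n e).next (b n e) (T n e) (o n e) := by
  obtain ⟨g₁, h₁⟩ := h₁
  obtain ⟨g₂, h₂⟩ := h₂
  obtain ⟨g₃, h₃⟩ := h₃
  obtain ⟨g₄, h₄⟩ := h₄
  refine ⟨fun a => ((g₂ a, (g₁ a).1.2.other), Bool.or (g₁ a).2.1 (g₃ a), g₄ a), fun n e z => ?_⟩
  have k₁ : (((s n e).board z, (s n e).turn), decide (z ∈ (s n e).touched),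
    enc (s n e).passed z) = g₁ (enc e z) := h₁ n e z
  have k₃ : decide (z ∈ T n e) = g₃ (enc e z) := h₃ n e z
  change ((b n e z, (s n e).turn.other), decide (z ∈ (s n e).touched ∪ T n e), enc (o n e) z) =
    ((g₂ (enc e z), _), _, g₄ (enc e z))
  rw [← h₂, ← h₄, ← k₁, ← k₃]
  simp only [Finset.mem_union, Bool.decide_or]
  rfl

instance Letterwise.toState {p : ∀ n, E n → Position n} [h : Letterwise p] :
    Letterwise fun n e => (p n e).toState := by
  obtain ⟨g, h⟩ := h
  refine ⟨fun a => (g a, false, Option.none), fun n e z => ?_⟩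
  simp only [← h]
  simp [enc, Position.toState]

instance Letterwise.id : Letterwise fun n (e : E n) => e := ⟨fun a => a, fun _ _ _ => rfl⟩

end Letterwise

/-! ### Squares and lines -/

section Squares

variable {E : ℕ → Type} [Coding E]

/-- Local information about a square. -/
theorem Definable.at_square (φ : Letter E → Prop) (s : ∀ n, E n → Square n) [h : Letterwise s] :
    Definable fun n e => φ (enc e (s n e)) := by
  obtain ⟨g, h⟩ := h
  refine (Definable.exists_square fun a : Letter E => g a = true ∧ φ a).congr fun n e => ?_
  have : ∀ z, g (enc e z) = true ↔ z = s n e := fun z => by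
    rw [← h]; exact decide_eq_true_iff
  simp [this]

instance Definable.apply_eq {A : Type} [Finite A] [Nonempty A] {b : ∀ n, E n → Square n → A}
    {s : ∀ n, E n → Square n} {a : ∀ n, E n → A}
    [h : Letterwise b] [h' : Letterwise s] [h'' : Letterwise a] :
    Definable fun n e => b n e (s n e) = a n e := by
  obtain ⟨g, h⟩ := h
  obtain ⟨g'', h''⟩ := h''
  refine (Definable.at_square (fun x => g x = g'' x) s).congr fun n e => ?_
  rw [← h, ← h'']
  rfl

instance Definable.mem {s : ∀ n, E n → Square n} {T : ∀ n, E n → Finset (Square n)}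
    [h : Letterwise T] [h' : Letterwise s] : Definable fun n e => s n e ∈ T n e := by
  obtain ⟨g, h⟩ := h
  refine (Definable.at_square (fun x => g x = true) s).congr fun n e => ?_
  rw [← h]
  exact decide_eq_true_iff

theorem eq_shiftBy_iff {N k : ℕ} {x y : Fin N → Bool} {i j : Fin N} (hx : ∀ l, x l = true ↔ l = i)
    (hy : ∀ l, y l = true ↔ l = j) : y = shiftBy k x ↔ (j : ℕ) = i + k := by
  constructor
  · rintro rfl
    obtain ⟨l, hl, e⟩ := shiftBy_eq_true.1 ((hy j).2 rfl)
    rwa [(hx l).1 hl] at e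
  · intro h
    funext l
    rw [Bool.eq_iff_iff, shiftBy_eq_true, hy]
    simp only [hx, Fin.ext_iff, h]
    exact ⟨fun hl => ⟨i, rfl, hl⟩, fun ⟨_, hj, hl⟩ => by omega⟩

/-- The mark of a square in a word. -/
theorem word_elim_iff {A : Type} {n : ℕ} {v : Square n → A} {f : A → Bool} {s : Square n}
    (h : ∀ z, f (v z) = true ↔ z = s) (i : Fin (len n)) :
    (word v i).elim false f = true ↔ i = index s := by
  by_cases hi : (i : ℕ) % (n + 1) = 0
  · rw [word_eq_none.2 hi]
    simp only [Option.elim_none, Bool.false_eq_true, false_iff]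
    rintro rfl
    rw [index_mod] at hi
    omega
  · obtain ⟨z, rfl⟩ := exists_index hi
    simp [h, index_injective.eq_iff]

/-- A step along a rank is a shift by one place. A shift from the last file does not reach a square,
because there is a place between the ranks. -/
theorem definable_east :
    Definable fun n (e : Square n × Square n) => Along (0, 1) 1 e.1 e.2 := by
  refine ⟨_, PS.shift_one.comap fun o : Option (Bool × Bool) =>
    (o.elim false Prod.fst, o.elim false Prod.snd), fun n hn e => ?_⟩
  simp only [comp_def]
  rw [eq_shiftBy_iff (word_elim_iff fun z => decide_eq_true_iff)
    (word_elim_iff fun z => decide_eq_true_iff)]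
  obtain ⟨⟨i, j⟩, t⟩ := e
  change (index t : ℕ) = index (i, j) + 1 ↔ _
  by_cases hj : (j : ℕ) + 1 < n
  · have : (index (i, j) : ℕ) + 1 = index (i, (⟨j + 1, hj⟩ : Fin n)) := by
      simp only [index]; omega
    rw [this, ← Fin.ext_iff, index_injective.eq_iff, Along, Prod.ext_iff, Fin.ext_iff, Fin.ext_iff]
    simp only
    omega
  · have h1 := t.2.2
    have h2 := j.2
    refine iff_of_false (fun h => ?_) fun h => ?_
    · have h3 := index_mod t
      have : (index t : ℕ) = (n + 1) * (i + 1) := by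
        rw [h, Nat.mul_succ, mul_comm (n + 1)]; simp only [index]; omega
      rw [this, Nat.mul_mod_right] at h3
      omega
    · have := h.2
      simp only at this
      omega

/-- A step along a file is a shift by `n + 1` places, the period of the places that do not belong to
squares. -/
theorem definable_north :
    Definable fun n (e : Square n × Square n) => Along (1, 0) 1 e.1 e.2 := by
  refine ⟨_, PS.period.comap fun o : Option (Bool × Bool) =>
    (o.elim true fun _ => false, o.elim false Prod.fst, o.elim false Prod.snd), fun n hn e => ?_⟩
  simp only [comp_def]
  have hd : ∀ (v : Square n → Bool × Bool) (i : Fin (len n)),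
      (word v i).elim true (fun _ => false) = true ↔ (i : ℕ) % (n + 1) = 0 := fun v i => by
    rw [← word_eq_none (v := v)]
    cases word v i <;> simp
  simp only [PS.period_iff hn (hd _), exists_eq_left]
  rw [eq_shiftBy_iff (word_elim_iff fun z => decide_eq_true_iff)
    (word_elim_iff fun z => decide_eq_true_iff)]
  obtain ⟨⟨i, j⟩, t⟩ := e
  change (index t : ℕ) = index (i, j) + (n + 1) ↔ _
  by_cases hi : (i : ℕ) + 1 < n
  · have : (index (i, j) : ℕ) + (n + 1) = index ((⟨i + 1, hi⟩ : Fin n), j) := by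
      simp only [index]; rw [Nat.add_mul]; omega
    rw [this, ← Fin.ext_iff, index_injective.eq_iff, Along, Prod.ext_iff, Fin.ext_iff, Fin.ext_iff]
    simp only
    omega
  · have h1 := t.1.2
    have h2 := i.2
    refine iff_of_false (fun h => ?_) fun h => ?_
    · have h3 := index_div t
      rw [h, Nat.add_div_right _ n.succ_pos, index_div] at h3
      simp only at h3
      omega
    · have := h.1
      simp only at this
      omega

/-- A fixed number of steps along a rank or a file. -/
theorem definable_along_zero (d : ℤ × ℤ) (h : d = (1, 0) ∨ d = (0, 1)) (k : ℕ) :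
    Definable fun n (e : Square n × Square n) => Along d k e.1 e.2 := by
  have h1 : Definable fun n (e : Square n × Square n) => Along d 1 e.1 e.2 := by
    rcases h with rfl | rfl
    exacts [definable_north, definable_east]
  induction k with
  | zero =>
    refine (inferInstance : Definable fun n (e : Square n × Square n) => e.2 = e.1).congr ?_
    intro n e
    rw [Along, Prod.ext_iff, Fin.ext_iff, Fin.ext_iff]
    simp
  | succ k ih =>
    have i1 := ih.comp (E := fun n => (Square n × Square n) × Square n) fun n e => (e.1.1, e.2)
    have i2 := h1.comp (E := fun n => (Square n × Square n) × Square n) fun n e => (e.2, e.1.2)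
    refine (inferInstance : Definable fun n (e : Square n × Square n) =>
      ∃ u, Along d k e.1 u ∧ Along d 1 u e.2).congr ?_
    rintro n ⟨s, t⟩
    constructor
    · rintro ⟨u, h1, h2⟩
      simp only [Along] at *
      push_cast at *
      constructor <;> linarith
    · intro h'
      have := t.1.2
      have := t.2.2
      rcases h with rfl | rfl
      · simp only [Along, mul_one, mul_zero] at *
        refine ⟨(⟨s.1 + k, by omega⟩, s.2), ?_, ?_⟩ <;> simp; omega
      · simp only [Along, mul_one, mul_zero] at *
        refine ⟨(s.1, ⟨s.2 + k, by omega⟩), ?_, ?_⟩ <;> simp; omega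

/-- A fixed displacement is composed of displacements along a file and along a rank. -/
theorem definable_along (d : ℤ × ℤ) :
    Definable fun n (e : Square n × Square n) => Along d 1 e.1 e.2 := by
  have key : ∀ c : ℤ × ℤ, c = (1, 0) ∨ c = (0, 1) → ∀ a : ℤ,
      Definable fun n (e : Square n × Square n) => Along (a * c.1, a * c.2) 1 e.1 e.2 := by
    intro c hc a
    obtain ⟨k, rfl | rfl⟩ := a.eq_nat_or_neg
    · refine (definable_along_zero c hc k).congr fun n e => ?_
      simp [Along]
    · have := (definable_along_zero c hc k).comp (E := fun n => Square n × Square n)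
        fun n e => (e.2, e.1)
      refine this.congr fun n e => ?_
      simp only [Along]
      push_cast
      constructor <;> rintro ⟨h1, h2⟩ <;> constructor <;> linarith
  have i1 := (key _ (.inl rfl) d.1).comp (E := fun n => (Square n × Square n) × Square n)
    fun n e => (e.1.1, e.2)
  have i2 := (key _ (.inr rfl) d.2).comp (E := fun n => (Square n × Square n) × Square n)
    fun n e => (e.2, e.1.2)
  refine (inferInstance : Definable fun n (e : Square n × Square n) => ∃ u,
    Along (d.1 * 1, d.1 * 0) 1 e.1 u ∧ Along (d.2 * 0, d.2 * 1) 1 u e.2).congr ?_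
  rintro n ⟨s, t⟩
  simp only [Along]
  push_cast
  constructor
  · rintro ⟨u, h1, h2⟩
    constructor <;> linarith
  · intro h
    refine ⟨(t.1, s.2), ⟨?_, ?_⟩, ?_, ?_⟩ <;> simp only <;> linarith

instance Definable.along (d : ℤ × ℤ) {s t : ∀ n, E n → Square n} [Letterwise s] [Letterwise t] :
    Definable fun n e => Along d 1 (s n e) (t n e) :=
  (definable_along d).comp fun n e => (s n e, t n e)

end Squares
end StackProg

namespace StackProg

open Chess Function
open Coding (Letter enc)

/-! ### The rules of chess -/

section Rules

-- A formula with many variables is about deeply nested tuples, which make for large instances.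
set_option synthInstance.maxSize 100000
set_option synthInstance.maxHeartbeats 1000000
set_option maxHeartbeats 1000000

variable {E Y : ℕ → Type} [Coding E] [Coding Y]

instance Definable.reflTransGen {R : ∀ n, E n → Y n → Y n → Prop} {u v : ∀ n, E n → Y n}
    [h : Definable fun n (e : E n × Y n × Y n) => R n e.1 e.2.1 e.2.2] [Letterwise u]
    [Letterwise v] : Definable fun n e => Relation.ReflTransGen (R n e) (u n e) (v n e) :=
  h.tc.comp fun n e => (e, u n e, v n e)

theorem Definable.exists_mem {ι : Type} [DecidableEq ι] (D : Finset ι)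
    {P : ι → ∀ n, E n → Prop} (h : ∀ d, Definable (P d)) :
    Definable fun n e => ∃ d ∈ D, P d n e := by
  induction D using Finset.induction_on with
  | empty => exact (Definable.const False).congr (by simp)
  | insert d D _ ih => exact (Definable.or (h := h d) (h' := ih)).congr (by simp)

instance Definable.relRank_eq (r : ℕ) {c : ∀ n, E n → Color} {s : ∀ n, E n → Square n}
    [Letterwise c] [Letterwise s] : Definable fun n e => relRank (c n e) (s n e) = r := by
  suffices h : Definable fun n (e : Color × Square n) => relRank e.1 e.2 = r from
    h.comp fun n e => (c n e, s n e)
  induction r with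
  | zero =>
    refine (inferInstance : Definable fun n (e : Color × Square n) =>
      (e.1 = .white ∧ ¬ ∃ t, Along (-1, 0) 1 e.2 t) ∨
        e.1 = .black ∧ ¬ ∃ t, Along (1, 0) 1 e.2 t).congr ?_
    rintro n ⟨_ | _, ⟨i, j⟩⟩
    · simp only [relRank, Along, true_and, reduceCtorEq, false_and, or_false]
      refine ⟨fun h => ?_, ?_⟩
      · by_contra h'
        exact h ⟨(⟨i - 1, by omega⟩, j), by simp; omega⟩
      · rintro h ⟨t, h', -⟩
        omega
    · simp only [relRank, Along, true_and, reduceCtorEq, false_and, false_or, Fin.val_rev]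
      refine ⟨fun h => ?_, ?_⟩
      · by_contra h'
        exact h ⟨(⟨i + 1, by omega⟩, j), by simp⟩
      · rintro h ⟨t, h', -⟩
        have := t.1.2
        omega
  | succ r ih =>
    have := ih.comp (E := fun n => (Color × Square n) × Square n) fun n e => (e.1.1, e.2)
    refine (inferInstance : Definable fun n (e : Color × Square n) =>
      (e.1 = .white ∧ ∃ t, Along (-1, 0) 1 e.2 t ∧ relRank e.1 t = r) ∨
        e.1 = .black ∧ ∃ t, Along (1, 0) 1 e.2 t ∧ relRank e.1 t = r).congr ?_
    rintro n ⟨_ | _, ⟨i, j⟩⟩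
    · simp only [relRank, Along, true_and, reduceCtorEq, false_and, or_false]
      constructor
      · rintro ⟨t, ⟨h1, -⟩, h2⟩
        simp only at *
        omega
      · intro h
        exact ⟨(⟨i - 1, by omega⟩, j), by simp; omega⟩
    · simp only [relRank, Along, true_and, reduceCtorEq, false_and, false_or, Fin.val_rev]
      constructor
      · rintro ⟨t, ⟨h1, -⟩, h2⟩
        have := t.1.2
        simp only at *
        omega
      · intro h
        exact ⟨(⟨i + 1, by omega⟩, j), by simp; omega⟩

/-- The last rank of a player is the first rank of the opponent, so that it can be recognized
without comparing a rank with `n`. -/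
theorem relRank_add_one_eq {n : ℕ} {c : Color} {s : Square n} :
    relRank c s + 1 = n ↔ relRank c.other s = 0 := by
  have := s.1.2
  cases c <;> simp only [relRank, Color.other, Fin.val_rev] <;> omega

instance Definable.relRank_last {c : ∀ n, E n → Color} {s : ∀ n, E n → Square n}
    [Letterwise c] [Letterwise s] : Definable fun n e => relRank (c n e) (s n e) + 1 = n := by
  simp only [relRank_add_one_eq]
  infer_instance

/-- `t` is the square in front of `s`, as seen by the player `c`. -/
def Forward {n : ℕ} (c : Color) (s t : Square n) : Prop :=
  relRank c t = relRank c s + 1 ∧ t.2 = s.2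

instance Definable.forward {c : ∀ n, E n → Color} {s t : ∀ n, E n → Square n}
    [Letterwise c] [Letterwise s] [Letterwise t] :
    Definable fun n e => Forward (c n e) (s n e) (t n e) := by
  refine (inferInstance : Definable fun n e => (c n e = .white ∧ Along (1, 0) 1 (s n e) (t n e)) ∨
    c n e = .black ∧ Along (-1, 0) 1 (s n e) (t n e)).congr fun n e => ?_
  have h1 := (s n e).1.2
  have h2 := (t n e).1.2
  cases c n e <;> simp only [Forward, relRank, Along, Fin.ext_iff, true_and, reduceCtorEq,
    false_and, or_false, false_or, Fin.val_rev] <;> omega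

instance Definable.pawnAttack {c : ∀ n, E n → Color} {s t : ∀ n, E n → Square n}
    [Letterwise c] [Letterwise s] [Letterwise t] :
    Definable fun n e => relRank (c n e) (t n e) = relRank (c n e) (s n e) + 1 ∧
      AdjacentFile (s n e) (t n e) := by
  refine (inferInstance : Definable fun n e =>
    (c n e = .white ∧ (Along (1, 1) 1 (s n e) (t n e) ∨ Along (1, -1) 1 (s n e) (t n e))) ∨
    c n e = .black ∧ (Along (-1, 1) 1 (s n e) (t n e) ∨ Along (-1, -1) 1 (s n e) (t n e))).congr
      fun n e => ?_
  have h1 := (s n e).1.2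
  have h2 := (t n e).1.2
  cases c n e <;> simp only [relRank, AdjacentFile, Along, true_and, reduceCtorEq,
    false_and, or_false, false_or, Fin.val_rev] <;> omega

instance Definable.steps (D : Finset (ℤ × ℤ)) {s t : ∀ n, E n → Square n}
    [Letterwise s] [Letterwise t] : Definable fun n e => Steps D (s n e) (t n e) :=
  .exists_mem D fun _ => inferInstance

/-- The board is convex: the squares between two squares on a line lie on the board. -/
theorem exists_between {n : ℕ} {d : ℤ × ℤ} {k : ℕ} {s t : Square n} (h : Along d (k + 1) s t) :
    ∃ u, Along d k s u ∧ Along d 1 u t := by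
  have key : ∀ (x y : Fin n) (a : ℤ), ((y : ℕ) : ℤ) = x + (k + 1 : ℕ) * a →
      ∃ z : Fin n, ((z : ℕ) : ℤ) = x + k * a := by
    intro x y a h
    have hx := x.2
    have hy := y.2
    push_cast at h
    have hk : (0 : ℤ) ≤ k := by positivity
    have h0 : 0 ≤ (x : ℤ) + k * a ∧ (x : ℤ) + k * a < n := by
      rcases le_total 0 a with ha | ha
      · have := mul_nonneg hk ha
        constructor <;> nlinarith
      · have := mul_nonneg hk (neg_nonneg.2 ha)
        constructor <;> nlinarith
    exact ⟨⟨((x : ℤ) + k * a).toNat, by omega⟩, by simp [h0.1]⟩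
  obtain ⟨i, hi⟩ := key _ _ _ h.1
  obtain ⟨j, hj⟩ := key _ _ _ h.2
  refine ⟨(i, j), ⟨hi, hj⟩, ?_⟩
  simp only [Along, hi, hj, h.1, h.2]
  push_cast
  constructor <;> ring

/-- Sliding expressed by a transitive closure: after one step, any number of steps that each leave
an empty square. -/
theorem slide_iff {n : ℕ} {b : Board n} {d : ℤ × ℤ} {s t : Square n} :
    (∃ k : ℕ, 0 < k ∧ Along d k s t ∧ ClearPath b d k s) ↔
      ∃ u, Along d 1 s u ∧
        Relation.ReflTransGen (fun v w => b v = none ∧ Along d 1 v w) u t := by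
  constructor
  · rintro ⟨k, hk, h⟩
    obtain ⟨k, rfl⟩ := Nat.exists_eq_succ_of_ne_zero hk.ne'
    clear hk
    induction k generalizing t with
    | zero => exact ⟨t, h.1, .refl⟩
    | succ k ih =>
      obtain ⟨v, hv, hvt⟩ := exists_between h.1
      obtain ⟨u, hu, hc⟩ := ih ⟨hv, fun j w h0 hj => h.2 j w h0 (by omega)⟩
      exact ⟨u, hu, hc.tail ⟨h.2 _ v k.succ_pos (by omega) hv, hvt⟩⟩
  · rintro ⟨u, hu, hc⟩
    induction hc with
    | refl => exact ⟨1, one_pos, hu, fun j v h0 h1 => by omega⟩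
    | @tail v w _ hs ih =>
      obtain ⟨k, -, hk, hclear⟩ := ih
      refine ⟨k + 1, k.succ_pos, ?_, fun j x h0 hj hx => ?_⟩
      · have := hs.2
        simp only [Along] at *
        push_cast at *
        constructor <;> linarith
      · rcases Nat.lt_or_ge j k with hjk | hjk
        · exact hclear j x h0 hjk hx
        · obtain rfl : j = k := by omega
          have : x = v := by
            rw [Along] at hx hk
            exact Prod.ext (Fin.ext (by omega)) (Fin.ext (by omega))
          rw [this, hs.1]

instance Definable.slide (d : ℤ × ℤ) {b : ∀ n, E n → Board n} {s t : ∀ n, E n → Square n}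
    [Letterwise (Y := Board) b] [Letterwise s] [Letterwise t] :
    Definable fun n e => ∃ k : ℕ, 0 < k ∧ Along d k (s n e) (t n e) ∧
      ClearPath (b n e) d k (s n e) := by
  suffices h : Definable fun n (e : Board n × Square n × Square n) => ∃ k : ℕ,
      0 < k ∧ Along d k e.2.1 e.2.2 ∧ ClearPath e.1 d k e.2.1 from
    h.comp fun n e => (b n e, s n e, t n e)
  simp only [slide_iff]
  infer_instance

instance Definable.slides (D : Finset (ℤ × ℤ)) {b : ∀ n, E n → Board n}
    {s t : ∀ n, E n → Square n} [Letterwise (Y := Board) b] [Letterwise s] [Letterwise t] :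
    Definable fun n e => Slides (b n e) D (s n e) (t n e) :=
  .exists_mem D fun _ => inferInstance

instance Definable.attacks {b : ∀ n, E n → Board n} {p : ∀ n, E n → Piece}
    {s t : ∀ n, E n → Square n} [Letterwise (Y := Board) b] [Letterwise p] [Letterwise s]
    [Letterwise t] : Definable fun n e => Attacks (b n e) (p n e) (s n e) (t n e) := by
  refine (inferInstance : Definable fun n e =>
    ((p n e).kind = .pawn ∧ (relRank (p n e).color (t n e) = relRank (p n e).color (s n e) + 1 ∧
      AdjacentFile (s n e) (t n e))) ∨
    ((p n e).kind = .rook ∧ Slides (b n e) straight (s n e) (t n e)) ∨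
    ((p n e).kind = .knight ∧ Steps knightJumps (s n e) (t n e)) ∨
    ((p n e).kind = .bishop ∧ Slides (b n e) diagonal (s n e) (t n e)) ∨
    ((p n e).kind = .queen ∧ Slides (b n e) (straight ∪ diagonal) (s n e) (t n e)) ∨
    ((p n e).kind = .king ∧ Steps (straight ∪ diagonal) (s n e) (t n e))).congr fun n e => ?_
  obtain ⟨c, k⟩ := p n e
  cases k <;> simp [Attacks]

instance Definable.attackedBy {b : ∀ n, E n → Board n} {c : ∀ n, E n → Color}
    {t : ∀ n, E n → Square n} [Letterwise (Y := Board) b] [Letterwise c] [Letterwise t] :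
    Definable fun n e => AttackedBy (b n e) (c n e) (t n e) := by
  suffices h : Definable fun n (e : Board n × Color × Square n) => AttackedBy e.1 e.2.1 e.2.2 from
    h.comp fun n e => (b n e, c n e, t n e)
  unfold AttackedBy
  infer_instance

instance Definable.inCheck {b : ∀ n, E n → Board n} {c : ∀ n, E n → Color}
    [Letterwise (Y := Board) b] [Letterwise c] :
    Definable fun n e => InCheck (b n e) (c n e) := by
  suffices h : Definable fun n (e : Board n × Color) => InCheck e.1 e.2 from
    h.comp fun n e => (b n e, c n e)
  unfold InCheck
  infer_instance

instance Definable.capturable {b : ∀ n, E n → Board n} {c : ∀ n, E n → Color}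
    {t : ∀ n, E n → Square n} [Letterwise (Y := Board) b] [Letterwise c] [Letterwise t] :
    Definable fun n e => Capturable (b n e) (c n e) (t n e) := by
  suffices h : Definable fun n (e : Board n × Color × Square n) => Capturable e.1 e.2.1 e.2.2 from
    h.comp fun n e => (b n e, c n e, t n e)
  unfold Capturable
  infer_instance

instance Definable.arrives {c : ∀ n, E n → Color} {y : ∀ n, E n → Square n} {k : ∀ n, E n → Kind}
    [Letterwise c] [Letterwise y] [Letterwise k] :
    Definable fun n e => Arrives (c n e) (y n e) (k n e) := by
  refine (inferInstance : Definable fun n e =>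
    (relRank (c n e) (y n e) + 1 = n ∧
      (k n e = .queen ∨ k n e = .rook ∨ k n e = .bishop ∨ k n e = .knight)) ∨
    (¬ relRank (c n e) (y n e) + 1 = n ∧ k n e = .pawn)).congr fun n e => ?_
  unfold Arrives
  split_ifs with h <;> simp [h]

end Rules
end StackProg

namespace StackProg

open Chess Function
open Coding (Letter enc)

/-! ### Moves -/

section Moves

-- A formula with many variables is about deeply nested tuples, which make for large instances.
set_option synthInstance.maxSize 100000
set_option synthInstance.maxHeartbeats 1000000
set_option maxHeartbeats 1000000

/-- The squares involved in castling: the king goes from `x` over `u` to `y`, towards the rook on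
`r`. -/
def CastlingLine {n : ℕ} (b : Board n) (d : ℤ × ℤ) (x u y r : Square n) : Prop :=
  Along d 1 x u ∧ Along d 1 u y ∧ r ≠ u ∧ r ≠ y ∧
    ∃ k : ℕ, 0 < k ∧ Along d k x r ∧ ClearPath b d k x

/-- There are at least two squares between king and rook if the rook stands neither on the square
the king crosses nor on the one it reaches. -/
theorem castlingLine_iff {n : ℕ} {b : Board n} {d : ℤ × ℤ} (hd : d = (0, 1) ∨ d = (0, -1))
    {x u y r : Square n} : CastlingLine b d x u y r ↔
      ∃ m : ℕ, 3 ≤ m ∧ Along d 1 x u ∧ Along d 2 x y ∧ Along d m x r ∧ ClearPath b d m x := by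
  constructor
  · rintro ⟨hu, hy, hru, hry, k, hk, hr, hc⟩
    refine ⟨k, ?_, hu, ?_, hr, hc⟩
    · by_contra h
      rw [Along] at hu hy hr
      rw [ne_eq, Prod.ext_iff, Fin.ext_iff, Fin.ext_iff] at hru hry
      rcases hd with rfl | rfl <;> simp only at * <;> omega
    · rw [Along] at *
      push_cast at *
      constructor <;> linarith
  · rintro ⟨m, hm, hu, hy, hr, hc⟩
    refine ⟨hu, ?_, ?_, ?_, m, by omega, hr, hc⟩
    · rw [Along] at *
      push_cast at *
      constructor <;> linarith
    all_goals
      rintro rfl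
      rw [Along] at hu hy hr
      rcases hd with rfl | rfl <;> simp only at * <;> omega

/-- The two squares in front of a pawn on its second rank. -/
theorem forward_iff {n : ℕ} {c : Color} {x e y : Square n} (hx : relRank c x = 1) :
    (relRank c e = 2 ∧ e.2 = x.2 ∧ relRank c y = 3 ∧ y.2 = x.2) ↔
      Forward c x e ∧ Forward c e y := by
  unfold Forward
  constructor
  · rintro ⟨h1, h2, h3, h4⟩
    exact ⟨⟨by omega, h2⟩, by omega, h4.trans h2.symm⟩
  · rintro ⟨⟨h1, h2⟩, h3, h4⟩
    exact ⟨by omega, h2, by omega, h4.trans h2⟩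

/-- The pawn captured en passant, on the rank of the capturing pawn and the file of its destination,
stands behind the destination. -/
theorem eq_iff_forward {n : ℕ} {c : Color} {x y z : Square n} (h : relRank c y = relRank c x + 1) :
    (z.1 = x.1 ∧ z.2 = y.2) ↔ Forward c z y := by
  have h1 := x.1.2
  have h2 := y.1.2
  have h3 := z.1.2
  rw [Forward, Fin.ext_iff, Fin.ext_iff, Fin.ext_iff]
  cases c <;> simp only [relRank, Fin.val_rev] at * <;> omega

/-- The rules for the moves as a formula that speaks only of definable notions. -/
theorem move_iff {n : ℕ} {castling : Bool} {s t : State n} : Move castling s t ↔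
    (∃ (x y : Square n) (k : Kind), k ≠ .pawn ∧ s.board x = some ⟨s.turn, k⟩ ∧
      Attacks s.board ⟨s.turn, k⟩ x y ∧ (s.board y = none ∨ Capturable s.board s.turn y) ∧
      t = s.next (Board.move s.board x y ⟨s.turn, k⟩) {x, y} none) ∨
    (∃ (x y : Square n) (k : Kind), s.board x = some ⟨s.turn, .pawn⟩ ∧ Forward s.turn x y ∧
      s.board y = none ∧ Arrives s.turn y k ∧
      t = s.next (Board.move s.board x y ⟨s.turn, k⟩) {x, y} none) ∨
    (∃ (x e y : Square n) (k : Kind), s.board x = some ⟨s.turn, .pawn⟩ ∧ relRank s.turn x = 1 ∧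
      x ∉ s.touched ∧ Forward s.turn x e ∧ s.board e = none ∧ Forward s.turn e y ∧
      s.board y = none ∧ Arrives s.turn y k ∧
      t = s.next (Board.move s.board x y ⟨s.turn, k⟩) {x, y} (some e)) ∨
    (∃ (x y : Square n) (k : Kind), s.board x = some ⟨s.turn, .pawn⟩ ∧
      Attacks s.board ⟨s.turn, .pawn⟩ x y ∧ Capturable s.board s.turn y ∧ Arrives s.turn y k ∧
      t = s.next (Board.move s.board x y ⟨s.turn, k⟩) {x, y} none) ∨
    (∃ (x y z : Square n) (k : Kind), s.board x = some ⟨s.turn, .pawn⟩ ∧ s.passed = some y ∧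
      Attacks s.board ⟨s.turn, .pawn⟩ x y ∧ s.board y = none ∧ Forward s.turn z y ∧
      s.board z = some ⟨s.turn.other, .pawn⟩ ∧ Arrives s.turn y k ∧
      t = s.next (update (Board.move s.board x y ⟨s.turn, k⟩) z none) {x, y, z} none) ∨
    (castling = true ∧ ∃ x u y r : Square n, s.board x = some ⟨s.turn, .king⟩ ∧
      relRank s.turn x = 0 ∧ x ∉ s.touched ∧ s.board r = some ⟨s.turn, .rook⟩ ∧ r ∉ s.touched ∧
      (CastlingLine s.board (0, 1) x u y r ∨ CastlingLine s.board (0, -1) x u y r) ∧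
      ¬ AttackedBy s.board s.turn.other x ∧ ¬ AttackedBy s.board s.turn.other u ∧
      ¬ AttackedBy s.board s.turn.other y ∧
      t = s.next (Board.move (Board.move s.board x y ⟨s.turn, .king⟩) r u ⟨s.turn, .rook⟩)
        {x, u, y, r} none) := by
  constructor
  · rintro (⟨x, y, k, h1, h2, h3, h4⟩ | ⟨x, y, k, h1, h2, h3, h4, h5⟩ |
      ⟨x, e, y, k, h1, h2, h3, h4, h5, h6, h7, h8, h9, h10⟩ | ⟨x, y, k, h1, h2, h3, h4⟩ |
      ⟨x, y, z, k, h1, h2, h3, h4, h5, h6, h7, h8⟩ |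
      ⟨x, u, y, r, d, m, h1, h2, h3, h4, h5, h6, h7, h8, h9, h10, h11, h12, h13, h14, h15⟩)
    · exact .inl ⟨x, y, k, h1, h2, h3, h4, rfl⟩
    · exact .inr (.inl ⟨x, y, k, h1, ⟨h2, h3⟩, h4, h5, rfl⟩)
    · obtain ⟨h, h'⟩ := (forward_iff h2).1 ⟨h4, h5, h7, h8⟩
      exact .inr (.inr (.inl ⟨x, e, y, k, h1, h2, h3, h, h6, h', h9, h10, rfl⟩))
    · exact .inr (.inr (.inr (.inl ⟨x, y, k, h1, h2, h3, h4, rfl⟩)))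
    · exact .inr (.inr (.inr (.inr (.inl ⟨x, y, z, k, h1, h2, h3, h4,
        (eq_iff_forward h3.1).1 ⟨h5, h6⟩, h7, h8, rfl⟩))))
    · have := (castlingLine_iff h7).2 ⟨m, h8, h9, h10, h11, h12⟩
      refine .inr (.inr (.inr (.inr (.inr ⟨h1, x, u, y, r, h2, h3, h4, h5, h6, ?_, h13, h14, h15,
        rfl⟩))))
      rcases h7 with rfl | rfl
      exacts [.inl this, .inr this]
  · rintro (⟨x, y, k, h1, h2, h3, h4, rfl⟩ | ⟨x, y, k, h1, ⟨h2, h3⟩, h4, h5, rfl⟩ |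
      ⟨x, e, y, k, h1, h2, h3, h, h6, h', h9, h10, rfl⟩ | ⟨x, y, k, h1, h2, h3, h4, rfl⟩ |
      ⟨x, y, z, k, h1, h2, h3, h4, h, h7, h8, rfl⟩ |
      ⟨h1, x, u, y, r, h2, h3, h4, h5, h6, h, h13, h14, h15, rfl⟩)
    · exact .piece x y k h1 h2 h3 h4
    · exact .pawnStep x y k h1 h2 h3 h4 h5
    · obtain ⟨h4, h5, h7, h8⟩ := (forward_iff h2).2 ⟨h, h'⟩
      exact .pawnDoubleStep x e y k h1 h2 h3 h4 h5 h6 h7 h8 h9 h10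
    · exact .pawnCapture x y k h1 h2 h3 h4
    · obtain ⟨h5, h6⟩ := (eq_iff_forward h3.1).2 h
      exact .enPassant x y z k h1 h2 h3 h4 h5 h6 h7 h8
    · rcases h with h | h
      · obtain ⟨m, h8, h9, h10, h11, h12⟩ := (castlingLine_iff (.inl rfl)).1 h
        exact .castle x u y r _ m h1 h2 h3 h4 h5 h6 (.inl rfl) h8 h9 h10 h11 h12 h13 h14 h15
      · obtain ⟨m, h8, h9, h10, h11, h12⟩ := (castlingLine_iff (.inr rfl)).1 h
        exact .castle x u y r _ m h1 h2 h3 h4 h5 h6 (.inr rfl) h8 h9 h10 h11 h12 h13 h14 h15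

variable {E : ℕ → Type} [Coding E]

instance Definable.castlingLine (d : ℤ × ℤ) {b : ∀ n, E n → Board n}
    {x u y r : ∀ n, E n → Square n} [Letterwise (Y := Board) b] [Letterwise x] [Letterwise u]
    [Letterwise y] [Letterwise r] :
    Definable fun n e => CastlingLine (b n e) d (x n e) (u n e) (y n e) (r n e) := by
  unfold CastlingLine
  infer_instance

instance Definable.move (castling : Bool) {s t : ∀ n, E n → State n} [Letterwise s]
    [Letterwise t] : Definable fun n e => Move castling (s n e) (t n e) := by
  suffices h : Definable fun n (e : State n × State n) => Move castling e.1 e.2 from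
    h.comp fun n e => (s n e, t n e)
  simp only [move_iff]
  infer_instance

instance Definable.legalMove (castling : Bool) {s t : ∀ n, E n → State n} [Letterwise s]
    [Letterwise t] : Definable fun n e => LegalMove castling (s n e) (t n e) := by
  unfold LegalMove
  infer_instance

instance Definable.reaches (castling : Bool) {s t : ∀ n, E n → State n} [Letterwise s]
    [Letterwise t] : Definable fun n e => Reaches castling (s n e) (t n e) := by
  unfold Reaches
  infer_instance

instance Definable.checkmated (castling : Bool) (c : Color) {s : ∀ n, E n → State n}
    [Letterwise s] : Definable fun n e => Checkmated castling (s n e) c := by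
  suffices h : Definable fun n (s : State n) => Checkmated castling s c from h.comp s
  unfold Checkmated
  infer_instance

instance Definable.valid {p : ∀ n, E n → Position n} [Letterwise p] :
    Definable fun n e => (p n e).Valid := by
  suffices h : Definable fun n (p : Position n) => p.Valid from h.comp p
  unfold Position.Valid
  infer_instance

instance Definable.card_ge (q : ℚ) (m : ℕ) {b : ∀ n, E n → Board n} {c : ∀ n, E n → Color}
    {k : ∀ n, E n → Kind} [hb : Letterwise (Y := Board) b] [hc : Letterwise c]
    [hk : Letterwise k] : Definable fun n e => q * n + m ≤
      ((Finset.univ.filter fun s : Square n => b n e s = some ⟨c n e, k n e⟩).card : ℚ) := by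
  obtain ⟨fb, hb⟩ := hb
  obtain ⟨fc, hc⟩ := hc
  obtain ⟨fk, hk⟩ := hk
  -- The inequality is multiplied by the denominator of `q`.
  let ω : Letter E → ℤ := by
    classical
    exact fun a => if fb a = some (Piece.mk (fc a) (fk a)) then q.den else 0
  refine (Definable.sum_nonneg ω (-(m * q.den)) (-q.num)).congr fun n e => ?_
  have h1 : ∑ z, ω (enc e z) = q.den *
      (Finset.univ.filter fun s : Square n => b n e s = some ⟨c n e, k n e⟩).card := by
    rw [Finset.card_filter, Nat.cast_sum, Finset.mul_sum]
    refine Finset.sum_congr rfl fun z _ => ?_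
    have h1 : b n e z = fb (enc e z) := hb n e z
    have h2 : c n e = fc (enc e z) := hc n e z
    have h3 : k n e = fk (enc e z) := hk n e z
    have h4 : (fb (enc e z) = some (Piece.mk (fc (enc e z)) (fk (enc e z)))) ↔
        b n e z = some ⟨c n e, k n e⟩ := by rw [h1, h2, h3]
    simp only [ω, h4]
    split_ifs <;> simp
  rw [h1]
  have hq : (0 : ℚ) < q.den := by exact_mod_cast q.den_pos
  have h2 : q * q.den = q.num := Rat.mul_den_eq_num q
  rw [← mul_le_mul_iff_left₀ hq, ← @Int.cast_nonneg_iff ℚ]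
  push_cast
  rw [add_mul, mul_right_comm, h2]
  constructor <;> intro h <;> linarith

instance Definable.isStarting (q : ℚ) (m : ℕ) {p : ∀ n, E n → Position n} [Letterwise p] :
    Definable fun n e => (p n e).IsStarting q m := by
  suffices h : Definable fun n (p : Position n) => p.IsStarting q m from h.comp p
  refine (inferInstance : Definable fun n (p : Position n) => p.turn = .white ∧
    (∀ (c : Color) (s : Square n), relRank c s = 1 → p.board s = some ⟨c, .pawn⟩) ∧
    (∀ (c : Color) (s : Square n), relRank c s = 0 →
      ∃ k : Kind, k ≠ .pawn ∧ p.board s = some ⟨c, k⟩) ∧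
    (∀ s : Square n, (∀ c : Color, ¬ relRank c s = 0 ∧ ¬ relRank c s = 1) → p.board s = none) ∧
    (∀ c : Color, ∃! s : Square n, p.board s = some ⟨c, .king⟩) ∧
    ∀ (c : Color) (k : Kind), k ≠ .pawn → k ≠ .king →
      q * n + m ≤ ((Finset.univ.filter fun s : Square n => p.board s = some ⟨c, k⟩).card : ℚ)).congr
      fun n p => ?_
  have h : ∀ (s : Square n) (c : Color), (¬ relRank c s = 0 ∧ ¬ relRank c s = 1) ↔
      2 ≤ relRank c s := fun s c => by omega
  simp only [h]
  exact ⟨fun ⟨h1, h2, h3, h4, h5, h6⟩ => ⟨h1, h2, h3, h4, h5, h6⟩,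
    fun ⟨h1, h2, h3, h4, h5, h6⟩ => ⟨h1, h2, h3, h4, h5, h6⟩⟩

theorem definable_helpmate (castling : Bool) : Definable fun n (p : Position n) =>
    p.Valid ∧ ∃ t : State n, Reaches castling p.toState t ∧ Checkmated castling t .black :=
  Definable.and (h := Definable.valid (p := fun _ p => p))

theorem definable_reachability (castling : Bool) (q : ℚ) (m : ℕ) :
    Definable fun n (p : Position n) => ∃ (p₀ : Position n) (t : State n), p₀.IsStarting q m ∧
      Reaches castling p₀.toState t ∧ t.toPosition = p :=
  inferInstance

end Moves
end StackProg

namespace StackProg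

open Chess Function
open Coding (enc)

/-! ### The words for positions -/

/-- The letters of the word for a position. -/
noncomputable def letters {n : ℕ} (p : Position n) (i : Fin (len n)) : Letter :=
  (word p.board i).elim (if (i : ℕ) = 0 then .toMove p.turn else .endOfRank) .square

theorem encode_eq {n : ℕ} (p : Position n) : p.encode = List.ofFn (letters p) := by
  have h : List.ofFn (letters p) = letters p (0 : Fin (n * (n + 1) + 1)) ::
      List.ofFn fun i : Fin (n * (n + 1)) => letters p i.succ := List.ofFn_succ
  rw [h, List.ofFn_mul, Position.encode, List.flatMap_def, List.ofFn_eq_map]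
  congr 1
  · have h : ∀ i : Fin (len n), (i : ℕ) = 0 → letters p i = .toMove p.turn := fun i hi => by
      rw [letters, word_eq_none.2 (by rw [hi, Nat.zero_mod]), Option.elim_none, if_pos hi]
    exact (h _ rfl).symm
  · congr 1
    refine List.map_congr_left fun i _ => ?_
    rw [List.ofFn_succ_last, List.ofFn_eq_map]
    congr 1
    · refine List.map_congr_left fun j _ => ?_
      have : letters p (index (i, j)) = .square (p.board (i, j)) := by
        rw [letters, word_index]
        rfl
      exact this.symm
    · congr 1
      have h : ∀ l : Fin (len n), (l : ℕ) = i * (n + 1) + n + 1 → letters p l = .endOfRank := by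
        intro l hl
        rw [letters, word_eq_none.2, Option.elim_none, if_neg (by omega)]
        rw [hl, add_assoc, Nat.mul_add_mod_self_right, Nat.mod_self]
      exact (h _ rfl).symm

instance : Finite Letter := by
  have : Function.Surjective fun x : Color ⊕ Option (Option Piece) =>
      x.elim Letter.toMove fun o => o.elim Letter.endOfRank Letter.square := by
    rintro (c | o | _)
    exacts [⟨.inl c, rfl⟩, ⟨.inr (some o), rfl⟩, ⟨.inr none, rfl⟩]
  exact Finite.of_surjective _ this

/-- Whether a letter names the player to move. -/
def isToMove : Letter → Bool
  | .toMove _ => true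
  | _ => false

/-- The contents of a square. -/
def content : Letter → Option (Option Piece)
  | .square o => some o
  | _ => none

/-- The letter in the representation of positions with the player `c` to move. -/
def positionLetter (c : Color) (a : Letter) : Option (Option Piece × Color) :=
  (content a).map fun o => (o, c)

/-- A word of the right length is the code of a position if its letters are of the right kinds:
contents of squares at the places of squares, and the player to move at the first place only. -/
theorem eq_letters_iff {n : ℕ} (w : Fin (len n) → Letter) (c : Color) :
    (∃ p : Position n, w = letters p ∧ p.turn = c) ↔
      (∀ i : Fin (len n), content (w i) = none ↔ (i : ℕ) % (n + 1) = 0) ∧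
      (∀ i : Fin (len n), isToMove (w i) = true ↔ (i : ℕ) = 0) ∧
      ∀ i c', w i = .toMove c' → c' = c := by
  constructor
  · rintro ⟨p, rfl, rfl⟩
    have h : ∀ i : Fin (len n), (i : ℕ) % (n + 1) = 0 →
        letters p i = if (i : ℕ) = 0 then .toMove p.turn else .endOfRank := fun i hi => by
      rw [letters, word_eq_none.2 hi, Option.elim_none]
    have h' : ∀ z, letters p (index z) = .square (p.board z) := fun z => by
      rw [letters, word_index, Option.elim_some]
    refine ⟨fun i => ?_, fun i => ?_, fun i c' => ?_⟩ <;>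
    · by_cases hi : (i : ℕ) % (n + 1) = 0
      · rw [h i hi]
        split_ifs with h0 <;> simp [content, isToMove, h0, hi, eq_comm]
      · obtain ⟨z, rfl⟩ := exists_index hi
        have h0 : (index z : ℕ) ≠ 0 := fun h0 => hi (by rw [h0, Nat.zero_mod])
        rw [h']
        simp [content, isToMove, hi, h0]
  · rintro ⟨h1, h2, h3⟩
    refine ⟨⟨fun z => (content (w (index z))).getD none, c⟩, funext fun i => ?_, rfl⟩
    have k1 := h1 i
    have k2 := h2 i
    by_cases hi : (i : ℕ) % (n + 1) = 0
    · rw [letters, word_eq_none.2 hi, Option.elim_none]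
      cases hw : w i with
      | toMove c' =>
        rw [hw] at k2
        rw [if_pos (k2.1 rfl), h3 i c' hw]
      | square o => simp [hw, content, hi] at k1
      | endOfRank =>
        rw [hw] at k2
        rw [if_neg fun h => by simpa [isToMove] using k2.2 h]
    · obtain ⟨z, rfl⟩ := exists_index hi
      rw [letters, word_index, Option.elim_some]
      cases hw : w (index z) with
      | toMove c' => simp [hw, content, hi] at k1
      | square o => simp [hw, content]
      | endOfRank => simp [hw, content, hi] at k1

/-- The player to move is a letter at the first place of the input, whereas it belongs to the
letters of all squares in the representation of positions. Hence the input is translated for each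
player separately, and the input must then name that player. On a board without squares the
representation does not tell positions apart, hence the hypothesis `h₀`. -/
theorem mem_PSPACE_of_definable {P : ∀ n, Position n → Prop} [h : Definable P]
    (h₀ : ∀ p, ¬ P 0 p) :
    {w | ∃ (n : ℕ) (p : Position n), w = p.encode ∧ P n p} ∈ PolySpace.PSPACE Letter := by
  have := Fintype.ofFinite Letter
  obtain ⟨L, h1, h2⟩ := h
  refine PS.mem_PSPACE ?_
  have key : ∀ c, PS fun N (w : Fin N → Letter) =>
      ((∃ n > 0, N = len n ∧ ∀ i, (content (w i)).isNone = true ↔ (i : ℕ) % (n + 1) = 0) ∧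
      (fun i => !isToMove (w i)) = shiftBy 1 (fun _ => true)) ∧
      (∀ i, ∀ c', w i = .toMove c' → c' = c) ∧ L N (positionLetter c ∘ w) := fun c =>
    ((PS.shape.comap fun a : Letter => (content a).isNone).and
      (PS.shift_one.comap fun a : Letter => (true, !isToMove a))).and
      ((PS.all fun a : Letter => ∀ c', a = .toMove c' → c' = c).and
        (h1.comap (positionLetter c)))
  refine (PS.exists_finite key).congr fun N w => ?_
  have hfirst : (fun i => !isToMove (w i)) = shiftBy 1 (fun _ => true) ↔
      ∀ i, isToMove (w i) = true ↔ (i : ℕ) = 0 := by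
    rw [funext_iff]
    refine forall_congr' fun i => ?_
    by_cases hi : (i : ℕ) = 0
    · simp [shiftBy, hi]
    · simp [shiftBy, hi, Nat.one_le_iff_ne_zero]
  have hword : ∀ {n : ℕ} (p : Position n), positionLetter p.turn ∘ letters p = word (enc p) := by
    intro n p
    refine eq_word (fun z => ?_) fun i hi => ?_
    · simp only [comp_apply, letters, word_index]
      rfl
    · simp only [comp_apply, letters, word_eq_none.2 hi, Option.elim_none]
      split_ifs <;> rfl
  rw [hfirst]
  constructor
  · rintro ⟨c, ⟨⟨n, hn, rfl, hd⟩, hf⟩, hc, hL⟩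
    obtain ⟨p, rfl, rfl⟩ := (eq_letters_iff w c).2
      ⟨fun i => by rw [← hd, Option.isNone_iff_eq_none], hf, hc⟩
    rw [hword, h2 n hn] at hL
    exact ⟨n, p, (encode_eq p).symm, hL⟩
  · rintro ⟨n, p, he, hp⟩
    have hn : 0 < n := by
      rcases Nat.eq_zero_or_pos n with rfl | hn
      · exact absurd hp (h₀ p)
      · exact hn
    rw [encode_eq] at he
    obtain rfl : N = len n := by simpa using congrArg List.length he
    obtain rfl := List.ofFn_injective he
    obtain ⟨k1, k2, k3⟩ := (eq_letters_iff (letters p) p.turn).1 ⟨p, rfl, rfl⟩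
    refine ⟨p.turn, ⟨⟨n, hn, rfl, fun i => by rw [← k1, Option.isNone_iff_eq_none]⟩, k2⟩, k3, ?_⟩
    rw [hword, h2 n hn]
    exact hp

end StackProg

theorem mainTheorem3 (castling : Bool) (q : ℚ) (m : ℕ) :
    Chess.helpmate castling ∈ PolySpace.PSPACE Chess.Letter ∧
      Chess.reachability castling q m ∈ PolySpace.PSPACE Chess.Letter := by
  -- There are no kings on an empty board.
  constructor
  · refine StackProg.mem_PSPACE_of_definable
      (h := StackProg.definable_helpmate castling) fun p h => ?_
    obtain ⟨s, -⟩ := h.1.1 .white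
    exact s.1.elim0
  · refine StackProg.mem_PSPACE_of_definable
      (h := StackProg.definable_reachability castling q m) fun p h => ?_
    obtain ⟨p₀, -, h, -⟩ := h
    obtain ⟨s, -⟩ := h.one_king .white
    exact s.1.elim0
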